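/- Let $M_1$ and $M_2$ be complex manifolds (finite-dimensional, Hausdorff, second countable), and let $\upsilon_1\colon M_1\to[1,+\infty)$ and $\upsilon_2\colon M_2\to[1,+\infty)$ be locally bounded functions. Set $\upsilon(x_1,x_2):=\upsilon_1(x_1)\upsilon_2(x_2)$ on $M_1\times M_2$. Notation. For a complex manifold $M$, $\mathcal O(M)$ is the space of holomorphic functions on $M$ with the topology of uniform convergence on compact sets, and $\mathcal A(M):=\mathcal O(M)'$ is its strong dual. For a locally bounded function $\upsilon\colon M\to[1,+\infty)$, let $V_\upsilon$ be the closure in $\mathcal A(M)$ of the absolutely convex hull of $\{\upsilon(x)^{-1}\delta_x : x\in M\}$, let $\|\cdot\|_\upsilon$ be the Minkowski functional of $V_\upsilon$, let $\mathcal A_\upsilon(M)$ be the (Hausdorff) completion of $\mathcal A(M)$ with respect to $\|\cdot\|_\upsilon$, and let $\mathcal A_{\upsilon^\infty}(M)$ be the (Hausdorff) completion of $\mathcal A(M)$ with respect to the sequence of prenorms $\|\cdot\|_{\upsilon^n}$, $n\in\mathbb N$, where $\upsilon^n(x):=\upsilon(x)^n$. Let $\mathcal O_{\upsilon}(M):=\{f\in\mathcal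 O(M): |f|_\upsilon:=\sup_{x\in M}\upsilon(x)^{-1}|f(x)|<\infty\}$ with the norm $|\cdot|_\upsilon$, and let $\mathcal O_{\upsilon^\infty}(M):=\bigcup_{n\in\mathbb N}\mathcal O_{\upsilon^n}(M)$ with the locally convex inductive limit topology. $E\widehat\otimes F$ denotes the complete projective tensor product of locally convex spaces. (A) The natural map $\rho\colon\mathcal A(M_1)\otimes\mathcal A(M_2)\to\mathcal A(M_1\times M_2)$, $\rho(a\otimes b)(F)=a\bigl(x\mapsto b(F(x,\cdot))\bigr)$, induces a topological isomorphism of Banach spaces $$\mathcal A_{\upsilon_1}(M_1)\,\widehat\otimes\,\mathcal A_{\upsilon_2}(M_2)\cong\mathcal A_{\upsilon}(M_1\times M_2)$$ and a topological isomorphism of Fréchet spaces $$\mathcal A_{\upsilon_1^\infty}(M_1)\,\widehat\otimes\,\mathcal A_{\upsilon_2^\infty}(M_2)\cong\mathcal A_{\upsilon^\infty}(M_1\times M_2).$$ (B) If, in addition, $\mathcal A_{\upsilon_1^\infty}(M_1)$ and $\mathcal A_{\upsilon_2^\infty}(M_2)$ are nuclear, then the natural map $\mathcal O(M_1)\otimes\mathcal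 O(M_2)\to\mathcal O(M_1\times M_2)$, $f\otimes g\mapsto\bigl((x,y)\mapsto f(x)g(y)\bigr)$, induces a topological isomorphism of locally convex spaces $$\mathcal O_{\upsilon_1^\infty}(M_1)\,\widehat\otimes\,\mathcal O_{\upsilon_2^\infty}(M_2)\cong\mathcal O_{\upsilon^\infty}(M_1\times M_2).$$ -/

import Mathlib

open scoped Manifold Topology TensorProduct Uniformity ENNReal ComplexOrder Pointwise
open Set Filter Metric

noncomputable section

namespace AnalyticFunctional

/-! ### Locally convex spaces -/

section LocallyConvex

/-- The finest locally convex vector space topology on `X` among those satisfying `P`.  The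
infimum (in Mathlib's order: the coarsest common refinement) of locally convex vector topologies is
again one; it satisfies `P` whenever `P` asks for the continuity of maps into `X`. -/
abbrev finestLCTopology (X : Type*) [AddCommGroup X] [Module ℂ X]
    (P : TopologicalSpace X → Prop) : TopologicalSpace X :=
  sInf {t | @IsTopologicalAddGroup X t _ ∧ @ContinuousSMul ℂ X _ _ t ∧
    @LocallyConvexSpace ℝ X _ _ _ _ t ∧ P t}

variable (X Y : Type*) [AddCommGroup X] [Module ℂ X] [TopologicalSpace X]
  [AddCommGroup Y] [Module ℂ Y] [TopologicalSpace Y]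

/-- The algebraic tensor product, to be endowed with the projective topology. -/
def ProjTensor : Type _ := X ⊗[ℂ] Y

instance : AddCommGroup (ProjTensor X Y) := inferInstanceAs (AddCommGroup (X ⊗[ℂ] Y))

instance : Module ℂ (ProjTensor X Y) := inferInstanceAs (Module ℂ (X ⊗[ℂ] Y))

variable {X Y} in
/-- Elementary tensors. -/
def ProjTensor.tmul (x : X) (y : Y) : ProjTensor X Y := x ⊗ₜ[ℂ] y

/-- The projective topology: the finest locally convex topology on `X ⊗ Y` for which the canonical
bilinear map `X × Y → X ⊗ Y` is (jointly) continuous. -/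
@[reducible]
def projTopology : TopologicalSpace (ProjTensor X Y) :=
  finestLCTopology (ProjTensor X Y) fun t =>
    @Continuous _ _ _ t fun p : X × Y => ProjTensor.tmul p.1 p.2

theorem isTopologicalAddGroup_projTopology :
    @IsTopologicalAddGroup (ProjTensor X Y) (projTopology X Y) _ :=
  topologicalAddGroup_sInf fun _ ht => ht.1

instance : UniformSpace (ProjTensor X Y) :=
  @IsTopologicalAddGroup.rightUniformSpace _ _ (projTopology X Y)
    (isTopologicalAddGroup_projTopology X Y)

instance : IsTopologicalAddGroup (ProjTensor X Y) := isTopologicalAddGroup_projTopology X Y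

instance : IsUniformAddGroup (ProjTensor X Y) := isUniformAddGroup_of_addCommGroup

instance : ContinuousSMul ℂ (ProjTensor X Y) := continuousSMul_sInf fun _ ht => ht.2.1

instance : UniformContinuousConstSMul ℂ (ProjTensor X Y) :=
  uniformContinuousConstSMul_of_continuousConstSMul _ _

/-- The complete projective tensor product: the Hausdorff completion of `X ⊗ Y` with the projective
topology. -/
abbrev CompletedTensor : Type _ := UniformSpace.Completion (ProjTensor X Y)

variable {X Y} in
/-- The image of an elementary tensor in the complete projective tensor product. -/
def ctmul (x : X) (y : Y) : CompletedTensor X Y := (ProjTensor.tmul x y : ProjTensor X Y)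

variable {X} in
/-- The space `X` with the single seminorm `p`. -/
def SeminormSpace (_p : Seminorm ℂ X) : Type _ := X

section SeminormSpace

variable {X} (p : Seminorm ℂ X)

instance : SeminormedAddCommGroup (SeminormSpace p) :=
  @AddGroupSeminorm.toSeminormedAddCommGroup X _ p.toAddGroupSeminorm

instance : Module ℂ (SeminormSpace p) := inferInstanceAs (Module ℂ X)

instance : NormedSpace ℂ (SeminormSpace p) where
  norm_smul_le c x := (map_smul_eq_mul p c x).le

/-- The identity map from `X` to `(X, p)`. -/
def SeminormSpace.of (x : X) : SeminormSpace p := x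

/-- The Banach space associated with a seminorm `p`: the Hausdorff completion of `(X, p)`. -/
abbrev LocalBanach : Type _ := UniformSpace.Completion (SeminormSpace p)

/-- The canonical map from `X` to the Banach space associated with `p`. -/
def toLocalBanach (x : X) : LocalBanach p := (SeminormSpace.of p x : LocalBanach p)

end SeminormSpace

/-- A locally convex space `X` is nuclear if for each continuous seminorm `p` the canonical map from
`X` to the Banach space `X_p` is nuclear, that is, has the form `x ↦ ∑ fₙ(x) yₙ` with an
equicontinuous sequence of functionals `fₙ` and an absolutely summable sequence `yₙ` in `X_p`. -/
def IsNuclear : Prop :=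
  ∀ p : Seminorm ℂ X, Continuous p →
    ∃ (q : Seminorm ℂ X) (f : ℕ → X →L[ℂ] ℂ) (y : ℕ → LocalBanach p),
      Continuous q ∧ (∀ n x, ‖f n x‖ ≤ q x) ∧ (Summable fun n => ‖y n‖) ∧
      ∀ x, HasSum (fun n => f n x • y n) (toLocalBanach p x)

end LocallyConvex

/-! ### Extended pseudometrics given by Minkowski functionals -/

section Minkowski

variable {X : Type*} [AddCommGroup X] [Module ℂ X] {V : Set X}

/-- The closure of the absolutely convex hull of `s`.  (The point `0`, which lies in the hull as soon
as `s` is nonempty, is inserted so that the hull of the empty set is `{0}`.) -/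
def closedAcv [TopologicalSpace X] (s : Set X) : Set X :=
  closure (absConvexHull ℂ (insert 0 s))

theorem absConvex_closedAcv [TopologicalSpace X] [IsTopologicalAddGroup X] [ContinuousSMul ℂ X]
    (s : Set X) : AbsConvex ℂ (closedAcv s) :=
  absConvex_absConvexHull.closure

theorem zero_mem_closedAcv [TopologicalSpace X] (s : Set X) : (0 : X) ∈ closedAcv s :=
  subset_closure (subset_absConvexHull (mem_insert _ _))

theorem egauge_add_le (hV : AbsConvex ℂ V) (x y : X) :
    egauge ℂ V (x + y) ≤ egauge ℂ V x + egauge ℂ V y := by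
  refine ENNReal.le_of_forall_pos_le_add fun ε hε hlt => ?_
  obtain ⟨hx, hy⟩ := ENNReal.add_lt_top.1 hlt
  have hε2 : ((ε / 2 : NNReal) : ℝ≥0∞) ≠ 0 := by
    simpa using hε.ne'
  obtain ⟨c, hc, hcx⟩ := egauge_lt_iff.1 (ENNReal.lt_add_right hx.ne hε2)
  obtain ⟨d, hd, hdy⟩ := egauge_lt_iff.1 (ENNReal.lt_add_right hy.ne hε2)
  have hc' : x ∈ ((‖c‖ : ℝ) : ℂ) • V := hV.1.smul_mono (a := c) (by simp) hc
  have hd' : y ∈ ((‖d‖ : ℝ) : ℂ) • V := hV.1.smul_mono (a := d) (by simp) hd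
  have hmem : x + y ∈ ((‖c‖ + ‖d‖ : ℝ) : ℂ) • V := by
    obtain ⟨u, hu, rfl⟩ := hc'
    obtain ⟨v, hv, rfl⟩ := hd'
    rcases (add_nonneg (norm_nonneg c) (norm_nonneg d)).eq_or_lt with h | h
    · have h1 : ‖c‖ = 0 := by linarith [norm_nonneg c, norm_nonneg d]
      have h2 : ‖d‖ = 0 := by linarith [norm_nonneg c, norm_nonneg d]
      refine ⟨u, hu, ?_⟩
      simp [h1, h2]
    · refine ⟨((‖c‖ / (‖c‖ + ‖d‖) : ℝ) : ℂ) • u + ((‖d‖ / (‖c‖ + ‖d‖) : ℝ) : ℂ) • v,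
        hV.2 hu hv ?_ ?_ ?_, ?_⟩
      · exact Complex.zero_le_real.2 (by positivity)
      · exact Complex.zero_le_real.2 (by positivity)
      · rw [← Complex.ofReal_add, ← add_div, div_self h.ne', Complex.ofReal_one]
      · simp only [smul_add, smul_smul, ← Complex.ofReal_mul]
        rw [mul_div_cancel₀ _ h.ne', mul_div_cancel₀ _ h.ne']
  calc egauge ℂ V (x + y) ≤ ‖((‖c‖ + ‖d‖ : ℝ) : ℂ)‖ₑ := egauge_le_of_mem_smul hmem
    _ = ‖c‖ₑ + ‖d‖ₑ := by
      rw [← ofReal_norm, Complex.norm_real, Real.norm_of_nonneg (by positivity),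
        ENNReal.ofReal_add (norm_nonneg _) (norm_nonneg _), ofReal_norm, ofReal_norm]
    _ ≤ (egauge ℂ V x + (ε / 2 : NNReal)) + (egauge ℂ V y + (ε / 2 : NNReal)) :=
      add_le_add hcx.le hdy.le
    _ = egauge ℂ V x + egauge ℂ V y + ε := by
      rw [add_add_add_comm, ← ENNReal.coe_add, add_halves]

/-- The pseudometric `‖x - y‖_V` given by the Minkowski functional
`‖x‖_V = inf {|c| : x ∈ c V} ∈ [0, ∞]` of an absolutely convex set `V` containing `0`. -/
abbrev minkowskiPseudoEMetric (hV : AbsConvex ℂ V) (h0 : (0 : X) ∈ V) : PseudoEMetricSpace X where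
  edist x y := egauge ℂ V (x - y)
  edist_self x := by rw [sub_self, egauge_zero_right _ ⟨0, h0⟩]
  edist_comm x y := by
    have := egauge_smul_right (𝕜 := ℂ) (c := -1) (s := V) (fun h => absurd h (by simp)) (x - y)
    simpa using this.symm
  edist_triangle x y z := by
    have := egauge_add_le hV (x - y) (y - z)
    rwa [sub_add_sub_cancel] at this

/-- The uniform structure defined by the Minkowski functional. -/
abbrev minkowskiUniformSpace (hV : AbsConvex ℂ V) (h0 : (0 : X) ∈ V) : UniformSpace X :=
  (minkowskiPseudoEMetric hV h0).toUniformSpace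

theorem isUniformAddGroup_minkowski (hV : AbsConvex ℂ V) (h0 : (0 : X) ∈ V) :
    @IsUniformAddGroup X (minkowskiUniformSpace hV h0) _ := by
  let _ := minkowskiPseudoEMetric hV h0
  refine ⟨LipschitzWith.uniformContinuous (K := 2) fun p q => ?_⟩
  have h1 : edist p.1 q.1 ≤ edist p q := le_max_left _ _
  have h2 : edist p.2 q.2 ≤ edist p q := le_max_right _ _
  have h3 : edist (p.1 - p.2) (q.1 - q.2) ≤ edist p.1 q.1 + edist q.2 p.2 := by
    refine le_trans (le_of_eq ?_) (egauge_add_le hV (p.1 - q.1) (q.2 - p.2))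
    change egauge ℂ V _ = egauge ℂ V _
    congr 1
    abel
  rw [edist_comm q.2] at h3
  refine h3.trans ((add_le_add h1 h2).trans (le_of_eq ?_))
  rw [← two_mul]
  rfl

theorem uniformContinuous_smul_minkowski (hV : AbsConvex ℂ V) (h0 : (0 : X) ∈ V) (c : ℂ) :
    @UniformContinuous X X (minkowskiUniformSpace hV h0) (minkowskiUniformSpace hV h0) (c • ·) := by
  let _ := minkowskiPseudoEMetric hV h0
  refine LipschitzWith.uniformContinuous (K := ‖c‖₊) fun p q => ?_
  change egauge ℂ V (c • p - c • q) ≤ ‖c‖ₑ * egauge ℂ V (p - q)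
  rw [← smul_sub, egauge_smul_right fun _ => ⟨0, h0⟩]

/-- The space `X` with the uniform structure defined by the family of the Minkowski functionals of
the sets `closedAcv (S i)`. -/
def GaugeSpace {X : Type*} {ι : Type} (_S : ι → Set X) : Type _ := X

section GaugeSpace

variable {ι : Type} (S : ι → Set X)

/-- The identity map from `X` to `GaugeSpace S`. -/
def GaugeSpace.of (x : X) : GaugeSpace S := x

instance : AddCommGroup (GaugeSpace S) := inferInstanceAs (AddCommGroup X)

instance : Module ℂ (GaugeSpace S) := inferInstanceAs (Module ℂ X)

variable [TopologicalSpace X] [IsTopologicalAddGroup X] [ContinuousSMul ℂ X]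

instance : UniformSpace (GaugeSpace S) :=
  (⨅ i, minkowskiUniformSpace (absConvex_closedAcv (S i)) (zero_mem_closedAcv (S i)) :
    UniformSpace X)

instance : IsUniformAddGroup (GaugeSpace S) :=
  isUniformAddGroup_iInf fun i =>
    isUniformAddGroup_minkowski (absConvex_closedAcv (S i)) (zero_mem_closedAcv (S i))

instance : UniformContinuousConstSMul ℂ (GaugeSpace S) where
  uniformContinuous_const_smul c := uniformContinuous_iInf_rng.2 fun i =>
    uniformContinuous_iInf_dom (i := i)
      (uniformContinuous_smul_minkowski (absConvex_closedAcv (S i)) (zero_mem_closedAcv (S i)) c)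

/-- The completion of `X` with respect to the Minkowski functionals of the sets
`closedAcv (S i)`. -/
abbrev GaugeCompletion : Type _ := UniformSpace.Completion (GaugeSpace S)

/-- The canonical map from `X` to its completion. -/
def toGaugeCompletion (x : X) : GaugeCompletion S := (GaugeSpace.of S x : GaugeCompletion S)

end GaugeSpace

end Minkowski

/-! ### Holomorphic functions and analytic functionals

A complex manifold is a charted space `M` over a model with corners `I` without boundary on a
finite-dimensional complex normed space `E`, with `IsManifold I 1 M`: over `ℂ` this says that the
transition maps are complex differentiable with continuous derivative, that is, holomorphic. -/

/-- Second order Taylor estimate for holomorphic functions on a ball. -/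
theorem second_order_bound {E : Type*} [NormedAddCommGroup E] [NormedSpace ℂ E] {f : E → ℂ} {c z : E}
    {R B : ℝ} (hd : DifferentiableOn ℂ f (ball c R)) (hB : ∀ w ∈ ball c R, ‖f w‖ ≤ B)
    (hz : z ∈ ball c R) :
    ‖fderiv ℂ f c‖ ≤ 2 * B / R ∧
      ‖f z - f c - fderiv ℂ f c (z - c)‖ ≤ 4 * B * (‖z - c‖ / R) ^ 2 := by
  have hR : 0 < R := nonempty_ball.mp ⟨_, hz⟩
  have hc : c ∈ ball c R := mem_ball_self hR
  have hdc : DifferentiableAt ℂ f c := hd.differentiableAt (ball_mem_nhds _ hR)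
  have hdiff : ∀ w ∈ ball c R, ‖f w - f c‖ ≤ 2 * B := fun w hw =>
    (norm_sub_le _ _).trans (by linarith [hB w hw, hB c hc])
  have h1 : ‖fderiv ℂ f c‖ ≤ 2 * B / R :=
    Complex.norm_fderiv_le_div_of_mapsTo_ball hd
      (fun w hw => by simpa [dist_eq_norm] using hdiff w hw) hR
  refine ⟨h1, ?_⟩
  have key := Complex.dist_le_mul_div_pow_of_mapsTo_ball_of_isLittleO (n := 1) (c := c) (z := z)
    (f := fun w => f w - fderiv ℂ f c (w - c)) (R₁ := R) (R₂ := 4 * B)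
    (hd.sub (by fun_prop)) ?_ ?_ hz
  · simpa [dist_eq_norm, sub_right_comm] using key
  · intro w hw
    have h2 : ‖fderiv ℂ f c (w - c)‖ ≤ 2 * B := by
      refine (ContinuousLinearMap.le_of_opNorm_le _ h1 _).trans ?_
      have : ‖w - c‖ ≤ R := by simpa [dist_eq_norm] using (mem_ball.1 hw).le
      have hB0 : 0 ≤ B := (norm_nonneg _).trans (hB c hc)
      calc 2 * B / R * ‖w - c‖ ≤ 2 * B / R * R := by gcongr
        _ = 2 * B := by field_simp
    have := norm_sub_le (f w - f c) (fderiv ℂ f c (w - c))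
    simp only [mem_closedBall, dist_eq_norm, sub_self, map_zero, sub_zero]
    rw [sub_right_comm]
    linarith [hdiff w hw]
  · have := hdc.hasFDerivAt.isLittleO
    simpa [sub_right_comm] using this.norm_right

/-- A continuous `C(K, ℂ)`-valued map which is holomorphic pointwise on `K` is holomorphic. -/
theorem differentiableAt_of_pointwise {E : Type*} [NormedAddCommGroup E] [NormedSpace ℂ E]
    {K : Type*} [TopologicalSpace K] [CompactSpace K] {G : E → C(K, ℂ)} {c : E}
    (hG : ContinuousAt G c) {s : Set E} (hs : s ∈ 𝓝 c)
    (hd : ∀ y, DifferentiableOn ℂ (fun z => G z y) s) : DifferentiableAt ℂ G c := by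
  have h1 : ∀ᶠ z in 𝓝 c, ‖G z‖ < ‖G c‖ + 1 :=
    hG.norm.eventually_lt continuousAt_const (lt_add_one _)
  obtain ⟨R, hR, hball⟩ := Metric.mem_nhds_iff.1 (inter_mem hs h1)
  set B := ‖G c‖ + 1
  have hd' : ∀ y, DifferentiableOn ℂ (fun z => G z y) (ball c R) := fun y =>
    (hd y).mono fun z hz => (hball hz).1
  have hB : ∀ y, ∀ z ∈ ball c R, ‖G z y‖ ≤ B := fun y z hz =>
    ((G z).norm_coe_le_norm y).trans (hball hz).2.le
  set L : K → E →L[ℂ] ℂ := fun y => fderiv ℂ (fun z => G z y) c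
  have hL1 : ∀ y, ‖L y‖ ≤ 2 * B / R := fun y =>
    (second_order_bound (hd' y) (hB y) (mem_ball_self hR)).1
  have hL2 : ∀ y, ∀ z ∈ ball c R, ‖G z y - G c y - L y (z - c)‖ ≤ 4 * B * (‖z - c‖ / R) ^ 2 :=
    fun y z hz => (second_order_bound (hd' y) (hB y) hz).2
  have hB0 : 0 < B := by positivity
  have hcont : ∀ h : E, Continuous fun y => L y h := by
    intro h
    refine continuous_of_uniform_approx_of_continuous fun u hu => ?_
    obtain ⟨ε, hε, hu⟩ := Metric.mem_uniformity_dist.1 hu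
    have ht : Tendsto (fun t : ℝ => 4 * B * (‖h‖ / R) ^ 2 * t) (𝓝[>] 0) (𝓝 0) := by
      have : Continuous (fun t : ℝ => 4 * B * (‖h‖ / R) ^ 2 * t) := by fun_prop
      simpa using (this.tendsto 0).mono_left nhdsWithin_le_nhds
    have ht2 : Tendsto (fun t : ℝ => t * ‖h‖) (𝓝[>] 0) (𝓝 0) := by
      have : Continuous (fun t : ℝ => t * ‖h‖) := by fun_prop
      simpa using (this.tendsto 0).mono_left nhdsWithin_le_nhds
    obtain ⟨t, ht, ht2, ht0⟩ := ((ht.eventually_lt_const hε).and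
      ((ht2.eventually_lt_const hR).and self_mem_nhdsWithin)).exists
    have ht0' : 0 < t := ht0
    refine ⟨fun y => (t : ℂ)⁻¹ * (G (c + (t : ℂ) • h) y - G c y), by fun_prop, fun y => hu ?_⟩
    have hnorm : ‖(t : ℂ) • h‖ = t * ‖h‖ := by
      rw [norm_smul, Complex.norm_real, Real.norm_of_nonneg ht0'.le]
    have := hL2 y (c + (t : ℂ) • h) (by rw [mem_ball, dist_eq_norm, add_sub_cancel_left, hnorm]; exact ht2)
    rw [add_sub_cancel_left, hnorm, map_smul, smul_eq_mul] at this
    have htc : (t : ℂ) ≠ 0 := by exact_mod_cast ht0'.ne'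
    have e : L y h - (t : ℂ)⁻¹ * (G (c + (t : ℂ) • h) y - G c y)
        = -((t : ℂ)⁻¹ * (G (c + (t : ℂ) • h) y - G c y - t * L y h)) := by
      field_simp; ring
    rw [dist_eq_norm, e, norm_neg, norm_mul, norm_inv, Complex.norm_real,
      Real.norm_of_nonneg ht0'.le]
    refine lt_of_le_of_lt ?_ ht
    rw [inv_mul_le_iff₀ ht0']
    refine this.trans (le_of_eq ?_)
    field_simp
  let D : E →L[ℂ] C(K, ℂ) := LinearMap.mkContinuous
    { toFun := fun h => ⟨fun y => L y h, hcont h⟩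
      map_add' := fun a b => by ext y; simp
      map_smul' := fun a b => by ext y; simp } (2 * B / R) fun h => by
        refine (ContinuousMap.norm_le _ (by positivity)).2 fun y => ?_
        exact ContinuousLinearMap.le_of_opNorm_le _ (hL1 y) h
  refine HasFDerivAt.differentiableAt (f' := D) ?_
  rw [hasFDerivAt_iff_isLittleO]
  have hO : (fun z => G z - G c - D (z - c)) =O[𝓝 c] fun z => ‖z - c‖ ^ 2 := by
    refine Asymptotics.IsBigO.of_bound (4 * B / R ^ 2) ?_
    filter_upwards [ball_mem_nhds c hR] with z hz
    rw [norm_pow, norm_norm]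
    refine (ContinuousMap.norm_le _ (by positivity)).2 fun y => ?_
    refine (hL2 y z hz).trans (le_of_eq ?_)
    field_simp
  refine hO.trans_isLittleO ?_
  have : (fun z : E => ‖z - c‖ ^ 2) =o[𝓝 c] fun z => ‖z - c‖ := by
    have h0 : Tendsto (fun z : E => ‖z - c‖) (𝓝 c) (𝓝 0) := by
      have : Continuous fun z : E => ‖z - c‖ := by fun_prop
      simpa using this.tendsto c
    exact (Asymptotics.isLittleO_pow_id one_lt_two).comp_tendsto h0
  exact this.of_norm_right

section Holomorphic

variable {E : Type*} [NormedAddCommGroup E] [NormedSpace ℂ E]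
  {H : Type*} [TopologicalSpace H] (I : ModelWithCorners ℂ E H)
  (M : Type*) [TopologicalSpace M] [ChartedSpace H M]

/-- The holomorphic functions on `M`, as a subspace of `C(M, ℂ)`. -/
def holSubmodule : Submodule ℂ C(M, ℂ) where
  carrier := {f | MDifferentiable I 𝓘(ℂ, ℂ) f}
  add_mem' hf hg := hf.add hg
  zero_mem' := mdifferentiable_const
  smul_mem' c _ hf := hf.const_smul c

/-- The space `𝒪(M)` of holomorphic functions on the complex manifold `M`, with the topology of
uniform convergence on compact sets (that is, the compact-open topology of `C(M, ℂ)`). -/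
def Hol : Type _ := holSubmodule I M

instance : AddCommGroup (Hol I M) := inferInstanceAs (AddCommGroup (holSubmodule I M))

instance : Module ℂ (Hol I M) := inferInstanceAs (Module ℂ (holSubmodule I M))

instance : TopologicalSpace (Hol I M) := inferInstanceAs (TopologicalSpace (holSubmodule I M))

instance : IsTopologicalAddGroup (Hol I M) :=
  inferInstanceAs (IsTopologicalAddGroup (holSubmodule I M))

instance : ContinuousSMul ℂ (Hol I M) := inferInstanceAs (ContinuousSMul ℂ (holSubmodule I M))

instance : FunLike (Hol I M) M ℂ where
  coe f := f.1
  coe_injective := fun _ _ h => Subtype.ext (DFunLike.coe_injective h)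

/-- The space `𝒜(M) = 𝒪(M)'` of analytic functionals, with the strong dual topology (uniform
convergence on bounded subsets of `𝒪(M)`). -/
abbrev AFun : Type _ := StrongDual ℂ (Hol I M)

variable {I M}

/-- The inclusion of `𝒪(M)` into `C(M, ℂ)`. -/
def Hol.incl : Hol I M →L[ℂ] C(M, ℂ) := (holSubmodule I M).subtypeL

theorem Hol.continuous_coe : Continuous (fun f : Hol I M => (f.1 : C(M, ℂ))) :=
  continuous_subtype_val

theorem Hol.mdifferentiable (f : Hol I M) : MDifferentiable I 𝓘(ℂ, ℂ) f := f.2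

@[simp] theorem Hol.zero_apply (x : M) : (0 : Hol I M) x = 0 := rfl

@[simp] theorem Hol.add_apply (f g : Hol I M) (x : M) : (f + g) x = f x + g x := rfl

@[simp] theorem Hol.neg_apply (f : Hol I M) (x : M) : (-f) x = -f x := rfl

@[simp] theorem Hol.smul_apply (c : ℂ) (f : Hol I M) (x : M) : (c • f) x = c * f x := rfl

variable (I) in
/-- The point evaluation `δ_x ∈ 𝒜(M)`. -/
def delta (x : M) : AFun I M where
  toFun f := f x
  map_add' _ _ := rfl
  map_smul' _ _ := rfl
  cont := (continuous_eval_const (F := C(M, ℂ)) x).comp Hol.continuous_coe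

/-- Restriction of holomorphic functions to a subset. -/
def Hol.restrict (K : Set M) : Hol I M →ₗ[ℂ] C(K, ℂ) where
  toFun f := f.1.restrict K
  map_add' _ _ := rfl
  map_smul' _ _ := rfl

/-- An analytic functional is carried by some compact set. -/
theorem AFun.exists_carrier (a : AFun I M) : ∃ (K : Set M) (_ : CompactSpace K)
    (b : StrongDual ℂ C(K, ℂ)), ∀ f : Hol I M, a f = b (f.1.restrict K) := by
  have h : {f : Hol I M | ‖a f‖ < 1} ∈ 𝓝 0 :=
    (isOpen_lt a.continuous.norm continuous_const).mem_nhds (by simp)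
  have h' : (𝓝 (0 : Hol I M)) = comap Hol.incl (𝓝 0) := nhds_induced _ _
  rw [h', ((nhds_basis_uniformity' ContinuousMap.hasBasis_compactConvergenceUniformity).comap
    _).mem_iff] at h
  obtain ⟨⟨K, V⟩, ⟨hK, hV⟩, hsub⟩ := h
  obtain ⟨ε, hε, hεV⟩ := Metric.mem_uniformity_dist.1 hV
  have hKc : CompactSpace K := isCompact_iff_compactSpace.1 hK
  refine ⟨K, hKc, ?_⟩
  let T : Hol I M →ₗ[ℂ] C(K, ℂ) := Hol.restrict K
  have hbound : ∀ f, ‖a f‖ ≤ ε⁻¹ * ‖T f‖ := by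
    intro f
    have hT : ∀ (g : Hol I M), ‖T g‖ < ε → ‖a g‖ < 1 := by
      intro g hg
      refine hsub (show _ ∈ _ from ?_)
      intro x hx
      refine hεV ?_
      have := (ContinuousMap.norm_coe_le_norm (T g) ⟨x, hx⟩).trans_lt hg
      rw [dist_comm, dist_eq_norm]
      rw [show ((0 : C(M, ℂ)), Hol.incl g).2 x - ((0 : C(M, ℂ)), Hol.incl g).1 x = T g ⟨x, hx⟩ from
        sub_zero _]
      exact this
    have hε' : ε ≠ 0 := hε.ne'
    rw [inv_mul_eq_div, le_div_iff₀ hε]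
    refine le_of_forall_gt_imp_ge_of_dense fun δ hδ => ?_
    have hδ0 : 0 < δ := (norm_nonneg _).trans_lt hδ
    have hn : ‖((ε / δ : ℝ) : ℂ)‖ = ε / δ := by
      rw [Complex.norm_real, Real.norm_of_nonneg (by positivity)]
    have := hT (((ε / δ : ℝ) : ℂ) • f) (by
      rw [map_smul, norm_smul, hn, div_mul_eq_mul_div, div_lt_iff₀ hδ0]
      gcongr)
    rw [map_smul, norm_smul, hn, div_mul_eq_mul_div, div_lt_one hδ0] at this
    linarith
  obtain ⟨s, hs⟩ := T.rangeRestrict.exists_rightInverse_of_surjective T.range_rangeRestrict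
  have hTs : ∀ y, T (s y) = y := fun y => congrArg Subtype.val (LinearMap.congr_fun hs y)
  let g : StrongDual ℂ (LinearMap.range T) := LinearMap.mkContinuous (a.toLinearMap ∘ₗ s) ε⁻¹
    fun y => by
      have := hbound (s y)
      rw [hTs] at this
      exact this
  obtain ⟨b, hb, -⟩ := exists_extension_norm_eq _ g
  refine ⟨b, fun f => ?_⟩
  have h1 : b (T f) = a (s (T.rangeRestrict f)) := hb (T.rangeRestrict f)
  have h2 : T (f - s (T.rangeRestrict f)) = 0 := by
    rw [map_sub, hTs, LinearMap.codRestrict_apply, sub_self]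
  have h3 := hbound (f - s (T.rangeRestrict f))
  rw [h2, norm_zero, mul_zero, norm_le_zero_iff, map_sub, sub_eq_zero] at h3
  rw [h3, ← h1]
  rfl

end Holomorphic

/-! ### Weights and weighted spaces -/

/-- A locally bounded function with values in `[1, ∞)`. -/
structure Weight (M : Type*) [TopologicalSpace M] where
  /-- The underlying function. -/
  toFun : M → ℝ
  one_le : ∀ x, 1 ≤ toFun x
  locallyBounded : ∀ x, ∃ U ∈ 𝓝 x, BddAbove (toFun '' U)

section Weight

variable {M M₁ M₂ : Type*} [TopologicalSpace M] [TopologicalSpace M₁] [TopologicalSpace M₂]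

instance : CoeFun (Weight M) fun _ => M → ℝ := ⟨Weight.toFun⟩

theorem Weight.pos (υ : Weight M) (x : M) : 0 < υ x := zero_lt_one.trans_le (υ.one_le x)

/-- The weight `υⁿ`. -/
def Weight.npow (υ : Weight M) (n : ℕ) : Weight M where
  toFun x := υ x ^ n
  one_le x := one_le_pow₀ (υ.one_le x)
  locallyBounded x := by
    obtain ⟨U, hU, C, hC⟩ := υ.locallyBounded x
    refine ⟨U, hU, C ^ n, ?_⟩
    rintro _ ⟨y, hy, rfl⟩
    exact pow_le_pow_left₀ (υ.pos y).le (hC ⟨y, hy, rfl⟩) n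

/-- The weight `(x, y) ↦ υ₁(x) υ₂(y)` on a product. -/
def Weight.prod (υ₁ : Weight M₁) (υ₂ : Weight M₂) : Weight (M₁ × M₂) where
  toFun p := υ₁ p.1 * υ₂ p.2
  one_le p := one_le_mul_of_one_le_of_one_le (υ₁.one_le p.1) (υ₂.one_le p.2)
  locallyBounded p := by
    obtain ⟨U, hU, C, hC⟩ := υ₁.locallyBounded p.1
    obtain ⟨W, hW, D, hD⟩ := υ₂.locallyBounded p.2
    refine ⟨U ×ˢ W, prod_mem_nhds hU hW, C * D, ?_⟩
    rintro _ ⟨y, hy, rfl⟩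
    have h1 := hC ⟨y.1, hy.1, rfl⟩
    exact mul_le_mul h1 (hD ⟨y.2, hy.2, rfl⟩) (υ₂.pos _).le ((υ₁.pos _).le.trans h1)

end Weight

section Weighted

variable {E : Type*} [NormedAddCommGroup E] [NormedSpace ℂ E]
  {H : Type*} [TopologicalSpace H] (I : ModelWithCorners ℂ E H)
  {M : Type*} [TopologicalSpace M] [ChartedSpace H M]

/-- The set of the functionals `υ(x)⁻¹ δ_x`, `x ∈ M`.  Its closed absolutely convex hull in `𝒜(M)`
is the set `V_υ`, whose Minkowski functional is `‖·‖_υ`. -/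
def weightedDeltas (υ : Weight M) : Set (AFun I M) :=
  range fun x => (υ x : ℂ)⁻¹ • delta I x

/-- The space `𝒜_υ(M)`: the completion of `𝒜(M)` with respect to `‖·‖_υ`. -/
abbrev AWeighted (υ : Weight M) : Type _ :=
  GaugeCompletion fun _ : Unit => weightedDeltas I υ

/-- The space `𝒜_{υ^∞}(M)`: the completion of `𝒜(M)` with respect to the sequence of prenorms
`‖·‖_{υⁿ}`, `n ∈ ℕ`. -/
abbrev AWeightedInf (υ : Weight M) : Type _ :=
  GaugeCompletion fun n : ℕ => weightedDeltas I (υ.npow n)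

variable {I} in
/-- The canonical map `𝒜(M) → 𝒜_υ(M)`. -/
def AFun.toWeighted (υ : Weight M) (a : AFun I M) : AWeighted I υ :=
  toGaugeCompletion _ a

variable {I} in
/-- The canonical map `𝒜(M) → 𝒜_{υ^∞}(M)`. -/
def AFun.toWeightedInf (υ : Weight M) (a : AFun I M) : AWeightedInf I υ :=
  toGaugeCompletion _ a

/-- The space `𝒪_υ(M)` of holomorphic functions `f` with `sup υ⁻¹ |f| < ∞`, as a subspace of
`𝒪(M)`. -/
def weightedSubmodule (υ : Weight M) : Submodule ℂ (Hol I M) where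
  carrier := {f | BddAbove (range fun x => (υ x)⁻¹ * ‖f x‖)}
  add_mem' := by
    rintro f g ⟨C, hC⟩ ⟨D, hD⟩
    refine ⟨C + D, ?_⟩
    rintro _ ⟨x, rfl⟩
    have h1 := hC ⟨x, rfl⟩
    have h2 := hD ⟨x, rfl⟩
    have h3 : 0 ≤ (υ x)⁻¹ := inv_nonneg.2 (υ.pos x).le
    calc (υ x)⁻¹ * ‖(f + g) x‖ ≤ (υ x)⁻¹ * (‖f x‖ + ‖g x‖) := by
          gcongr; exact norm_add_le _ _
      _ = (υ x)⁻¹ * ‖f x‖ + (υ x)⁻¹ * ‖g x‖ := mul_add _ _ _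
      _ ≤ C + D := add_le_add h1 h2
  zero_mem' := ⟨0, by rintro _ ⟨x, rfl⟩; simp⟩
  smul_mem' := by
    rintro c f ⟨C, hC⟩
    refine ⟨‖c‖ * C, ?_⟩
    rintro _ ⟨x, rfl⟩
    have h1 := hC ⟨x, rfl⟩
    calc (υ x)⁻¹ * ‖(c • f) x‖ = ‖c‖ * ((υ x)⁻¹ * ‖f x‖) := by
          rw [Hol.smul_apply, norm_mul]; ring
      _ ≤ ‖c‖ * C := by gcongr

theorem weightedSubmodule_mono (υ : Weight M) {m n : ℕ} (hmn : m ≤ n) :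
    weightedSubmodule I (υ.npow m) ≤ weightedSubmodule I (υ.npow n) := by
  rintro f ⟨C, hC⟩
  refine ⟨C, ?_⟩
  rintro _ ⟨x, rfl⟩
  refine le_trans ?_ (hC ⟨x, rfl⟩)
  have h1 : (υ x) ^ m ≤ (υ x) ^ n := pow_le_pow_right₀ (υ.one_le x) hmn
  have h2 : 0 < (υ x) ^ m := pow_pos (υ.pos x) m
  change (υ x ^ n)⁻¹ * ‖f x‖ ≤ (υ x ^ m)⁻¹ * ‖f x‖
  gcongr

/-- The norm `|f|_υ = sup υ⁻¹ |f|` on `𝒪_υ(M)`. -/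
def weightedNorm (υ : Weight M) : AddGroupNorm (weightedSubmodule I υ) where
  toFun f := ⨆ x, (υ x)⁻¹ * ‖f.1 x‖
  map_zero' := by simp
  add_le' f g := by
    rcases isEmpty_or_nonempty M with hM | hM
    · simp [Real.iSup_of_isEmpty]
    refine ciSup_le fun x => ?_
    have h3 : 0 ≤ (υ x)⁻¹ := inv_nonneg.2 (υ.pos x).le
    calc (υ x)⁻¹ * ‖(f + g).1 x‖ ≤ (υ x)⁻¹ * (‖f.1 x‖ + ‖g.1 x‖) := by
          gcongr; exact norm_add_le _ _
      _ = (υ x)⁻¹ * ‖f.1 x‖ + (υ x)⁻¹ * ‖g.1 x‖ := mul_add _ _ _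
      _ ≤ _ := add_le_add (le_ciSup f.2 x) (le_ciSup g.2 x)
  neg' f := by simp
  eq_zero_of_map_eq_zero' f hf := by
    refine Subtype.ext (DFunLike.ext _ _ fun x => ?_)
    have h1 : (υ x)⁻¹ * ‖f.1 x‖ ≤ 0 := (le_ciSup f.2 x).trans_eq hf
    have h3 : 0 < (υ x)⁻¹ := inv_pos.2 (υ.pos x)
    have h4 : ‖f.1 x‖ ≤ 0 := nonpos_of_mul_nonpos_right h1 h3
    exact norm_le_zero_iff.1 h4

/-- The norm topology of `𝒪_υ(M)`. -/
abbrev weightedTopology (υ : Weight M) : TopologicalSpace (weightedSubmodule I υ) :=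
  (weightedNorm I υ).toNormedAddCommGroup.toPseudoMetricSpace.toUniformSpace.toTopologicalSpace

/-- The union of the spaces `𝒪_{υⁿ}(M)`, `n ∈ ℕ`, as a subspace of `𝒪(M)`. -/
def weightedInfSubmodule (υ : Weight M) : Submodule ℂ (Hol I M) where
  carrier := {f | ∃ n, f ∈ weightedSubmodule I (υ.npow n)}
  add_mem' := by
    rintro f g ⟨m, hf⟩ ⟨n, hg⟩
    exact ⟨max m n, add_mem (weightedSubmodule_mono I υ (le_max_left m n) hf)
      (weightedSubmodule_mono I υ (le_max_right m n) hg)⟩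
  zero_mem' := ⟨0, zero_mem _⟩
  smul_mem' := by
    rintro c f ⟨n, hf⟩
    exact ⟨n, Submodule.smul_mem _ c hf⟩

/-- The space `𝒪_{υ^∞}(M) = ⋃ 𝒪_{υⁿ}(M)`, to be endowed with the inductive limit topology. -/
def HolInf (υ : Weight M) : Type _ := weightedInfSubmodule I υ

section HolInf

variable (υ : Weight M)

instance : AddCommGroup (HolInf I υ) := inferInstanceAs (AddCommGroup (weightedInfSubmodule I υ))

instance : Module ℂ (HolInf I υ) := inferInstanceAs (Module ℂ (weightedInfSubmodule I υ))

instance : FunLike (HolInf I υ) M ℂ where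
  coe f := f.1
  coe_injective := fun _ _ h => Subtype.ext (DFunLike.coe_injective h)

/-- The inclusion `𝒪_{υⁿ}(M) → 𝒪_{υ^∞}(M)`. -/
def HolInf.incl (n : ℕ) (f : weightedSubmodule I (υ.npow n)) : HolInf I υ := ⟨f.1, n, f.2⟩

/-- The (locally convex) inductive limit topology on `𝒪_{υ^∞}(M)`: the finest locally convex
topology for which all inclusions `𝒪_{υⁿ}(M) → 𝒪_{υ^∞}(M)` are continuous. -/
instance : TopologicalSpace (HolInf I υ) :=
  finestLCTopology (HolInf I υ) fun t =>
    ∀ n, @Continuous _ _ (weightedTopology I (υ.npow n)) t (HolInf.incl I υ n)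

end HolInf

end Weighted

/-! ### Products -/

section Product

variable {E₁ E₂ : Type*} [NormedAddCommGroup E₁] [NormedSpace ℂ E₁] [NormedAddCommGroup E₂]
  [NormedSpace ℂ E₂] {H₁ H₂ : Type*} [TopologicalSpace H₁] [TopologicalSpace H₂]
  {I₁ : ModelWithCorners ℂ E₁ H₁} {I₂ : ModelWithCorners ℂ E₂ H₂}
  {M₁ M₂ : Type*} [TopologicalSpace M₁] [ChartedSpace H₁ M₁] [TopologicalSpace M₂]
  [ChartedSpace H₂ M₂]

/-- The slice `F(x, ·)` of a holomorphic function on a product. -/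
def Hol.slice (F : Hol (I₁.prod I₂) (M₁ × M₂)) (x : M₁) : Hol I₂ M₂ :=
  ⟨F.1.curry x, F.2.comp (mdifferentiable_const.prodMk mdifferentiable_id)⟩

theorem Hol.mdifferentiable_apply_slice [I₁.Boundaryless] [IsManifold I₁ 1 M₁]
    (F : Hol (I₁.prod I₂) (M₁ × M₂)) (b : AFun I₂ M₂) :
    MDifferentiable I₁ 𝓘(ℂ, ℂ) fun x => b (F.slice x) := by
  obtain ⟨K, _, b', hb⟩ := b.exists_carrier
  let G : C(M₁, C(K, ℂ)) := ⟨fun x => (F.1.curry x).restrict K,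
    (ContinuousMap.continuous_precomp ⟨Subtype.val, continuous_subtype_val⟩).comp F.1.curry.continuous⟩
  have hbG : (fun x => b (F.slice x)) = fun x => b' (G x) := funext fun x => hb _
  rw [hbG]
  intro x
  refine (mdifferentiableAt_iff _ _).2 ⟨by fun_prop, ?_⟩
  rw [I₁.range_eq_univ, differentiableWithinAt_univ]
  have hd : DifferentiableAt ℂ (fun z => G ((extChartAt I₁ x).symm z)) (extChartAt I₁ x x) := by
    refine differentiableAt_of_pointwise ?_ (extChartAt_target_mem_nhds x) fun y => ?_
    · exact G.continuous.continuousAt.comp (continuousAt_extChartAt_symm x)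
    · have h1 : MDifferentiable I₁ 𝓘(ℂ, ℂ) fun x => F (x, (y : M₂)) :=
        F.mdifferentiable.comp (mdifferentiable_id.prodMk mdifferentiable_const)
      have h2 := h1.comp_mdifferentiableOn (mdifferentiableOn_extChartAt_symm (I := I₁) (x := x))
      exact mdifferentiableOn_iff_differentiableOn.1 h2
  exact b'.differentiableAt.comp _ hd

/-- `x ↦ b(F(x, ·))` as a holomorphic function of `x`. -/
def Hol.partialEval [I₁.Boundaryless] [IsManifold I₁ 1 M₁]
    (F : Hol (I₁.prod I₂) (M₁ × M₂)) (b : AFun I₂ M₂) : Hol I₁ M₁ :=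
  ⟨⟨fun x => b (F.slice x), (F.mdifferentiable_apply_slice b).continuous⟩,
    F.mdifferentiable_apply_slice b⟩

theorem Hol.continuous_partialEval [I₁.Boundaryless] [IsManifold I₁ 1 M₁]
    [FiniteDimensional ℂ E₁] [FiniteDimensional ℂ E₂]
    (b : AFun I₂ M₂) :
    Continuous fun F : Hol (I₁.prod I₂) (M₁ × M₂) => F.partialEval b := by
  have := Manifold.locallyCompact_of_finiteDimensional (M := M₁) I₁
  have := Manifold.locallyCompact_of_finiteDimensional (M := M₂) I₂
  obtain ⟨K, _, b', hb⟩ := b.exists_carrier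
  refine Continuous.subtype_mk (f := fun F : Hol (I₁.prod I₂) (M₁ × M₂) => (F.partialEval b).1) ?_ _
  have h : (fun F : Hol (I₁.prod I₂) (M₁ × M₂) => (F.partialEval b).1) = fun F =>
      ContinuousMap.comp ⟨b', b'.continuous⟩ (ContinuousMap.comp
        ⟨fun g : C(M₂, ℂ) => g.restrict K, ContinuousMap.continuous_precomp ⟨Subtype.val, continuous_subtype_val⟩⟩ F.1.curry) := by
    ext F x
    exact hb _
  rw [h]
  exact (ContinuousMap.continuous_postcomp _).comp ((ContinuousMap.continuous_postcomp _).comp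
    (ContinuousMap.continuous_curry.comp Hol.continuous_coe))

/-- The natural map `ρ : 𝒜(M₁) ⊗ 𝒜(M₂) → 𝒜(M₁ × M₂)` on elementary tensors: `ρ(a ⊗ b)` is the
functional `F ↦ a (x ↦ b (F(x, ·)))`; in particular it maps `f ⊗ g` to `a f * b g`. -/
def AFun.prod [I₁.Boundaryless] [IsManifold I₁ 1 M₁] [FiniteDimensional ℂ E₁]
    [FiniteDimensional ℂ E₂] (a : AFun I₁ M₁) (b : AFun I₂ M₂) : AFun (I₁.prod I₂) (M₁ × M₂) where
  toFun F := a (F.partialEval b)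
  map_add' F G := by
    rw [← map_add]; congr 1; exact DFunLike.ext _ _ fun x => map_add b (F.slice x) (G.slice x)
  map_smul' c F := by
    rw [← map_smul]; congr 1; exact DFunLike.ext _ _ fun x => map_smul b c (F.slice x)
  cont := a.continuous.comp (Hol.continuous_partialEval b)

end Product

end AnalyticFunctional

end

/-!
For a single manifold `M`, Taylor expansion in charts shows that `x ↦ δ_x ∈ 𝒜(M)` is holomorphic
(`exists_delta_taylor`), and point evaluations span a dense subspace (`dense_span_delta`). Hence every continuous
functional on `𝒜(M)` is the evaluation at a holomorphic function, and the bipolar theorem identifies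
`‖·‖_υ` with the dual norm of `𝒪_υ(M)` (`egauge_closedAcv_weightedDeltas`); the functionals on `𝒜(M)`
bounded by `‖·‖_υ` form the unit ball of `𝒪_υ(M)` (`exists_hol_of_le_weightedSeminorm`).

A complete locally convex space `Z` with a continuous bilinear map `β : X × Y → Z` whose values span
a dense subspace is the complete projective tensor product as soon as equicontinuous sets of
functionals on `X ⊗ Y` extend along `β` to equicontinuous sets of functionals on `Z`
(`exists_completedTensor_equiv`). For spaces of analytic functionals, such a functional is a bilinear
form `β` with `|β(a, b)| ≤ C ‖a‖_{υ₁} ‖b‖_{υ₂}`. The function `F(x, y) = β(δ_x, δ_y)` is holomorphic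
with `|F| ≤ C υ`, and evaluation at `F` is the required extension (`exists_hol_of_bilinear`).

For the spaces `𝒪_{υ^∞}`, nuclearity is used in the form of expansions `g = ∑ aₖ(g) Fₖ` of the functions
`g ∈ 𝒪_{υⁿ}(M)`, with `∑ ‖aₖ‖_{υⁿ} < ∞` and `Fₖ` bounded in `𝒪_{υᵐ}(M)`
(`hasExpansions_of_isNuclear`). They show that the balls of `𝒪_{υⁿ}(M)` are relatively compact in
`𝒪_{υ^∞}(M)`; as a Cauchy filter accumulates at such a ball, `𝒪_{υ^∞}(M)` is complete
(`HolInf.completeSpace`). Expansions on the factors give expansions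
`F = ∑ (aₖ ⊗ bₗ)(F) Fₖ ⊗ Gₗ` on the product (`Expansion.prod`). These yield the density of the span of
the elementary tensors, and a functional `φ` on the tensor product is extended by
`F ↦ ∑ (aₖ ⊗ bₗ)(F) φ(Fₖ ⊗ Gₗ)` (`HolInf.exists_factor_bilinear`).
-/

noncomputable section

namespace AnalyticFunctional

/-! ### Bounded sets of holomorphic functions -/

section OneManifold

variable {E : Type*} [NormedAddCommGroup E] [NormedSpace ℂ E]
  {H : Type*} [TopologicalSpace H] {I : ModelWithCorners ℂ E H}
  {M : Type*} [TopologicalSpace M] [ChartedSpace H M]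

theorem Hol.hasBasis_nhds_zero : (𝓝 (0 : Hol I M)).HasBasis
    (fun Kε : Set M × ℝ => IsCompact Kε.1 ∧ 0 < Kε.2)
    fun Kε => {f | ∀ x ∈ Kε.1, ‖f x‖ < Kε.2} := by
  have h' : (𝓝 (0 : Hol I M)) = comap Hol.incl (𝓝 0) := nhds_induced _ _
  rw [h']
  refine ((nhds_basis_uniformity' (Metric.uniformity_basis_dist.compactConvergenceUniformity)
    ).comap _).to_hasBasis ?_ ?_
  · rintro ⟨K, ε⟩ ⟨hK, hε⟩
    refine ⟨(K, ε), ⟨hK, hε⟩, fun f hf x hx => ?_⟩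
    have := hf x hx
    change dist (0 : ℂ) (f x) < ε
    rwa [dist_comm, dist_zero_right]
  · rintro ⟨K, ε⟩ ⟨hK, hε⟩
    refine ⟨(K, ε), ⟨hK, hε⟩, fun f hf x hx => ?_⟩
    have : dist (0 : ℂ) (f x) < ε := hf x hx
    rwa [dist_comm, dist_zero_right] at this

theorem Hol.isVonNBounded_iff {D : Set (Hol I M)} : Bornology.IsVonNBounded ℂ D ↔
    ∀ K : Set M, IsCompact K → ∃ C, ∀ f ∈ D, ∀ x ∈ K, ‖f x‖ ≤ C := by
  constructor
  · intro hD K hK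
    obtain ⟨r, hr, h⟩ := (hD (Hol.hasBasis_nhds_zero.mem_of_mem (i := (K, 1))
      ⟨hK, zero_lt_one⟩)).exists_pos
    refine ⟨r, fun f hf x hx => ?_⟩
    obtain ⟨g, hg, rfl⟩ := h (r : ℂ) (by simp [abs_of_pos hr]) hf
    have h1 : ‖g x‖ < 1 := hg x hx
    change ‖(r : ℂ) * g x‖ ≤ r
    rw [norm_mul, Complex.norm_real, Real.norm_of_nonneg hr.le]
    nlinarith
  · intro h
    rw [Hol.hasBasis_nhds_zero.isVonNBounded_iff]
    rintro ⟨K, ε⟩ ⟨hK, hε : 0 < ε⟩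
    obtain ⟨C, hC⟩ := h K hK
    refine Absorbs.of_norm ⟨(|C| + 1) / ε, fun c hc f hf => ?_⟩
    have hc0 : 0 < ‖c‖ := lt_of_lt_of_le (by positivity) hc
    have hc1 : c ≠ 0 := norm_pos_iff.1 hc0
    refine ⟨c⁻¹ • f, fun x hx => ?_, smul_inv_smul₀ hc1 f⟩
    have := hC f hf x hx
    change ‖c⁻¹ * f x‖ < ε
    rw [norm_mul, norm_inv, inv_mul_lt_iff₀ hc0]
    rw [div_le_iff₀ hε] at hc
    linarith [le_abs_self C]

/-- A locally bounded function is bounded on compact sets. -/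
theorem Weight.exists_le_on_compact (υ : Weight M) {K : Set M} (hK : IsCompact K) :
    ∃ C, 0 ≤ C ∧ ∀ x ∈ K, υ x ≤ C := by
  refine hK.induction_on ⟨0, le_rfl, by simp⟩ ?_ ?_ ?_
  · rintro s t hst ⟨C, h0, hC⟩
    exact ⟨C, h0, fun x hx => hC x (hst hx)⟩
  · rintro s t ⟨C, h0, hC⟩ ⟨D, -, hD⟩
    refine ⟨max C D, le_max_of_le_left h0, fun x hx => ?_⟩
    rcases hx with hx | hx
    · exact (hC x hx).trans (le_max_left _ _)
    · exact (hD x hx).trans (le_max_right _ _)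
  · intro x _
    obtain ⟨U, hU, C, hC⟩ := υ.locallyBounded x
    exact ⟨U, mem_nhdsWithin_of_mem_nhds hU, max C 0, le_max_right _ _,
      fun y hy => (hC ⟨y, hy, rfl⟩).trans (le_max_left _ _)⟩

variable (I) in
/-- The closed unit ball of `𝒪_υ(M)`. -/
def weightedBall (υ : Weight M) : Set (Hol I M) := {f | ∀ x, ‖f x‖ ≤ υ x}

theorem isVonNBounded_weightedBall (υ : Weight M) :
    Bornology.IsVonNBounded ℂ (weightedBall I υ) := by
  refine Hol.isVonNBounded_iff.2 fun K hK => ?_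
  obtain ⟨C, -, hC⟩ := υ.exists_le_on_compact hK
  exact ⟨C, fun f hf x hx => (hf x).trans (hC x hx)⟩

/-- A continuous seminorm on `𝒜(M)` is dominated by a multiple of the supremum over a bounded subset
of `𝒪(M)`. -/
theorem AFun.exists_bounded_of_continuous_seminorm {p : Seminorm ℂ (AFun I M)}
    (hp : Continuous p) : ∃ D : Set (Hol I M), Bornology.IsVonNBounded ℂ D ∧ ∃ C, 0 < C ∧
      ∀ (a : AFun I M) (t : ℝ), 0 ≤ t → (∀ g ∈ D, ‖a g‖ ≤ t) → p a ≤ C * t := by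
  have h : {a : AFun I M | p a < 1} ∈ 𝓝 0 :=
    (isOpen_lt hp continuous_const).mem_nhds (by simp)
  obtain ⟨⟨D, ε⟩, ⟨hD, hε⟩, hsub⟩ :=
    (ContinuousLinearMap.hasBasis_nhds_zero_of_basis Metric.nhds_basis_ball).mem_iff.1 h
  replace hε : 0 < ε := hε
  refine ⟨D, hD, ε⁻¹, inv_pos.2 hε, fun a t ht hat => ?_⟩
  rw [inv_mul_eq_div, le_div_iff₀ hε]
  refine le_of_forall_gt_imp_ge_of_dense fun s hs => ?_
  have hs0 : 0 < s := ht.trans_lt hs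
  have hn : ‖((ε / s : ℝ) : ℂ)‖ = ε / s := by
    rw [Complex.norm_real, Real.norm_of_nonneg (by positivity)]
  have h1 : p (((ε / s : ℝ) : ℂ) • a) < 1 := by
    refine hsub (fun g hg => ?_)
    change _ ∈ ball (0 : ℂ) ε
    rw [mem_ball_zero_iff]
    change ‖((ε / s : ℝ) : ℂ) * a g‖ < ε
    rw [norm_mul, hn, div_mul_eq_mul_div, div_lt_iff₀ hs0]
    have := (hat g hg).trans_lt hs
    gcongr
  rw [map_smul_eq_mul, hn, div_mul_eq_mul_div, div_lt_one hs0] at h1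
  linarith

/-! ### Holomorphic dependence of point evaluations on the point -/

theorem mdifferentiableAt_of_differentiableAt_extChartAt [I.Boundaryless] {f : M → ℂ} {x : M}
    (h : DifferentiableAt ℂ (fun z => f ((extChartAt I x).symm z)) (extChartAt I x x)) :
    MDifferentiableAt I 𝓘(ℂ, ℂ) f x := by
  refine (mdifferentiableAt_iff _ _).2 ⟨?_, ?_⟩
  · have h1 : ContinuousAt (fun y => f ((extChartAt I x).symm (extChartAt I x y))) x :=
      ContinuousAt.comp (f := extChartAt I x) h.continuousAt (continuousAt_extChartAt x)
    refine h1.congr ?_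
    filter_upwards [extChartAt_source_mem_nhds (I := I) x] with y hy
    rw [(extChartAt I x).left_inv hy]
  · rw [I.range_eq_univ, differentiableWithinAt_univ]
    exact h

theorem Hol.differentiableOn_extChartAt [IsManifold I 1 M] (g : Hol I M) (x : M) :
    DifferentiableOn ℂ (fun z => g ((extChartAt I x).symm z)) (extChartAt I x).target :=
  mdifferentiableOn_iff_differentiableOn.1
    (g.mdifferentiable.comp_mdifferentiableOn (mdifferentiableOn_extChartAt_symm (I := I) (x := x)))

/-- Second order Taylor expansion of `δ` at a point `c`, in a chart: `D h` is the derivative at `c`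
in the direction `h`. -/
theorem exists_delta_taylor [I.Boundaryless] [IsManifold I 1 M] [FiniteDimensional ℂ E] (c : M) :
    ∃ (R : ℝ) (D : E →ₗ[ℂ] AFun I M), 0 < R ∧ ∀ p : Seminorm ℂ (AFun I M), Continuous p →
      ∃ C, 0 ≤ C ∧ (∀ h, p (D h) ≤ C * ‖h‖) ∧ ∀ z ∈ ball (extChartAt I c c) R,
        p (delta I ((extChartAt I c).symm z) - delta I c - D (z - extChartAt I c c)) ≤
          C * ‖z - extChartAt I c c‖ ^ 2 := by
  have : ProperSpace E := FiniteDimensional.proper ℂ E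
  set e := extChartAt I c
  obtain ⟨R, hR, hball⟩ := Metric.nhds_basis_closedBall.mem_iff.1
    (extChartAt_target_mem_nhds (I := I) c)
  set K : Set M := e.symm '' closedBall (e c) R
  have hK : IsCompact K := (isCompact_closedBall _ _).image_of_continuousOn
    ((continuousOn_extChartAt_symm c).mono hball)
  have hd : ∀ g : Hol I M, DifferentiableOn ℂ (fun z => g (e.symm z)) (ball (e c) R) := fun g =>
    (g.differentiableOn_extChartAt c).mono (ball_subset_closedBall.trans hball)
  have hdc : ∀ g : Hol I M, DifferentiableAt ℂ (fun z => g (e.symm z)) (e c) := fun g =>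
    (hd g).differentiableAt (ball_mem_nhds _ hR)
  have hB : ∀ (g : Hol I M) (B : ℝ), (∀ x ∈ K, ‖g x‖ ≤ B) → ∀ w ∈ ball (e c) R,
      ‖g (e.symm w)‖ ≤ B := fun g B h w hw => h _ ⟨w, ball_subset_closedBall hw, rfl⟩
  -- `L h g` is the derivative of `g` at `c` in the direction `h`, which Cauchy's estimate bounds in
  -- terms of `g` on the compact set `K`
  let L : E → Hol I M →ₗ[ℂ] ℂ := fun h =>
    { toFun := fun g => fderiv ℂ (fun z => g (e.symm z)) (e c) h
      map_add' := fun f g => by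
        have : (fun z => (f + g) (e.symm z)) =
          (fun z => f (e.symm z)) + fun z => g (e.symm z) := rfl
        rw [this, fderiv_add (hdc f) (hdc g)]; rfl
      map_smul' := fun a g => by
        have : (fun z => (a • g) (e.symm z)) = a • fun z => g (e.symm z) := rfl
        rw [this, fderiv_const_smul (hdc g)]; rfl }
  have hL : ∀ (h : E) (g : Hol I M) (B : ℝ), (∀ x ∈ K, ‖g x‖ ≤ B) → ‖L h g‖ ≤ 2 * B / R * ‖h‖ :=
    fun h g B hg => ContinuousLinearMap.le_of_opNorm_le _
      (second_order_bound (hd g) (hB g B hg) (mem_ball_self hR)).1 h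
  have hLc : ∀ h, Continuous (L h) := by
    intro h
    refine continuous_of_continuousAt_zero (L h).toAddMonoidHom ?_
    rw [ContinuousAt, map_zero, Metric.nhds_basis_closedBall.tendsto_right_iff]
    intro ε hε
    have hδ : 0 < ε * R / (2 * (‖h‖ + 1)) := by positivity
    filter_upwards [Hol.hasBasis_nhds_zero.mem_of_mem (i := (K, ε * R / (2 * (‖h‖ + 1))))
      ⟨hK, hδ⟩] with g hg
    rw [mem_closedBall_zero_iff]
    refine (hL h g _ fun x hx => (hg x hx).le).trans ?_
    have : 2 * (ε * R / (2 * (‖h‖ + 1))) / R * ‖h‖ = ε * (‖h‖ / (‖h‖ + 1)) := by field_simp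
    rw [this]
    refine mul_le_of_le_one_right hε.le ((div_le_one (by positivity)).2 (by linarith))
  let D : E →ₗ[ℂ] AFun I M :=
    { toFun := fun h => ⟨L h, hLc h⟩
      map_add' := fun h k => by
        ext g; exact map_add (fderiv ℂ (fun z => g (e.symm z)) (e c)) h k
      map_smul' := fun a h => by
        ext g; exact map_smul (fderiv ℂ (fun z => g (e.symm z)) (e c)) a h }
  refine ⟨R, D, hR, fun p hp => ?_⟩
  obtain ⟨S, hS, C, hC, hpC⟩ := AFun.exists_bounded_of_continuous_seminorm hp
  obtain ⟨B', hB'⟩ := Hol.isVonNBounded_iff.1 hS K hK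
  obtain ⟨B, hB0, hSB⟩ : ∃ B, 0 ≤ B ∧ ∀ g ∈ S, ∀ x ∈ K, ‖g x‖ ≤ B :=
    ⟨max B' 0, le_max_right _ _, fun g hg x hx => (hB' g hg x hx).trans (le_max_left _ _)⟩
  refine ⟨C * (2 * B / R) + C * (4 * B / R ^ 2), by positivity, fun h => ?_, fun z hz => ?_⟩
  · calc p (D h) ≤ C * (2 * B / R * ‖h‖) :=
          hpC _ _ (by positivity) fun g hg => hL h g B (hSB g hg)
      _ = C * (2 * B / R) * ‖h‖ := by ring
      _ ≤ _ := by gcongr; exact le_add_of_nonneg_right (by positivity)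
  · refine (hpC _ (4 * B * (‖z - e c‖ / R) ^ 2) (by positivity) fun g hg => ?_).trans ?_
    · have := (second_order_bound (hd g) (hB g B (hSB g hg)) hz).2
      have hc : e.symm (e c) = c := extChartAt_to_inv c
      rw [hc] at this
      exact this
    · calc C * (4 * B * (‖z - e c‖ / R) ^ 2) = C * (4 * B / R ^ 2) * ‖z - e c‖ ^ 2 := by
            field_simp
        _ ≤ _ := by gcongr; exact le_add_of_nonneg_left (by positivity)

end OneManifold

/-! ### Reflexivity and the bipolar theorem for analytic functionals -/

/-- A complex topological vector space which is locally convex over `ℝ` has its topology defined by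
seminorms over `ℂ`. -/
theorem polynormableSpace_of_locallyConvexSpace (X : Type*) [AddCommGroup X] [Module ℂ X]
    [TopologicalSpace X] [IsTopologicalAddGroup X] [ContinuousSMul ℂ X] [LocallyConvexSpace ℝ X] :
    PolynormableSpace ℂ X := by
  have : ContinuousSMul ℝ X := IsScalarTower.continuousSMul ℂ
  have : LocallyConvexSpace ℂ X := by
    refine .ofBasisZero ℂ X _ _ (LocallyConvexSpace.convex_basis_zero ℝ X) ?_
    rintro s ⟨-, hs⟩
    exact convex_RCLike_iff_convex_real.2 hs
  exact LocallyConvexSpace.toPolynormableSpace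

theorem absConvex_of_seminorm_le {X : Type*} [AddCommGroup X] [Module ℂ X] (p : Seminorm ℂ X)
    (r : ℝ) : AbsConvex ℂ {x | p x ≤ r} := by
  rw [show {x | p x ≤ r} = p.closedBall 0 r by ext x; simp [Seminorm.mem_closedBall]]
  exact ⟨p.balanced_closedBall_zero r, convex_RCLike_iff_convex_real.2 (p.convex_closedBall 0 r)⟩

section OneManifold

variable {E : Type*} [NormedAddCommGroup E] [NormedSpace ℂ E]
  {H : Type*} [TopologicalSpace H] {I : ModelWithCorners ℂ E H}
  {M : Type*} [TopologicalSpace M] [ChartedSpace H M]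

@[simp] theorem delta_apply (x : M) (f : Hol I M) : delta I x f = f x := rfl

theorem norm_apply_le_of_mem_closedAcv {υ : Weight M} {a : AFun I M}
    (ha : a ∈ closedAcv (weightedDeltas I υ)) {f : Hol I M} (hf : f ∈ weightedBall I υ) :
    ‖a f‖ ≤ 1 := by
  have hcl : IsClosed {a : AFun I M | ‖a f‖ ≤ 1} :=
    isClosed_le (continuous_eval_const f).norm continuous_const
  let ev : AFun I M →ₗ[ℂ] ℂ := ⟨⟨fun a => a f, fun _ _ => rfl⟩, fun _ _ => rfl⟩
  refine closure_minimal (absConvexHull_min ?_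
    (absConvex_of_seminorm_le ((normSeminorm ℂ ℂ).comp ev) 1)) hcl ha
  rintro _ (rfl | ⟨x, rfl⟩)
  · simp
  · have := hf x
    have h0 := υ.pos x
    change ‖(υ x : ℂ)⁻¹ * f x‖ ≤ 1
    rw [norm_mul, norm_inv, Complex.norm_real, Real.norm_of_nonneg h0.le, inv_mul_le_iff₀ h0]
    simpa using this

variable [I.Boundaryless] [IsManifold I 1 M] [FiniteDimensional ℂ E]

theorem continuous_delta : Continuous (delta I : M → AFun I M) := by
  refine continuous_iff_continuousAt.2 fun c => ?_
  have := polynormableSpace_of_locallyConvexSpace (AFun I M)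
  refine ((PolynormableSpace.withSeminorms ℂ (AFun I M)).tendsto_nhds _ _).2 ?_
  rintro ⟨p, hp⟩ ε hε
  obtain ⟨R, D, hR, hD⟩ := exists_delta_taylor (I := I) c
  obtain ⟨C, hC, h1, h2⟩ := hD p hp
  have hcont : Tendsto (fun x => C * ‖extChartAt I c x - extChartAt I c c‖ ^ 2 +
      C * ‖extChartAt I c x - extChartAt I c c‖) (𝓝 c) (𝓝 0) := by
    have h3 : Tendsto (fun x => ‖extChartAt I c x - extChartAt I c c‖) (𝓝 c) (𝓝 0) := by
      have := ((continuousAt_extChartAt (I := I) c).sub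
        (continuousAt_const (y := extChartAt I c c))).norm
      simpa [ContinuousAt] using this
    simpa using ((h3.pow 2).const_mul C).add (h3.const_mul C)
  filter_upwards [hcont.eventually_lt_const hε, extChartAt_source_mem_nhds (I := I) c,
    (continuousAt_extChartAt (I := I) c).eventually_mem (ball_mem_nhds _ hR)] with x hx hxs hxb
  have h4 := h2 _ hxb
  rw [(extChartAt I c).left_inv hxs] at h4
  refine lt_of_le_of_lt ?_ hx
  have h5 := map_add_le_add p (delta I x - delta I c - D (extChartAt I c x - extChartAt I c c))
    (D (extChartAt I c x - extChartAt I c c))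
  rw [sub_add_cancel] at h5
  exact h5.trans (add_le_add h4 (h1 _))

/-- Point evaluations span a strongly dense subspace of `𝒜(M)`: a functional carried by a compact
set `K` is approximated with the help of a partition of unity on `K`. -/
theorem dense_span_delta [T2Space M] :
    Dense (Submodule.span ℂ (range (delta I : M → AFun I M)) : Set (AFun I M)) := by
  have := Manifold.locallyCompact_of_finiteDimensional (M := M) I
  intro a
  obtain ⟨K, hKc, b, hb⟩ := a.exists_carrier
  have hK : IsCompact K := isCompact_iff_compactSpace.2 hKc
  rw [mem_closure_iff_nhds]
  intro U hU
  have hU' : (fun v => a - v) ⁻¹' U ∈ 𝓝 (0 : AFun I M) :=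
    (continuous_const.sub continuous_id).continuousAt.preimage_mem_nhds (by simpa using hU)
  obtain ⟨⟨S, ε⟩, ⟨hS, hε⟩, hsub⟩ :=
    (ContinuousLinearMap.hasBasis_nhds_zero_of_basis Metric.nhds_basis_ball).mem_iff.1 hU'
  replace hε : 0 < ε := hε
  set η : ℝ := ε / (‖b‖ + 1)
  have hη : 0 < η := by positivity
  have hloc : ∀ x : M, ∃ V : Set M, IsOpen V ∧ x ∈ V ∧ ∀ y ∈ V, ∀ g ∈ S, ‖g y - g x‖ < η := by
    intro x
    have h1 : {v : AFun I M | ∀ g ∈ S, v g ∈ ball (0 : ℂ) η} ∈ 𝓝 (delta I x - delta I x) := by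
      rw [sub_self]
      exact (ContinuousLinearMap.hasBasis_nhds_zero_of_basis Metric.nhds_basis_ball).mem_of_mem
        (i := (S, η)) ⟨hS, hη⟩
    have h2 := (continuous_delta (I := I).sub
      (continuous_const (y := delta I x))).continuousAt.preimage_mem_nhds h1
    obtain ⟨V, hV, hVo, hxV⟩ := mem_nhds_iff.1 h2
    exact ⟨V, hVo, hxV, fun y hy g hg => mem_ball_zero_iff.1 (hV hy g hg)⟩
  choose V hVo hxV hV using hloc
  obtain ⟨t, ht⟩ := hK.elim_finite_subcover V hVo fun x _ => mem_iUnion.2 ⟨x, hxV x⟩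
  let x : Fin t.card → M := fun i => (t.equivFin.symm i : M)
  obtain ⟨ρ, hρs, hρ1, hρ0, -⟩ := exists_continuous_sum_one_of_isOpen_isCompact
    (s := fun i => V (x i)) (fun i => hVo _) hK (fun y hy => by
      obtain ⟨z, hz, hyz⟩ := mem_iUnion₂.1 (ht hy)
      refine mem_iUnion.2 ⟨t.equivFin ⟨z, hz⟩, ?_⟩
      simpa [x] using hyz)
  let r : Fin t.card → C(K, ℂ) := fun i => ⟨fun y => (ρ i y : ℂ), by fun_prop⟩
  -- `∑ b(ρᵢ) δ_{xᵢ}` sends `g` to `b (∑ g(xᵢ) ρᵢ)`, and `∑ g(xᵢ) ρᵢ` is close to `g` on `K`,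
  -- uniformly for `g ∈ S`
  let v : AFun I M := ∑ i, b (r i) • delta I (x i)
  have hv : v ∈ Submodule.span ℂ (range (delta I : M → AFun I M)) :=
    Submodule.sum_mem _ fun i _ => Submodule.smul_mem _ _ (Submodule.subset_span ⟨_, rfl⟩)
  refine ⟨v, ?_, hv⟩
  suffices h : a - v ∈ {w : AFun I M | ∀ g ∈ S, w g ∈ ball (0 : ℂ) ε} by
    have := hsub h
    simpa using this
  intro g hg
  rw [mem_ball_zero_iff]
  have hvg : v g = ∑ i, b (r i) * g (x i) := by
    simp [v]
  have hag : (a - v) g = b (g.1.restrict K - ∑ i, g (x i) • r i) := by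
    change a g - v g = _
    rw [hb g, hvg, map_sub, map_sum]
    congr 1
    refine Finset.sum_congr rfl fun i _ => ?_
    rw [map_smul, smul_eq_mul, mul_comm]
  have hnorm : ‖g.1.restrict K - ∑ i, g (x i) • r i‖ ≤ η := by
    refine (ContinuousMap.norm_le _ hη.le).2 fun y => ?_
    have h1 : ∑ i, ρ i (y : M) = 1 := by
      have := hρ1 y.2
      simpa using this
    have h2 : (g.1.restrict K - ∑ i, g (x i) • r i) y = ∑ i, (ρ i (y : M) : ℂ) * (g y - g (x i)) := by
      have h3 : (∑ i, (ρ i (y : M) : ℂ)) = 1 := by exact_mod_cast h1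
      have h4 : (∑ i, g (x i) • r i) y = ∑ i, (ρ i (y : M) : ℂ) * g (x i) := by
        rw [ContinuousMap.sum_apply]
        exact Finset.sum_congr rfl fun i _ => mul_comm _ _
      rw [ContinuousMap.sub_apply, h4]
      simp only [mul_sub, Finset.sum_sub_distrib, ← Finset.sum_mul, h3, one_mul]
      rfl
    rw [h2]
    calc ‖∑ i, (ρ i (y : M) : ℂ) * (g y - g (x i))‖ ≤ ∑ i, ρ i (y : M) * η := by
          refine norm_sum_le_of_le _ fun i _ => ?_
          rw [norm_mul, Complex.norm_real, Real.norm_of_nonneg (hρ0 i y).1]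
          by_cases hy : ρ i (y : M) = 0
          · simp [hy]
          · exact mul_le_mul_of_nonneg_left
              (hV _ _ (hρs i (subset_closure hy)) g hg).le (hρ0 i y).1
      _ = η := by rw [← Finset.sum_mul, h1, one_mul]
  rw [hag]
  calc ‖b (g.1.restrict K - ∑ i, g (x i) • r i)‖ ≤ ‖b‖ * η := b.le_opNorm_of_le hnorm
    _ = ε * (‖b‖ / (‖b‖ + 1)) := by simp only [η]; field_simp
    _ < ε := mul_lt_of_lt_one_right hε ((div_lt_one (by positivity)).2 (by linarith))

/-- The space `𝒪(M)` is reflexive: a strongly continuous functional on `𝒜(M)` is the evaluation at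
a holomorphic function. -/
theorem AFun.exists_hol_of_continuous [T2Space M] (ψ : AFun I M →ₗ[ℂ] ℂ) (hψ : Continuous ψ) :
    ∃ f : Hol I M, ∀ a : AFun I M, ψ a = a f := by
  let p : Seminorm ℂ (AFun I M) := (normSeminorm ℂ ℂ).comp ψ
  have hp : Continuous p := hψ.norm
  have hd : MDifferentiable I 𝓘(ℂ, ℂ) fun x : M => ψ (delta I x) := by
    intro c
    obtain ⟨R, D, hR, hD⟩ := exists_delta_taylor (I := I) c
    obtain ⟨C, hC, -, h2⟩ := hD p hp
    refine mdifferentiableAt_of_differentiableAt_extChartAt ?_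
    set e := extChartAt I c
    have hc : e.symm (e c) = c := extChartAt_to_inv c
    refine HasFDerivAt.differentiableAt (f' := LinearMap.toContinuousLinearMap (ψ ∘ₗ D)) ?_
    rw [hasFDerivAt_iff_isLittleO]
    have hO : (fun z => ψ (delta I (e.symm z)) - ψ (delta I (e.symm (e c))) -
        (LinearMap.toContinuousLinearMap (ψ ∘ₗ D)) (z - e c)) =O[𝓝 (e c)]
          fun z => ‖z - e c‖ ^ 2 := by
      refine Asymptotics.IsBigO.of_bound C ?_
      filter_upwards [ball_mem_nhds (e c) hR] with z hz
      have := h2 z hz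
      rw [norm_pow, norm_norm, hc]
      refine le_trans (le_of_eq ?_) this
      change _ = ‖ψ _‖
      rw [(ψ.map_sub _ _ : ψ (_ - _) = _), ψ.map_sub]
      rfl
    refine hO.trans_isLittleO ?_
    have h0 : Tendsto (fun z : E => ‖z - e c‖) (𝓝 (e c)) (𝓝 0) := by
      have : Continuous fun z : E => ‖z - e c‖ := by fun_prop
      simpa using this.tendsto (e c)
    exact Asymptotics.IsLittleO.of_norm_right
      ((Asymptotics.isLittleO_pow_id one_lt_two).comp_tendsto h0)
  -- `ψ` and evaluation at `f` agree on the dense span of the point evaluations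
  let f : Hol I M := ⟨⟨fun x => ψ (delta I x), hd.continuous⟩, hd⟩
  refine ⟨f, fun a => ?_⟩
  have hev : Continuous fun a : AFun I M => a f := continuous_eval_const f
  let ev : AFun I M →ₗ[ℂ] ℂ := ⟨⟨fun a => a f, fun _ _ => rfl⟩, fun _ _ => rfl⟩
  have hspan : EqOn ψ ev (Submodule.span ℂ (range (delta I : M → AFun I M)) : Set (AFun I M)) := by
    refine LinearMap.eqOn_span ?_
    rintro _ ⟨x, rfl⟩
    rfl
  exact congrFun (hψ.ext_on dense_span_delta hev hspan) a

/-! ### The prenorm `‖·‖_υ` and the duality with `𝒪_υ(M)` -/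

/-- The bipolar theorem for `V_υ`. -/
theorem mem_closedAcv_weightedDeltas_iff [T2Space M] {υ : Weight M} {a : AFun I M} :
    a ∈ closedAcv (weightedDeltas I υ) ↔ ∀ f ∈ weightedBall I υ, ‖a f‖ ≤ 1 := by
  refine ⟨fun ha f hf => norm_apply_le_of_mem_closedAcv ha hf, fun ha => ?_⟩
  by_contra hna
  have hV := absConvex_closedAcv (weightedDeltas I υ)
  have : ContinuousSMul ℝ (AFun I M) := IsScalarTower.continuousSMul ℂ
  obtain ⟨ψ, u, h1, h2⟩ := RCLike.geometric_hahn_banach_closed_point (𝕜 := ℂ)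
    (convex_RCLike_iff_convex_real.1 hV.2) isClosed_closure hna
  obtain ⟨f, hf⟩ := AFun.exists_hol_of_continuous ψ.toLinearMap ψ.continuous
  replace hf : ∀ a, ψ a = a f := hf
  have hu : 0 < u := by
    have := h1 0 (zero_mem_closedAcv _)
    simpa using this
  have hle : ∀ b ∈ closedAcv (weightedDeltas I υ), ‖ψ b‖ ≤ u := by
    intro b hb
    -- as `V_υ` is balanced, `b` may be rotated so that `ψ b` becomes real and nonnegative
    rcases eq_or_ne (ψ b) 0 with h0 | h0
    · simp [h0, hu.le]
    · have hb' : ((starRingEnd ℂ (ψ b)) / ‖ψ b‖) • b ∈ closedAcv (weightedDeltas I υ) := by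
        refine hV.1.smul_mem ?_ hb
        rw [norm_div, RCLike.norm_conj, Complex.norm_real, norm_norm, div_self (norm_ne_zero_iff.2 h0)]
      have := (h1 _ hb').le
      rw [map_smul, smul_eq_mul, div_mul_eq_mul_div, mul_comm, Complex.mul_conj'] at this
      have h3 : (‖ψ b‖ : ℂ) ^ 2 / ‖ψ b‖ = (‖ψ b‖ : ℂ) := by
        have : (‖ψ b‖ : ℂ) ≠ 0 := by simpa using h0
        field_simp
      rw [h3] at this
      simpa using this
  have hball : ((u : ℂ)⁻¹ • f) ∈ weightedBall I υ := by
    intro x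
    have h0 := υ.pos x
    have := hle ((υ x : ℂ)⁻¹ • delta I x)
      (subset_closure (subset_absConvexHull (mem_insert_of_mem _ ⟨x, rfl⟩)))
    rw [map_smul, hf, smul_eq_mul, norm_mul, norm_inv, Complex.norm_real,
      Real.norm_of_nonneg h0.le, inv_mul_le_iff₀ h0] at this
    rw [Hol.smul_apply, norm_mul, norm_inv, Complex.norm_real, Real.norm_of_nonneg hu.le,
      inv_mul_le_iff₀ hu, mul_comm]
    exact this
  have h4 := ha _ hball
  rw [map_smul, ← hf, smul_eq_mul, norm_mul, norm_inv, Complex.norm_real,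
    Real.norm_of_nonneg hu.le, inv_mul_le_iff₀ hu, mul_one] at h4
  exact absurd (h2.trans_le ((RCLike.re_le_norm _).trans h4)) (lt_irrefl _)

end OneManifold

section OneManifold

variable {E : Type*} [NormedAddCommGroup E] [NormedSpace ℂ E]
  {H : Type*} [TopologicalSpace H] {I : ModelWithCorners ℂ E H}
  {M : Type*} [TopologicalSpace M] [ChartedSpace H M]

theorem bddAbove_weightedBall (υ : Weight M) (a : AFun I M) :
    BddAbove (range fun f : weightedBall I υ => ‖a f‖) := by
  obtain ⟨r, hr⟩ := NormedSpace.isVonNBounded_iff' ℂ |>.1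
    ((isVonNBounded_weightedBall (I := I) υ).image a)
  refine ⟨r, ?_⟩
  rintro _ ⟨f, rfl⟩
  exact hr _ ⟨f, f.2, rfl⟩

theorem zero_mem_weightedBall (υ : Weight M) : (0 : Hol I M) ∈ weightedBall I υ := fun x => by
  simpa using (υ.pos x).le

variable (I) in
/-- The norm of the functional `a` on the unit ball of `𝒪_υ(M)`.  By the bipolar theorem this is the
Minkowski functional `‖a‖_υ` of `V_υ`, see `egauge_closedAcv_weightedDeltas`. -/
def weightedSeminorm (υ : Weight M) : Seminorm ℂ (AFun I M) :=
  Seminorm.ofSMulLE (fun a => ⨆ f : weightedBall I υ, ‖a f‖) (by simp)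
    (fun a b => by
      have : Nonempty (weightedBall I υ) := ⟨0, zero_mem_weightedBall υ⟩
      exact ciSup_le fun f => (norm_add_le (a f) (b f)).trans
        (add_le_add (le_ciSup (bddAbove_weightedBall υ a) f)
          (le_ciSup (bddAbove_weightedBall υ b) f)))
    (fun c a => by
      have : Nonempty (weightedBall I υ) := ⟨0, zero_mem_weightedBall υ⟩
      refine ciSup_le fun f => ?_
      change ‖c * a f‖ ≤ _
      rw [norm_mul]
      exact mul_le_mul_of_nonneg_left (le_ciSup (bddAbove_weightedBall υ a) f) (norm_nonneg c))

theorem weightedSeminorm_le_iff {υ : Weight M} {a : AFun I M} {C : ℝ} :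
    weightedSeminorm I υ a ≤ C ↔ ∀ f ∈ weightedBall I υ, ‖a f‖ ≤ C := by
  have : Nonempty (weightedBall I υ) := ⟨0, zero_mem_weightedBall υ⟩
  exact (ciSup_le_iff (bddAbove_weightedBall υ a)).trans Subtype.forall

theorem norm_apply_le_mul_weightedSeminorm {υ : Weight M} (a : AFun I M) {f : Hol I M} {C : ℝ}
    (hC : 0 ≤ C) (hf : ∀ x, ‖f x‖ ≤ C * υ x) : ‖a f‖ ≤ C * weightedSeminorm I υ a := by
  rcases hC.eq_or_lt with rfl | hC
  · have : f = 0 := DFunLike.ext _ _ fun x => norm_le_zero_iff.1 (by simpa using hf x)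
    simp [this]
  · have h1 : ((C : ℂ)⁻¹ • f) ∈ weightedBall I υ := fun x => by
      rw [Hol.smul_apply, norm_mul, norm_inv, Complex.norm_real, Real.norm_of_nonneg hC.le,
        inv_mul_le_iff₀ hC]
      exact hf x
    have h2 := (weightedSeminorm_le_iff (a := a)).1 le_rfl _ h1
    rwa [map_smul, smul_eq_mul, norm_mul, norm_inv, Complex.norm_real, Real.norm_of_nonneg hC.le,
      inv_mul_le_iff₀ hC] at h2

theorem weightedSeminorm_delta_le (υ : Weight M) (x : M) : weightedSeminorm I υ (delta I x) ≤ υ x :=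
  weightedSeminorm_le_iff.2 fun _ hf => hf x

theorem continuous_weightedSeminorm (υ : Weight M) : Continuous (weightedSeminorm I υ) := by
  refine Seminorm.continuous' (r := 1) ?_
  refine mem_of_superset ((ContinuousLinearMap.hasBasis_nhds_zero_of_basis
    Metric.nhds_basis_ball).mem_of_mem (i := (weightedBall I υ, 1))
    ⟨isVonNBounded_weightedBall υ, zero_lt_one⟩) fun a ha => ?_
  rw [Seminorm.mem_closedBall, sub_zero]
  exact weightedSeminorm_le_iff.2 fun f hf => (mem_ball_zero_iff.1 (ha f hf)).le

theorem weightedSeminorm_mono {υ ω : Weight M} (h : ∀ x, υ x ≤ ω x) :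
    weightedSeminorm I υ ≤ weightedSeminorm I ω := fun _ =>
  weightedSeminorm_le_iff.2 fun f hf => weightedSeminorm_le_iff.1 le_rfl f fun x =>
    (hf x).trans (h x)

variable [I.Boundaryless] [IsManifold I 1 M] [FiniteDimensional ℂ E] [T2Space M]

theorem egauge_closedAcv_weightedDeltas (υ : Weight M) (a : AFun I M) :
    egauge ℂ (closedAcv (weightedDeltas I υ)) a = ENNReal.ofReal (weightedSeminorm I υ a) := by
  refine le_antisymm ?_ (le_egauge_iff.2 fun c hc => ?_)
  · refine ENNReal.le_of_forall_pos_le_add fun ε hε _ => ?_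
    set r : ℝ := weightedSeminorm I υ a + ε
    have hε' : (0 : ℝ) < ε := hε
    have hr : 0 < r := add_pos_of_nonneg_of_pos (apply_nonneg _ _) hε'
    have hr0 : (r : ℂ) ≠ 0 := by exact_mod_cast hr.ne'
    have hmem : a ∈ (r : ℂ) • closedAcv (weightedDeltas I υ) := by
      rw [mem_smul_set_iff_inv_smul_mem₀ hr0, mem_closedAcv_weightedDeltas_iff]
      intro f hf
      change ‖(r : ℂ)⁻¹ * a f‖ ≤ 1
      rw [norm_mul, norm_inv, Complex.norm_real, Real.norm_of_nonneg hr.le, inv_mul_le_iff₀ hr,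
        mul_one]
      exact (weightedSeminorm_le_iff.1 le_rfl f hf).trans (le_add_of_nonneg_right hε'.le)
    refine (egauge_le_of_mem_smul hmem).trans (le_of_eq ?_)
    rw [← ofReal_norm, Complex.norm_real, Real.norm_of_nonneg hr.le,
      ENNReal.ofReal_add (apply_nonneg _ _) hε'.le, ENNReal.ofReal_coe_nnreal]
  · obtain ⟨b, hb, rfl⟩ := hc
    rw [← ofReal_norm]
    refine ENNReal.ofReal_le_ofReal ?_
    rw [map_smul_eq_mul]
    exact mul_le_of_le_one_right (norm_nonneg c)
      (weightedSeminorm_le_iff.2 fun f hf => norm_apply_le_of_mem_closedAcv hb hf)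

/-- The dual of `(𝒜(M), ‖·‖_υ)` is `𝒪_υ(M)`. -/
theorem exists_hol_of_le_weightedSeminorm {υ : Weight M} {φ : AFun I M →ₗ[ℂ] ℂ} {C : ℝ}
    (hC : 0 ≤ C) (hφ : ∀ a, ‖φ a‖ ≤ C * weightedSeminorm I υ a) :
    ∃ f : Hol I M, (∀ x, ‖f x‖ ≤ C * υ x) ∧ ∀ a : AFun I M, φ a = a f := by
  have hcont : Continuous φ := by
    refine continuous_of_continuousAt_zero φ.toAddMonoidHom ?_
    rw [ContinuousAt, map_zero]
    refine squeeze_zero_norm hφ ?_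
    have : Continuous fun a => C * weightedSeminorm I υ a :=
      continuous_const.mul (continuous_weightedSeminorm υ)
    simpa using this.tendsto 0
  obtain ⟨f, hf⟩ := AFun.exists_hol_of_continuous φ hcont
  refine ⟨f, fun x => ?_, hf⟩
  calc ‖f x‖ = ‖φ (delta I x)‖ := by rw [hf]; rfl
    _ ≤ C * weightedSeminorm I υ (delta I x) := hφ _
    _ ≤ C * υ x := by gcongr; exact weightedSeminorm_delta_le υ x

variable (I) in
/-- The seminorms `‖·‖_{υᵢ}` on `𝒜(M)` endowed with the uniform structure they define. -/
def weightedFamily {ι : Type} (υ : ι → Weight M) :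
    SeminormFamily ℂ (GaugeSpace fun i => weightedDeltas I (υ i)) ι :=
  fun i => weightedSeminorm I (υ i)

theorem withSeminorms_weightedFamily {ι : Type} [Nonempty ι] (υ : ι → Weight M) :
    WithSeminorms (weightedFamily I υ) := by
  rw [SeminormFamily.withSeminorms_iff_uniformSpace_eq_iInf]
  refine iInf_congr fun i => ?_
  have h : minkowskiPseudoEMetric (absConvex_closedAcv (weightedDeltas I (υ i)))
      (zero_mem_closedAcv (weightedDeltas I (υ i))) =
      (weightedSeminorm I (υ i)).toSeminormedAddCommGroup.toPseudoMetricSpace.toPseudoEMetricSpace := by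
    refine PseudoEMetricSpace.ext (EDist.ext (funext fun a => funext fun b => ?_))
    let _ := (weightedSeminorm I (υ i)).toSeminormedAddCommGroup
    refine (egauge_closedAcv_weightedDeltas (υ i) (a - b)).trans ?_
    change _ = edist a b
    rw [edist_eq_enorm_sub, ← ofReal_norm]
    rfl
  exact congrArg (fun m : PseudoEMetricSpace (AFun I M) => m.toUniformSpace) h

end OneManifold

/-! ### Seminorms on completions -/

section Completion

open UniformSpace (Completion)

variable {X : Type*} [UniformSpace X] [AddCommGroup X] [IsUniformAddGroup X] [Module ℂ X]

theorem Seminorm.uniformContinuous_of_continuous {p : Seminorm ℂ X} (hp : Continuous p) :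
    UniformContinuous p :=
  Seminorm.uniformContinuous_of_continuousAt_zero hp.continuousAt

theorem continuous_of_norm_le_seminorm {X : Type*} [AddCommGroup X] [Module ℂ X]
    [TopologicalSpace X] [IsTopologicalAddGroup X] {q : Seminorm ℂ X} (hq : Continuous q)
    {φ : X →ₗ[ℂ] ℂ} (hφ : ∀ x, ‖φ x‖ ≤ q x) : Continuous φ := by
  refine continuous_of_continuousAt_zero φ.toAddMonoidHom ?_
  rw [ContinuousAt, map_zero]
  exact squeeze_zero_norm hφ (by simpa using hq.tendsto 0)

theorem extension_seminorm_add_le {p : Seminorm ℂ X} (hp : Continuous p) (x y : Completion X) :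
    Completion.extension p (x + y) ≤ Completion.extension p x + Completion.extension p y := by
  have hc : Continuous (Completion.extension p) := Completion.continuous_extension
  have he : ∀ x : X, Completion.extension p (x : Completion X) = p x :=
    Completion.extension_coe (Seminorm.uniformContinuous_of_continuous hp)
  induction x, y using Completion.induction_on₂ with
  | hp =>
    exact isClosed_le (hc.comp continuous_add)
      ((hc.comp continuous_fst).add (hc.comp continuous_snd))
  | ih a b =>
    rw [← Completion.coe_add, he, he, he]
    exact map_add_le_add p a b

variable [UniformContinuousConstSMul ℂ X]

theorem extension_seminorm_smul_le {p : Seminorm ℂ X} (hp : Continuous p) (c : ℂ)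
    (x : Completion X) : Completion.extension p (c • x) ≤ ‖c‖ * Completion.extension p x := by
  have hc : Continuous (Completion.extension p) := Completion.continuous_extension
  have he : ∀ x : X, Completion.extension p (x : Completion X) = p x :=
    Completion.extension_coe (Seminorm.uniformContinuous_of_continuous hp)
  induction x using Completion.induction_on with
  | hp => exact isClosed_le (hc.comp (continuous_const_smul c)) (continuous_const.mul hc)
  | ih a => rw [← Completion.coe_smul, he, he, map_smul_eq_mul]

/-- The continuous extension of a continuous seminorm to the completion. -/
def completionSeminorm (p : Seminorm ℂ X) (hp : Continuous p) : Seminorm ℂ (Completion X) :=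
  Seminorm.ofSMulLE (Completion.extension p)
    (by rw [← Completion.coe_zero, Completion.extension_coe
      (Seminorm.uniformContinuous_of_continuous hp), map_zero])
    (extension_seminorm_add_le hp) (extension_seminorm_smul_le hp)

theorem continuous_completionSeminorm (p : Seminorm ℂ X) (hp : Continuous p) :
    Continuous (completionSeminorm p hp) :=
  Completion.continuous_extension (f := p)

@[simp]
theorem completionSeminorm_coe (p : Seminorm ℂ X) (hp : Continuous p) (x : X) :
    completionSeminorm p hp (x : Completion X) = p x :=
  Completion.extension_coe (Seminorm.uniformContinuous_of_continuous hp) x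

theorem withSeminorms_completionSeminorm {ι : Type*} [Nonempty ι] {p : SeminormFamily ℂ X ι}
    (hp : WithSeminorms p) :
    WithSeminorms fun i => completionSeminorm (p i) (hp.continuous_seminorm i) := by
  set P : SeminormFamily ℂ (Completion X) ι :=
    fun i => completionSeminorm (p i) (hp.continuous_seminorm i)
  have hP : ∀ i, Continuous (P i) := fun i => continuous_completionSeminorm _ _
  rw [SeminormFamily.withSeminorms_iff_nhds_eq_iInf]
  refine le_antisymm (le_iInf fun i => ?_) fun W hW => ?_
  · rw [← tendsto_iff_comap]
    simpa using (hP i).tendsto 0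
  · obtain ⟨W', ⟨hW', hcl⟩, hsub⟩ := (closed_nhds_basis (0 : Completion X)).mem_iff.1 hW
    have h1 : ((↑) : X → Completion X) ⁻¹' W' ∈ 𝓝 (0 : X) :=
      (Completion.continuous_coe X).continuousAt.preimage_mem_nhds (by rwa [Completion.coe_zero])
    obtain ⟨s, ε, hε, hs⟩ := hp.mem_nhds_iff _ _ |>.1 h1
    have h2 : {z | ∀ i ∈ s, P i z < ε} ∈ ⨅ i, comap (P i) (𝓝 0) := by
      have : {z | ∀ i ∈ s, P i z < ε} = ⋂ i ∈ s, {z | P i z < ε} := by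
        ext; simp
      rw [this, Finset.iInter_mem_sets]
      exact fun i _ => mem_iInf_of_mem i ⟨Iio ε, Iio_mem_nhds hε, fun z hz => hz⟩
    refine mem_of_superset h2 (subset_trans ?_ hsub)
    have ho : IsOpen {z | ∀ i ∈ s, P i z < ε} := by
      have : {z | ∀ i ∈ s, P i z < ε} = ⋂ i ∈ s, {z | P i z < ε} := by
        ext; simp
      rw [this]
      exact isOpen_biInter_finset fun i _ => isOpen_lt (hP i) continuous_const
    have hd : DenseRange ((↑) : X → Completion X) := Completion.denseRange_coe
    refine (hd.open_subset_closure_inter ho).trans (closure_minimal ?_ hcl)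
    rintro _ ⟨hz, x, rfl⟩
    refine hs ?_
    rw [Seminorm.mem_ball, sub_zero]
    refine Seminorm.finset_sup_apply_lt hε fun i hi => ?_
    have := hz i hi
    rwa [completionSeminorm_coe] at this

/-- For a directed family of seminorms, each continuous seminorm is dominated by a multiple of a
single member. -/
theorem exists_le_of_withSeminorms {Y : Type*} [AddCommGroup Y] [Module ℂ Y]
    [TopologicalSpace Y] {ι : Type*} [Preorder ι] [IsDirectedOrder ι] [Nonempty ι]
    {p : SeminormFamily ℂ Y ι} (hp : WithSeminorms p) (hmono : Monotone p) {q : Seminorm ℂ Y}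
    (hq : Continuous q) : ∃ (i : ι) (C : ℝ), 0 < C ∧ ∀ x, q x ≤ C * p i x := by
  obtain ⟨s, C, hC, h⟩ := Seminorm.bound_of_continuous hp q hq
  obtain ⟨i, hi⟩ := s.exists_le
  refine ⟨i, C, by positivity, fun x => (h x).trans ?_⟩
  change (C : ℝ) * _ ≤ _
  gcongr
  exact Finset.sup_le (fun j hj => hmono (hi j hj)) x

/-- A continuous bilinear map into a complete Hausdorff space extends to the completions. -/
theorem exists_bilinear_extension {Y Z : Type*} [UniformSpace Y] [AddCommGroup Y]
    [IsUniformAddGroup Y] [Module ℂ Y] [UniformContinuousConstSMul ℂ Y]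
    [UniformSpace Z] [AddCommGroup Z] [IsUniformAddGroup Z] [Module ℂ Z] [ContinuousConstSMul ℂ Z]
    [CompleteSpace Z] [T0Space Z] (β : X →ₗ[ℂ] Y →ₗ[ℂ] Z)
    (hβ : Continuous fun p : X × Y => β p.1 p.2) :
    ∃ B : Completion X →ₗ[ℂ] Completion Y →ₗ[ℂ] Z,
      (Continuous fun p : Completion X × Completion Y => B p.1 p.2) ∧
      ∀ (x : X) (y : Y), B (x : Completion X) (y : Completion Y) = β x y := by
  let φ : X →+ Y →+ Z := AddMonoidHom.mk' (fun x => (β x).toAddMonoidHom) fun a b => by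
    ext y; simp
  have dX : IsDenseInducing (Completion.toCompl : X →+ Completion X) :=
    Completion.isDenseInducing_coe
  have dY : IsDenseInducing (Completion.toCompl : Y →+ Completion Y) :=
    Completion.isDenseInducing_coe
  have hφ : Continuous fun p : X × Y => φ p.1 p.2 := hβ
  obtain ⟨F, hF, hFe⟩ : ∃ F : Completion X × Completion Y → Z, Continuous F ∧
      ∀ (x : X) (y : Y), F ((x : Completion X), (y : Completion Y)) = β x y :=
    ⟨IsDenseInducing.extend (dX.prodMap dY) (fun p : X × Y => φ p.1 p.2),
      IsDenseInducing.extend_Z_bilin dX dY hφ, fun x y => (dX.prodMap dY).extend_eq hφ (x, y)⟩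
  refine ⟨LinearMap.mk₂ ℂ (fun x y => F (x, y)) ?_ ?_ ?_ ?_, hF, hFe⟩
  · intro x x' y
    induction x, x', y using Completion.induction_on₃ with
    | hp =>
      exact isClosed_eq (hF.comp ((continuous_fst.add (continuous_fst.comp continuous_snd)).prodMk
          (continuous_snd.comp continuous_snd)))
        ((hF.comp (continuous_fst.prodMk (continuous_snd.comp continuous_snd))).add
          (hF.comp continuous_snd))
    | ih a b c => rw [← Completion.coe_add, hFe, hFe, hFe, map_add, LinearMap.add_apply]
  · intro c x y
    induction x, y using Completion.induction_on₂ with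
    | hp =>
      exact isClosed_eq (hF.comp ((continuous_fst.const_smul c).prodMk continuous_snd))
        (hF.const_smul c)
    | ih a b => rw [← Completion.coe_smul, hFe, hFe, map_smul, LinearMap.smul_apply]
  · intro x y y'
    induction x, y, y' using Completion.induction_on₃ with
    | hp =>
      exact isClosed_eq (hF.comp (continuous_fst.prodMk
          ((continuous_fst.comp continuous_snd).add (continuous_snd.comp continuous_snd))))
        ((hF.comp (continuous_fst.prodMk (continuous_fst.comp continuous_snd))).add
          (hF.comp (continuous_fst.prodMk (continuous_snd.comp continuous_snd))))
    | ih a b c => rw [← Completion.coe_add, hFe, hFe, hFe, map_add]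
  · intro c x y
    induction x, y using Completion.induction_on₂ with
    | hp =>
      exact isClosed_eq (hF.comp (continuous_fst.prodMk (continuous_snd.const_smul c)))
        (hF.const_smul c)
    | ih a b => rw [← Completion.coe_smul, hFe, hFe, map_smul]

end Completion

/-! ### Recognizing a complete projective tensor product -/

section Algebra

variable {X Y Z : Type*} [AddCommGroup X] [Module ℂ X] [AddCommGroup Y] [Module ℂ Y]
  [AddCommGroup Z] [Module ℂ Z]

/-- The linear map on the tensor product defined by a bilinear map. -/
def ProjTensor.lift (β : X →ₗ[ℂ] Y →ₗ[ℂ] Z) : ProjTensor X Y →ₗ[ℂ] Z :=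
  (TensorProduct.lift β : X ⊗[ℂ] Y →ₗ[ℂ] Z)

@[simp]
theorem ProjTensor.lift_tmul (β : X →ₗ[ℂ] Y →ₗ[ℂ] Z) (x : X) (y : Y) :
    ProjTensor.lift β (ProjTensor.tmul x y) = β x y :=
  TensorProduct.lift.tmul x y

theorem ProjTensor.hom_ext {S T : ProjTensor X Y →ₗ[ℂ] Z}
    (h : ∀ x y, S (ProjTensor.tmul x y) = T (ProjTensor.tmul x y)) : S = T :=
  TensorProduct.ext' (M := X) (N := Y) h

variable (X Y) in
/-- The canonical bilinear map `X × Y → X ⊗ Y`. -/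
def ProjTensor.mk : X →ₗ[ℂ] Y →ₗ[ℂ] ProjTensor X Y := TensorProduct.mk ℂ X Y

/-- By the Hahn-Banach theorem, a seminorm is attained at each point by a functional which it
dominates. -/
theorem Seminorm.exists_dual_vector (r : Seminorm ℂ X) (u : X) :
    ∃ φ : X →ₗ[ℂ] ℂ, ‖φ u‖ = r u ∧ ∀ v, ‖φ v‖ ≤ r v := by
  rcases eq_or_ne u 0 with rfl | hu
  · exact ⟨0, by simp, fun v => by simp⟩
  · let f : X →ₗ.[ℂ] ℂ := LinearPMap.mkSpanSingleton u ((r u : ℝ) : ℂ) hu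
    have hf : ∀ v : f.domain, ‖f.toFun v‖ ≤ r v := by
      rintro ⟨v, hv⟩
      obtain ⟨c, rfl⟩ := Submodule.mem_span_singleton.1 hv
      have : f.toFun ⟨c • u, hv⟩ = c • ((r u : ℝ) : ℂ) :=
        LinearPMap.mkSpanSingleton'_apply _ _ _ _ _
      rw [this, norm_smul, Complex.norm_real, Real.norm_of_nonneg (apply_nonneg r u),
        map_smul_eq_mul]
    obtain ⟨φ, hφ, hφr⟩ := Module.Dual.exists_extension_of_le_seminorm _ f.toFun hf
    refine ⟨φ, ?_, hφr⟩
    have h1 := hφ ⟨u, Submodule.mem_span_singleton_self u⟩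
    have h2 : f.toFun ⟨u, Submodule.mem_span_singleton_self u⟩ = ((r u : ℝ) : ℂ) :=
      LinearPMap.mkSpanSingleton_apply ℂ ℂ hu _
    change φ u = _ at h1
    rw [h1, h2, Complex.norm_real, Real.norm_of_nonneg (apply_nonneg r u)]

theorem continuous_finset_sup_seminorm [TopologicalSpace X] {ι : Type*} (p : ι → Seminorm ℂ X)
    (hp : ∀ i, Continuous (p i)) (s : Finset ι) : Continuous (s.sup p : Seminorm ℂ X) := by
  classical
  induction s using Finset.induction_on with
  | empty => exact continuous_const (y := (0 : ℝ))
  | insert i s _ ih =>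
    rw [Finset.sup_insert]
    exact (hp i).max ih

theorem exists_continuous_seminorm_of_mem_nhds {X : Type*} [AddCommGroup X] [Module ℂ X]
    [TopologicalSpace X] [PolynormableSpace ℂ X] {U : Set X} (hU : U ∈ 𝓝 0) : ∃ p : Seminorm ℂ X, Continuous p ∧ ∀ x, p x ≤ 1 → x ∈ U := by
  obtain ⟨s, ε, hε, hs⟩ := (PolynormableSpace.withSeminorms ℂ X).mem_nhds_iff _ _ |>.1 hU
  set q : Seminorm ℂ X := s.sup fun p : {p : Seminorm ℂ X // Continuous p} => p.1
  have hq : Continuous q := continuous_finset_sup_seminorm _ (fun p => p.2) s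
  refine ⟨(2 / ε).toNNReal • q, continuous_const.mul hq, fun x hx => hs ?_⟩
  have h1 : ((2 / ε).toNNReal : ℝ) * q x ≤ 1 := hx
  rw [Real.coe_toNNReal _ (by positivity), div_mul_eq_mul_div, div_le_one hε] at h1
  rw [Seminorm.mem_ball, sub_zero]
  change q x < ε
  linarith

end Algebra

section Tensor

variable {X Y : Type*} [AddCommGroup X] [Module ℂ X] [TopologicalSpace X]
  [AddCommGroup Y] [Module ℂ Y] [TopologicalSpace Y]

instance : PolynormableSpace ℂ (ProjTensor X Y) := by
  refine PolynormableSpace.sInf fun t ht => ?_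
  obtain ⟨h1, h2, h3, -⟩ := ht
  exact polynormableSpace_of_locallyConvexSpace (ProjTensor X Y)

theorem continuous_tmul : Continuous fun p : X × Y => ProjTensor.tmul p.1 p.2 :=
  continuous_sInf_rng.2 fun _ ht => ht.2.2.2

theorem ProjTensor.continuous_lift {Z : Type*} [AddCommGroup Z] [Module ℂ Z] [TopologicalSpace Z]
    [IsTopologicalAddGroup Z] [ContinuousSMul ℂ Z] [LocallyConvexSpace ℝ Z]
    (β : X →ₗ[ℂ] Y →ₗ[ℂ] Z) (hβ : Continuous fun p : X × Y => β p.1 p.2) :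
    Continuous (ProjTensor.lift β) := by
  refine continuous_sInf_dom
    (t₁ := {t | @IsTopologicalAddGroup (ProjTensor X Y) t _ ∧
      @ContinuousSMul ℂ (ProjTensor X Y) _ _ t ∧
      @LocallyConvexSpace ℝ (ProjTensor X Y) _ _ _ _ t ∧
      @Continuous _ _ _ t fun p : X × Y => ProjTensor.tmul p.1 p.2})
    (t := TopologicalSpace.induced (ProjTensor.lift β) inferInstance) ?_
    continuous_induced_dom
  refine ⟨topologicalAddGroup_induced _, continuousSMul_induced _, ?_,
    continuous_induced_rng.2 ?_⟩
  · let _ : TopologicalSpace (ProjTensor X Y) :=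
      TopologicalSpace.induced (ProjTensor.lift β) inferInstance
    exact Topology.IsInducing.locallyConvexSpace
      (f := (ProjTensor.lift β).restrictScalars ℝ) ⟨rfl⟩
  · simpa [Function.comp_def] using hβ

/-- A continuous bilinear map `β` into a complete space `Z`, whose values span a dense subspace,
makes `Z` the complete projective tensor product as soon as equicontinuous sets of functionals on
`X ⊗ Y` extend along `β` to equicontinuous sets of functionals on `Z`: by the Hahn-Banach theorem,
`Z` then induces the projective topology on `X ⊗ Y`. -/
theorem exists_completedTensor_equiv {Z : Type*} [UniformSpace Z] [AddCommGroup Z]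
    [IsUniformAddGroup Z] [Module ℂ Z] [ContinuousSMul ℂ Z] [LocallyConvexSpace ℝ Z]
    [CompleteSpace Z] [T0Space Z] (β : X →ₗ[ℂ] Y →ₗ[ℂ] Z)
    (hβ : Continuous fun p : X × Y => β p.1 p.2)
    (hdense : Dense (Submodule.span ℂ (range fun p : X × Y => β p.1 p.2) : Set Z))
    (hext : ∀ r : Seminorm ℂ (ProjTensor X Y), Continuous r → ∃ N ∈ 𝓝 (0 : Z),
      ∀ φ : ProjTensor X Y →ₗ[ℂ] ℂ, (∀ u, ‖φ u‖ ≤ r u) → ∃ ψ : Z →ₗ[ℂ] ℂ,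
        (∀ x y, ψ (β x y) = φ (ProjTensor.tmul x y)) ∧ ∀ z ∈ N, ‖ψ z‖ ≤ 1) :
    ∃ Φ : CompletedTensor X Y ≃L[ℂ] Z, ∀ x y, Φ (ctmul x y) = β x y := by
  set T := ProjTensor.lift β
  have hT : Continuous T := ProjTensor.continuous_lift β hβ
  have hind : Topology.IsInducing T := by
    refine (IsTopologicalAddGroup.isInducing_iff_nhds_zero (f := T.toAddMonoidHom)).2
      (le_antisymm ?_ ?_)
    · exact tendsto_iff_comap.1 (by simpa using hT.tendsto 0)
    intro W hW
    obtain ⟨r, hr, hrW⟩ := exists_continuous_seminorm_of_mem_nhds hW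
    obtain ⟨N, hN, hNφ⟩ := hext r hr
    refine ⟨N, hN, fun u hu => hrW u ?_⟩
    obtain ⟨φ, hφu, hφr⟩ := Seminorm.exists_dual_vector r u
    obtain ⟨ψ, hψ, hψN⟩ := hNφ φ hφr
    have h1 : ψ ∘ₗ T = φ := ProjTensor.hom_ext fun x y => by
      rw [LinearMap.comp_apply, ProjTensor.lift_tmul, hψ]
    rw [← hφu, ← h1]
    exact hψN _ hu
  have huT : IsUniformInducing T := AddMonoidHom.isUniformInducing_of_isInducing
    (f := T.toAddMonoidHom) hind
  have hdT : DenseRange T := by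
    refine hdense.mono ?_
    have : Submodule.span ℂ (range fun p : X × Y => β p.1 p.2) ≤ LinearMap.range T := by
      refine Submodule.span_le.2 ?_
      rintro _ ⟨p, rfl⟩
      exact ⟨ProjTensor.tmul p.1 p.2, ProjTensor.lift_tmul β _ _⟩
    exact this
  let pkg : AbstractCompletion (ProjTensor X Y) :=
    { space := Z, coe := T, uniformStruct := inferInstance, complete := inferInstance,
      separation := inferInstance, isUniformInducing := huT, dense := hdT }
  let e : CompletedTensor X Y ≃ᵤ Z := UniformSpace.Completion.cPkg.compareEquiv pkg
  have he : ∀ u : ProjTensor X Y, e (u : CompletedTensor X Y) = T u :=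
    fun u => UniformSpace.Completion.cPkg.compare_coe pkg u
  have hec : Continuous e := e.continuous
  refine ⟨⟨⟨⟨⟨e, fun a b => ?_⟩, fun c a => ?_⟩, e.symm, e.left_inv, e.right_inv⟩,
    hec, e.symm.continuous⟩, fun x y => ?_⟩
  · induction a, b using UniformSpace.Completion.induction_on₂ with
    | hp =>
      exact isClosed_eq (hec.comp continuous_add)
        ((hec.comp continuous_fst).add (hec.comp continuous_snd))
    | ih a b => rw [← UniformSpace.Completion.coe_add, he, he, he, map_add]
  · change e (c • a) = c • e a
    induction a using UniformSpace.Completion.induction_on with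
    | hp => exact isClosed_eq (hec.comp (continuous_const_smul c)) (hec.const_smul c)
    | ih a => rw [← UniformSpace.Completion.coe_smul, he, he, map_smul]
  · exact (he _).trans (ProjTensor.lift_tmul β x y)

end Tensor

/-! ### Estimates for bilinear maps -/

section Bilinear

variable {X Y Z : Type*} [AddCommGroup X] [Module ℂ X] [AddCommGroup Y] [Module ℂ Y]
  [AddCommGroup Z] [Module ℂ Z]

/-- A seminorm bounded by `K` on the `p`-ball of radius `ε` is at most `K / ε * p`. -/
theorem Seminorm.le_mul_of_bound (p q : Seminorm ℂ X) {ε K : ℝ} (hε : 0 < ε)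
    (h : ∀ x, p x < ε → q x ≤ K) (x : X) : q x ≤ K / ε * p x := by
  have hK : 0 ≤ K := by simpa using h 0 (by simpa using hε)
  rw [div_mul_eq_mul_div, le_div_iff₀ hε]
  have key : ∀ s, p x < s → q x * ε ≤ K * s := by
    intro s hs
    have hs0 : 0 < s := (apply_nonneg p x).trans_lt hs
    have hn : ‖((ε / s : ℝ) : ℂ)‖ = ε / s := by
      rw [Complex.norm_real, Real.norm_of_nonneg (by positivity)]
    have h1 := h (((ε / s : ℝ) : ℂ) • x) (by
      rw [map_smul_eq_mul, hn, div_mul_eq_mul_div, div_lt_iff₀ hs0]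
      gcongr)
    rw [map_smul_eq_mul, hn, div_mul_eq_mul_div, div_le_iff₀ hs0] at h1
    linarith
  have hlim : Tendsto (fun s => K * s) (𝓝[>] (p x)) (𝓝 (K * p x)) :=
    ((continuous_const.mul continuous_id).tendsto _).mono_left nhdsWithin_le_nhds
  exact ge_of_tendsto hlim (eventually_mem_nhdsWithin.mono key)

variable [TopologicalSpace X] [TopologicalSpace Y] [TopologicalSpace Z]

theorem continuous_bilinear_of_le [IsTopologicalAddGroup X] [IsTopologicalAddGroup Y]
    {ι : Type*} [Nonempty ι] {q : SeminormFamily ℂ Z ι} (hq : WithSeminorms q)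
    (β : X →ₗ[ℂ] Y →ₗ[ℂ] Z) (h : ∀ i, ∃ (p : Seminorm ℂ X) (p' : Seminorm ℂ Y), Continuous p ∧
      Continuous p' ∧ ∀ x y, q i (β x y) ≤ p x * p' y) :
    Continuous fun z : X × Y => β z.1 z.2 := by
  have := hq.topologicalAddGroup
  let φ : X →+ Y →+ Z := AddMonoidHom.mk' (fun x => (β x).toAddMonoidHom) fun a b => by
    ext y; simp
  refine continuous_of_continuousAt_zero₂ φ ?_ (fun x => ?_) (fun y => ?_)
  · refine (hq.tendsto_nhds _ _).2 fun i ε hε => ?_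
    obtain ⟨p, p', hp, hp', hle⟩ := h i
    have : Tendsto (fun z : X × Y => p z.1 * p' z.2) (𝓝 (0, 0)) (𝓝 0) := by
      have hc : Continuous fun z : X × Y => p z.1 * p' z.2 :=
        (hp.comp continuous_fst).mul (hp'.comp continuous_snd)
      simpa using hc.tendsto (0, 0)
    filter_upwards [this.eventually_lt_const hε] with z hz
    change q i (β z.1 z.2 - β 0 0) < ε
    rw [map_zero, sub_zero]
    exact (hle z.1 z.2).trans_lt hz
  · refine (hq.tendsto_nhds _ _).2 fun i ε hε => ?_
    obtain ⟨p, p', hp, hp', hle⟩ := h i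
    have : Tendsto (fun y : Y => p x * p' y) (𝓝 0) (𝓝 0) := by
      have hc : Continuous fun y : Y => p x * p' y := continuous_const.mul hp'
      simpa using hc.tendsto 0
    filter_upwards [this.eventually_lt_const hε] with y hy
    rw [map_zero, sub_zero]
    exact (hle x y).trans_lt hy
  · refine (hq.tendsto_nhds _ _).2 fun i ε hε => ?_
    obtain ⟨p, p', hp, hp', hle⟩ := h i
    have : Tendsto (fun x : X => p x * p' y) (𝓝 0) (𝓝 0) := by
      have hc : Continuous fun x : X => p x * p' y := hp.mul continuous_const
      simpa using hc.tendsto 0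
    filter_upwards [this.eventually_lt_const hε] with x hx
    change q i (β x y - β 0 y) < ε
    rw [map_zero, LinearMap.zero_apply, sub_zero]
    exact (hle x y).trans_lt hx

theorem exists_ball_subset_of_withSeminorms {ι : Type*} [Preorder ι] [IsDirectedOrder ι] [Nonempty ι]
    {p : SeminormFamily ℂ X ι} (hp : WithSeminorms p) (hmono : Monotone p) {U : Set X}
    (hU : U ∈ 𝓝 0) : ∃ (i : ι) (ε : ℝ), 0 < ε ∧ ∀ j, i ≤ j → ∀ x, p j x < ε → x ∈ U := by
  obtain ⟨s, ε, hε, hs⟩ := hp.mem_nhds_iff _ _ |>.1 hU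
  obtain ⟨i, hi⟩ := s.exists_le
  refine ⟨i, ε, hε, fun j hj x hx => hs ?_⟩
  rw [Seminorm.mem_ball, sub_zero]
  exact (Finset.sup_le (fun k hk => hmono ((hi k hk).trans hj)) x).trans_lt hx

theorem exists_bound_bilinear {ι : Type*} [Preorder ι] [IsDirectedOrder ι]
    [Nonempty ι] {p : SeminormFamily ℂ X ι} (hp : WithSeminorms p) (hmono : Monotone p)
    {p' : SeminormFamily ℂ Y ι} (hp' : WithSeminorms p') (hmono' : Monotone p')
    (β : X →ₗ[ℂ] Y →ₗ[ℂ] Z) (hβ : Continuous fun z : X × Y => β z.1 z.2) {r : Seminorm ℂ Z}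
    (hr : Continuous r) : ∃ (i : ι) (C : ℝ), 0 < C ∧ ∀ x y, r (β x y) ≤ C * p i x * p' i y := by
  have h : {z : X × Y | r (β z.1 z.2) < 1} ∈ 𝓝 ((0, 0) : X × Y) :=
    (isOpen_lt (hr.comp hβ) continuous_const).mem_nhds (by simp)
  rw [nhds_prod_eq] at h
  obtain ⟨U, hU, V, hV, hUV⟩ := mem_prod_iff.1 h
  obtain ⟨i, ε, hε, hi⟩ := exists_ball_subset_of_withSeminorms hp hmono hU
  obtain ⟨j, δ, hδ, hj⟩ := exists_ball_subset_of_withSeminorms hp' hmono' hV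
  obtain ⟨k, hik, hjk⟩ := exists_ge_ge i j
  refine ⟨k, 1 / ε / δ, by positivity, fun x y => ?_⟩
  have h1 : ∀ y, p' k y < δ → ∀ x, r (β x y) ≤ 1 / ε * p k x := fun y hy =>
    Seminorm.le_mul_of_bound (p k) (r.comp (β.flip y)) hε fun x hx =>
      (hUV (mk_mem_prod (hi k hik x hx) (hj k hjk y hy)) : r (β x y) < 1).le
  have h2 := Seminorm.le_mul_of_bound (p' k) (r.comp (β x)) hδ (fun y hy => h1 y hy x) y
  refine h2.trans (le_of_eq ?_)
  ring

end Bilinear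

section Completion

open UniformSpace (Completion)

variable {X : Type*} [UniformSpace X] [AddCommGroup X] [IsUniformAddGroup X] [Module ℂ X]
  [UniformContinuousConstSMul ℂ X]

/-- A functional dominated by a multiple of a continuous seminorm extends to the completion. -/
theorem exists_functional_extension (p : Seminorm ℂ X) (hp : Continuous p) {φ : X →ₗ[ℂ] ℂ} {C : ℝ}
    (hφ : ∀ x, ‖φ x‖ ≤ C * p x) : ∃ ψ : Completion X →L[ℂ] ℂ, (∀ x : X, ψ x = φ x) ∧
      ∀ z, ‖ψ z‖ ≤ C * completionSeminorm p hp z := by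
  have hφc : Continuous φ := by
    refine continuous_of_continuousAt_zero φ.toAddMonoidHom ?_
    rw [ContinuousAt, map_zero]
    have hc : Continuous fun x => C * p x := continuous_const.mul hp
    exact squeeze_zero_norm hφ (by simpa using hc.tendsto 0)
  have hu : UniformContinuous φ :=
    uniformContinuous_addMonoidHom_of_continuous (f := φ.toAddMonoidHom) hφc
  have hc : Continuous (Completion.extension φ) := Completion.continuous_extension
  have he : ∀ x : X, Completion.extension φ (x : Completion X) = φ x := Completion.extension_coe hu
  refine ⟨⟨⟨⟨Completion.extension φ, fun x y => ?_⟩, fun c x => ?_⟩, hc⟩, he, fun z => ?_⟩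
  · induction x, y using Completion.induction_on₂ with
    | hp =>
      exact isClosed_eq (hc.comp continuous_add)
        ((hc.comp continuous_fst).add (hc.comp continuous_snd))
    | ih a b => rw [← Completion.coe_add, he, he, he, map_add]
  · change Completion.extension φ (c • x) = c • Completion.extension φ x
    induction x using Completion.induction_on with
    | hp => exact isClosed_eq (hc.comp (continuous_const_smul c)) (hc.const_smul c)
    | ih a => rw [← Completion.coe_smul, he, he, map_smul]
  · change ‖Completion.extension φ z‖ ≤ _
    induction z using Completion.induction_on with
    | hp =>
      exact isClosed_le hc.norm ((continuous_completionSeminorm p hp).const_smul C)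
    | ih a =>
      rw [he, completionSeminorm_coe]
      exact hφ a

end Completion

/-! ### Bounded bilinear forms on spaces of analytic functionals -/

section Product

variable {E₁ E₂ : Type*} [NormedAddCommGroup E₁] [NormedSpace ℂ E₁] [NormedAddCommGroup E₂]
  [NormedSpace ℂ E₂] {H₁ H₂ : Type*} [TopologicalSpace H₁] [TopologicalSpace H₂]
  {I₁ : ModelWithCorners ℂ E₁ H₁} {I₂ : ModelWithCorners ℂ E₂ H₂}
  {M₁ M₂ : Type*} [TopologicalSpace M₁] [ChartedSpace H₁ M₁] [TopologicalSpace M₂]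
  [ChartedSpace H₂ M₂] [I₁.Boundaryless] [I₂.Boundaryless]
  [IsManifold I₁ 1 M₁] [IsManifold I₂ 1 M₂] [FiniteDimensional ℂ E₁] [FiniteDimensional ℂ E₂]

/-- The bilinear version of the Taylor estimate: `(x, y) ↦ β(δ_x, δ_y)` is holomorphic. -/
theorem mdifferentiable_bilinear_delta {p₁ : Seminorm ℂ (AFun I₁ M₁)} (hp₁ : Continuous p₁)
    {p₂ : Seminorm ℂ (AFun I₂ M₂)} (hp₂ : Continuous p₂)
    (β : AFun I₁ M₁ →ₗ[ℂ] AFun I₂ M₂ →ₗ[ℂ] ℂ) (hβ : ∀ a b, ‖β a b‖ ≤ p₁ a * p₂ b) :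
    MDifferentiable (I₁.prod I₂) 𝓘(ℂ, ℂ) fun z : M₁ × M₂ => β (delta I₁ z.1) (delta I₂ z.2) := by
  rintro ⟨c, d⟩
  refine mdifferentiableAt_of_differentiableAt_extChartAt ?_
  rw [extChartAt_prod]
  set e := extChartAt I₁ c
  set f := extChartAt I₂ d
  change DifferentiableAt ℂ (fun z : E₁ × E₂ => β (delta I₁ (e.symm z.1)) (delta I₂ (f.symm z.2)))
    (e c, f d)
  obtain ⟨R₁, D₁, hR₁, hD₁⟩ := exists_delta_taylor (I := I₁) c
  obtain ⟨C₁, hC₁, hb₁, ht₁⟩ := hD₁ p₁ hp₁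
  obtain ⟨R₂, D₂, hR₂, hD₂⟩ := exists_delta_taylor (I := I₂) d
  obtain ⟨C₂, hC₂, hb₂, ht₂⟩ := hD₂ p₂ hp₂
  have hc : e.symm (e c) = c := extChartAt_to_inv c
  have hd : f.symm (f d) = d := extChartAt_to_inv d
  let L : E₁ × E₂ →ₗ[ℂ] ℂ :=
    (β.flip (delta I₂ d) ∘ₗ D₁) ∘ₗ LinearMap.fst ℂ E₁ E₂ +
      (β (delta I₁ c) ∘ₗ D₂) ∘ₗ LinearMap.snd ℂ E₁ E₂
  refine HasFDerivAt.differentiableAt (f' := LinearMap.toContinuousLinearMap L) ?_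
  rw [hasFDerivAt_iff_isLittleO]
  set A₁ := p₁ (delta I₁ c)
  set A₂ := p₂ (delta I₂ d)
  have hA₁ : 0 ≤ A₁ := apply_nonneg _ _
  have hA₂ : 0 ≤ A₂ := apply_nonneg _ _
  set K := C₁ * (A₂ + 2 * C₂) + (A₁ + C₁) * C₂ + C₁ * C₂
  have hO : (fun z : E₁ × E₂ => β (delta I₁ (e.symm z.1)) (delta I₂ (f.symm z.2)) -
      β (delta I₁ (e.symm (e c))) (delta I₂ (f.symm (f d))) -
      (LinearMap.toContinuousLinearMap L) (z - (e c, f d))) =O[𝓝 (e c, f d)]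
        fun z => ‖z - (e c, f d)‖ ^ 2 := by
    refine Asymptotics.IsBigO.of_bound K ?_
    filter_upwards [ball_mem_nhds (e c, f d) (lt_min (lt_min hR₁ hR₂) one_pos)] with z hz
    rw [norm_pow, norm_norm, hc, hd]
    rw [mem_ball, dist_eq_norm, lt_min_iff, lt_min_iff] at hz
    set N := ‖z - (e c, f d)‖
    set h := z.1 - e c
    set k := z.2 - f d
    have hhN : ‖h‖ ≤ N := norm_fst_le (z - (e c, f d))
    have hkN : ‖k‖ ≤ N := norm_snd_le (z - (e c, f d))
    set x := delta I₁ (e.symm z.1)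
    set y := delta I₂ (f.symm z.2)
    have hx := ht₁ z.1 (by rw [mem_ball, dist_eq_norm]; exact hhN.trans_lt hz.1.1)
    have hy := ht₂ z.2 (by rw [mem_ball, dist_eq_norm]; exact hkN.trans_lt hz.1.2)
    change p₁ (x - delta I₁ c - D₁ h) ≤ C₁ * ‖h‖ ^ 2 at hx
    change p₂ (y - delta I₂ d - D₂ k) ≤ C₂ * ‖k‖ ^ 2 at hy
    have hN0 : 0 ≤ N := norm_nonneg _
    have hk1 : ‖k‖ ≤ 1 := hkN.trans hz.2.le
    have hh1 : ‖h‖ ≤ 1 := hhN.trans hz.2.le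
    have hy' : p₂ y ≤ A₂ + 2 * C₂ := by
      have h1 : y = delta I₂ d + D₂ k + (y - delta I₂ d - D₂ k) := by abel
      rw [h1]
      refine (map_add_le_add _ _ _).trans ((add_le_add (map_add_le_add _ _ _) hy).trans ?_)
      have h2 := hb₂ k
      have h3 : C₂ * ‖k‖ ≤ C₂ := mul_le_of_le_one_right hC₂ hk1
      have h4 : C₂ * ‖k‖ ^ 2 ≤ C₂ := mul_le_of_le_one_right hC₂ (pow_le_one₀ (norm_nonneg _) hk1)
      linarith
    have hx' : p₁ (delta I₁ c + D₁ h) ≤ A₁ + C₁ := by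
      refine (map_add_le_add _ _ _).trans ?_
      have h2 := hb₁ h
      have h3 : C₁ * ‖h‖ ≤ C₁ := mul_le_of_le_one_right hC₁ hh1
      linarith
    have hxN : p₁ (x - delta I₁ c - D₁ h) ≤ C₁ * N ^ 2 := hx.trans (by gcongr)
    have hyN : p₂ (y - delta I₂ d - D₂ k) ≤ C₂ * N ^ 2 := hy.trans (by gcongr)
    have hDh : p₁ (D₁ h) ≤ C₁ * N := (hb₁ h).trans (by gcongr)
    have hDk : p₂ (D₂ k) ≤ C₂ * N := (hb₂ k).trans (by gcongr)
    have hL : (LinearMap.toContinuousLinearMap L) (z - (e c, f d)) =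
        β (D₁ h) (delta I₂ d) + β (delta I₁ c) (D₂ k) := rfl
    have hsplit : β x y - β (delta I₁ c) (delta I₂ d) -
        (β (D₁ h) (delta I₂ d) + β (delta I₁ c) (D₂ k)) =
        β (x - delta I₁ c - D₁ h) y + β (delta I₁ c + D₁ h) (y - delta I₂ d - D₂ k) +
          β (D₁ h) (D₂ k) := by
      simp only [map_sub, map_add, LinearMap.sub_apply, LinearMap.add_apply]
      ring
    rw [hL, hsplit]
    calc ‖β (x - delta I₁ c - D₁ h) y + β (delta I₁ c + D₁ h) (y - delta I₂ d - D₂ k) +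
          β (D₁ h) (D₂ k)‖
        ≤ p₁ (x - delta I₁ c - D₁ h) * p₂ y +
          p₁ (delta I₁ c + D₁ h) * p₂ (y - delta I₂ d - D₂ k) + p₁ (D₁ h) * p₂ (D₂ k) :=
          norm_add₃_le.trans (add_le_add (add_le_add (hβ _ _) (hβ _ _)) (hβ _ _))
      _ ≤ C₁ * N ^ 2 * (A₂ + 2 * C₂) + (A₁ + C₁) * (C₂ * N ^ 2) + C₁ * N * (C₂ * N) := by
          gcongr
      _ = K * N ^ 2 := by simp only [K]; ring
  refine hO.trans_isLittleO ?_
  have h0 : Tendsto (fun z : E₁ × E₂ => ‖z - (e c, f d)‖) (𝓝 (e c, f d)) (𝓝 0) := by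
    have : Continuous fun z : E₁ × E₂ => ‖z - (e c, f d)‖ := by fun_prop
    simpa using this.tendsto (e c, f d)
  exact Asymptotics.IsLittleO.of_norm_right
    ((Asymptotics.isLittleO_pow_id one_lt_two).comp_tendsto h0)

/-- A bilinear form bounded with respect to `‖·‖_{υ₁}` and `‖·‖_{υ₂}` is given by a holomorphic
function on `M₁ × M₂` with the corresponding growth. -/
theorem exists_hol_of_bilinear [T2Space M₁] [T2Space M₂] {υ₁ : Weight M₁} {υ₂ : Weight M₂}
    (β : AFun I₁ M₁ →ₗ[ℂ] AFun I₂ M₂ →ₗ[ℂ] ℂ) {C : ℝ} (hC : 0 ≤ C)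
    (hβ : ∀ a b, ‖β a b‖ ≤ C * weightedSeminorm I₁ υ₁ a * weightedSeminorm I₂ υ₂ b) :
    ∃ F : Hol (I₁.prod I₂) (M₁ × M₂), (∀ z, ‖F z‖ ≤ C * υ₁.prod υ₂ z) ∧
      ∀ a b, AFun.prod a b F = β a b := by
  have hd : MDifferentiable (I₁.prod I₂) 𝓘(ℂ, ℂ)
      fun z : M₁ × M₂ => β (delta I₁ z.1) (delta I₂ z.2) := by
    refine mdifferentiable_bilinear_delta (p₁ := C.toNNReal • weightedSeminorm I₁ υ₁)
      (p₂ := weightedSeminorm I₂ υ₂)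
      ((continuous_weightedSeminorm υ₁).const_smul (C.toNNReal : ℝ))
      (continuous_weightedSeminorm υ₂) β fun a b => (hβ a b).trans (le_of_eq ?_)
    change _ = (C.toNNReal : ℝ) * _ * _
    rw [Real.coe_toNNReal C hC]
  let F : Hol (I₁.prod I₂) (M₁ × M₂) := ⟨⟨_, hd.continuous⟩, hd⟩
  have hF : ∀ z, F z = β (delta I₁ z.1) (delta I₂ z.2) := fun _ => rfl
  refine ⟨F, fun z => ?_, fun a b => ?_⟩
  · rw [hF]
    refine (hβ _ _).trans ?_
    have h1 := weightedSeminorm_delta_le (I := I₁) υ₁ z.1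
    have h2 := weightedSeminorm_delta_le (I := I₂) υ₂ z.2
    calc C * weightedSeminorm I₁ υ₁ (delta I₁ z.1) * weightedSeminorm I₂ υ₂ (delta I₂ z.2)
        ≤ C * υ₁ z.1 * υ₂ z.2 := by gcongr; exact mul_nonneg hC (υ₁.pos _).le
      _ = C * (υ₁ z.1 * υ₂ z.2) := mul_assoc _ _ _
  · have hslice : ∀ x, b (F.slice x) = β (delta I₁ x) b := by
      intro x
      obtain ⟨g, -, hg⟩ := exists_hol_of_le_weightedSeminorm (υ := υ₂) (φ := β (delta I₁ x))
        (mul_nonneg hC (apply_nonneg (weightedSeminorm I₁ υ₁) (delta I₁ x))) (hβ _)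
      rw [hg]
      congr 1
      exact DFunLike.ext _ _ fun y => hg (delta I₂ y)
    obtain ⟨f, -, hf⟩ := exists_hol_of_le_weightedSeminorm (υ := υ₁) (φ := β.flip b)
      (mul_nonneg hC (apply_nonneg (weightedSeminorm I₂ υ₂) b)) fun a => (hβ a b).trans_eq (by ring)
    have : F.partialEval b = f := DFunLike.ext _ _ fun x =>
      (hslice x).trans (hf (delta I₁ x))
    change a (F.partialEval b) = β a b
    rw [this]
    exact (hf a).symm

end Product

/-! ### Tensor products of weighted spaces of analytic functionals -/

section Product

open UniformSpace (Completion)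

variable {E₁ E₂ : Type*} [NormedAddCommGroup E₁] [NormedSpace ℂ E₁] [NormedAddCommGroup E₂]
  [NormedSpace ℂ E₂] {H₁ H₂ : Type*} [TopologicalSpace H₁] [TopologicalSpace H₂]
  {I₁ : ModelWithCorners ℂ E₁ H₁} {I₂ : ModelWithCorners ℂ E₂ H₂}
  {M₁ M₂ : Type*} [TopologicalSpace M₁] [ChartedSpace H₁ M₁] [TopologicalSpace M₂]
  [ChartedSpace H₂ M₂] [I₁.Boundaryless] [IsManifold I₁ 1 M₁] [FiniteDimensional ℂ E₁] [FiniteDimensional ℂ E₂]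

/-- The bilinear map `(a, b) ↦ ρ(a ⊗ b)`. -/
def AFun.prodₗ : AFun I₁ M₁ →ₗ[ℂ] AFun I₂ M₂ →ₗ[ℂ] AFun (I₁.prod I₂) (M₁ × M₂) :=
  LinearMap.mk₂ ℂ AFun.prod (fun _ _ _ => rfl) (fun _ _ _ => rfl)
    (fun a b b' => by
      ext F
      change a (F.partialEval (b + b')) = a (F.partialEval b) + a (F.partialEval b')
      rw [← map_add]
      rfl)
    (fun c a b => by
      ext F
      change a (F.partialEval (c • b)) = c • a (F.partialEval b)
      rw [← map_smul]
      rfl)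

theorem weightedSeminorm_prod_le (υ₁ : Weight M₁) (υ₂ : Weight M₂) (a : AFun I₁ M₁)
    (b : AFun I₂ M₂) : weightedSeminorm (I₁.prod I₂) (υ₁.prod υ₂) (AFun.prod a b) ≤
      weightedSeminorm I₁ υ₁ a * weightedSeminorm I₂ υ₂ b := by
  refine weightedSeminorm_le_iff.2 fun F hF => ?_
  rw [mul_comm]
  refine norm_apply_le_mul_weightedSeminorm a (apply_nonneg _ _) fun x => ?_
  rw [mul_comm]
  exact norm_apply_le_mul_weightedSeminorm b (υ₁.pos x).le fun y => hF (x, y)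

variable [I₂.Boundaryless] [IsManifold I₂ 1 M₂] [T2Space M₁] [T2Space M₂]

theorem dense_span_toGaugeCompletion_delta {E : Type*} [NormedAddCommGroup E] [NormedSpace ℂ E]
    {H : Type*} [TopologicalSpace H] {I : ModelWithCorners ℂ E H} {M : Type*} [TopologicalSpace M]
    [ChartedSpace H M] [I.Boundaryless] [IsManifold I 1 M] [FiniteDimensional ℂ E] [T2Space M]
    {ι : Type} [Nonempty ι] (υ : ι → Weight M) :
    Dense (Submodule.span ℂ (range fun x =>
      toGaugeCompletion (fun i => weightedDeltas I (υ i)) (delta I x)) : Set (GaugeCompletion fun i => weightedDeltas I (υ i))) := by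
  set S : ι → Set (AFun I M) := fun i => weightedDeltas I (υ i)
  have hof : Continuous (GaugeSpace.of S : AFun I M → GaugeSpace S) := by
    rw [continuous_iff_continuousAt]
    intro a
    refine ((withSeminorms_weightedFamily υ).tendsto_nhds _ _).2 fun i ε hε => ?_
    have hc : Continuous fun b => weightedSeminorm I (υ i) (b - a) :=
      (continuous_weightedSeminorm (υ i)).comp (continuous_id.sub continuous_const)
    have := hc.tendsto a
    rw [sub_self, map_zero] at this
    exact this.eventually_lt_const hε
  let J : AFun I M →ₗ[ℂ] GaugeCompletion S :=
    ⟨⟨toGaugeCompletion S, fun a b => Completion.coe_add (GaugeSpace.of S a) (GaugeSpace.of S b)⟩,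
      fun c a => Completion.coe_smul c (GaugeSpace.of S a)⟩
  have hJ : Continuous J := (Completion.continuous_coe _).comp hof
  have hJd : DenseRange J := Completion.denseRange_coe (α := GaugeSpace S)
  have h := hJd.dense_image hJ (dense_span_delta (I := I) (M := M))
  rw [← Submodule.map_coe, Submodule.map_span, ← range_comp] at h
  exact h

/-- The isomorphism `𝒜_{υ₁}(M₁) ⊗̂ 𝒜_{υ₂}(M₂) ≅ 𝒜_{υ₁υ₂}(M₁ × M₂)` for increasing families of
weights. -/
theorem exists_gaugeCompletion_tensor_equiv {ι : Type} [Preorder ι] [IsDirectedOrder ι] [Nonempty ι]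
    (υ₁ : ι → Weight M₁) (υ₂ : ι → Weight M₂) (h₁ : ∀ i j, i ≤ j → ∀ x, υ₁ i x ≤ υ₁ j x)
    (h₂ : ∀ i j, i ≤ j → ∀ x, υ₂ i x ≤ υ₂ j x) :
    ∃ Φ : CompletedTensor (GaugeCompletion fun i => weightedDeltas I₁ (υ₁ i))
        (GaugeCompletion fun i => weightedDeltas I₂ (υ₂ i)) ≃L[ℂ]
        GaugeCompletion fun i => weightedDeltas (I₁.prod I₂) ((υ₁ i).prod (υ₂ i)),
      ∀ (a : AFun I₁ M₁) (b : AFun I₂ M₂), Φ (ctmul (toGaugeCompletion _ a) (toGaugeCompletion _ b)) =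
        toGaugeCompletion _ (AFun.prod a b) := by
  set S₁ : ι → Set (AFun I₁ M₁) := fun i => weightedDeltas I₁ (υ₁ i)
  set S₂ : ι → Set (AFun I₂ M₂) := fun i => weightedDeltas I₂ (υ₂ i)
  set υ : ι → Weight (M₁ × M₂) := fun i => (υ₁ i).prod (υ₂ i)
  set S : ι → Set (AFun (I₁.prod I₂) (M₁ × M₂)) := fun i => weightedDeltas (I₁.prod I₂) (υ i)
  have hp₁ := withSeminorms_weightedFamily (I := I₁) υ₁
  have hp₂ := withSeminorms_weightedFamily (I := I₂) υ₂
  have hp := withSeminorms_weightedFamily (I := I₁.prod I₂) υ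
  have hm₁ : Monotone (weightedFamily I₁ υ₁) := fun i j hij => weightedSeminorm_mono (h₁ i j hij)
  have hm₂ : Monotone (weightedFamily I₂ υ₂) := fun i j hij => weightedSeminorm_mono (h₂ i j hij)
  have hP := withSeminorms_completionSeminorm hp
  have : ContinuousSMul ℂ (GaugeCompletion S) := hP.continuousSMul
  have : LocallyConvexSpace ℝ (GaugeCompletion S) := hP.toLocallyConvexSpace
  let J : GaugeSpace S →ₗ[ℂ] GaugeCompletion S :=
    ⟨⟨fun a => (a : GaugeCompletion S), Completion.coe_add⟩, Completion.coe_smul⟩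
  let J₁ : GaugeSpace S₁ →ₗ[ℂ] GaugeCompletion S₁ :=
    ⟨⟨fun a => (a : GaugeCompletion S₁), Completion.coe_add⟩, Completion.coe_smul⟩
  let J₂ : GaugeSpace S₂ →ₗ[ℂ] GaugeCompletion S₂ :=
    ⟨⟨fun a => (a : GaugeCompletion S₂), Completion.coe_add⟩, Completion.coe_smul⟩
  let ρ : GaugeSpace S₁ →ₗ[ℂ] GaugeSpace S₂ →ₗ[ℂ] GaugeSpace S := AFun.prodₗ (I₁ := I₁) (I₂ := I₂)
  have hρ : Continuous fun z : GaugeSpace S₁ × GaugeSpace S₂ => ρ z.1 z.2 :=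
    continuous_bilinear_of_le hp ρ fun i => ⟨_, _, hp₁.continuous_seminorm i,
      hp₂.continuous_seminorm i, weightedSeminorm_prod_le (υ₁ i) (υ₂ i)⟩
  obtain ⟨B, hB, hBρ⟩ := exists_bilinear_extension (ρ.compr₂ J)
    ((Completion.continuous_coe _).comp hρ)
  replace hBρ : ∀ (a : GaugeSpace S₁) (b : GaugeSpace S₂),
      B (a : GaugeCompletion S₁) (b : GaugeCompletion S₂) = (ρ a b : GaugeCompletion S) := hBρ
  have hdense : Dense (Submodule.span ℂ (range fun z : GaugeCompletion S₁ × GaugeCompletion S₂ =>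
      B z.1 z.2) : Set (GaugeCompletion S)) := by
    refine (dense_span_toGaugeCompletion_delta (I := I₁.prod I₂) υ).mono
      (Submodule.span_mono ?_)
    rintro _ ⟨⟨x, y⟩, rfl⟩
    exact ⟨(toGaugeCompletion S₁ (delta I₁ x), toGaugeCompletion S₂ (delta I₂ y)),
      hBρ (GaugeSpace.of S₁ (delta I₁ x)) (GaugeSpace.of S₂ (delta I₂ y))⟩
  obtain ⟨Φ, hΦ⟩ := exists_completedTensor_equiv B hB hdense fun r hr => by
    obtain ⟨i, C, hC, hle⟩ := exists_bound_bilinear hp₁ hm₁ hp₂ hm₂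
      ((ProjTensor.mk (GaugeCompletion S₁) (GaugeCompletion S₂)).compl₁₂ J₁ J₂)
      (continuous_tmul.comp ((Completion.continuous_coe _).prodMap (Completion.continuous_coe _))) hr
    set P := completionSeminorm (weightedFamily (I₁.prod I₂) υ i) (hp.continuous_seminorm i)
    have hPc : Continuous P := continuous_completionSeminorm _ _
    refine ⟨{z | C * P z < 1}, (isOpen_lt (continuous_const.mul hPc) continuous_const).mem_nhds
      (by simp), fun φ hφ => ?_⟩
    have hφc : Continuous φ := continuous_of_norm_le_seminorm hr hφ
    obtain ⟨F, hFle, hF⟩ := exists_hol_of_bilinear (I₁ := I₁) (I₂ := I₂) (υ₁ := υ₁ i) (υ₂ := υ₂ i)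
      (((ProjTensor.mk (GaugeCompletion S₁) (GaugeCompletion S₂)).compl₁₂ J₁ J₂).compr₂ φ) hC.le
      fun a b => (hφ _).trans (hle a b)
    let ev : GaugeSpace S →ₗ[ℂ] ℂ :=
      (⟨⟨fun a => a F, fun _ _ => rfl⟩, fun _ _ => rfl⟩ : AFun (I₁.prod I₂) (M₁ × M₂) →ₗ[ℂ] ℂ)
    obtain ⟨ψ, hψ, hψle⟩ := exists_functional_extension (weightedFamily (I₁.prod I₂) υ i)
      (hp.continuous_seminorm i) (φ := ev) (C := C)
      fun a => norm_apply_le_mul_weightedSeminorm (υ := υ i) a hC.le hFle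
    refine ⟨ψ.toLinearMap, fun x y => ?_, fun z hz => (hψle z).trans (le_of_lt hz)⟩
    change ψ (B x y) = φ (ProjTensor.tmul x y)
    induction x, y using Completion.induction_on₂ with
    | hp => exact isClosed_eq (ψ.continuous.comp hB) (hφc.comp continuous_tmul)
    | ih a b =>
      rw [hBρ, hψ]
      exact hF a b
  exact ⟨Φ, fun a b => (hΦ _ _).trans (hBρ _ _)⟩

theorem exists_aWeighted_tensor_equiv (υ₁ : Weight M₁) (υ₂ : Weight M₂) :
    ∃ Φ : CompletedTensor (AWeighted I₁ υ₁) (AWeighted I₂ υ₂) ≃L[ℂ]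
        AWeighted (I₁.prod I₂) (υ₁.prod υ₂),
      ∀ (a : AFun I₁ M₁) (b : AFun I₂ M₂),
        Φ (ctmul (a.toWeighted υ₁) (b.toWeighted υ₂)) =
          (AFun.prod a b).toWeighted (υ₁.prod υ₂) :=
  exists_gaugeCompletion_tensor_equiv (fun _ : Unit => υ₁) (fun _ => υ₂)
    (fun _ _ _ _ => le_rfl) fun _ _ _ _ => le_rfl

theorem Weight.prod_npow {M₁ M₂ : Type*} [TopologicalSpace M₁] [TopologicalSpace M₂]
    (υ₁ : Weight M₁) (υ₂ : Weight M₂) (n : ℕ) :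
    (υ₁.prod υ₂).npow n = (υ₁.npow n).prod (υ₂.npow n) := by
  have : ((υ₁.prod υ₂).npow n).toFun = ((υ₁.npow n).prod (υ₂.npow n)).toFun :=
    funext fun z => mul_pow _ _ _
  cases h : (υ₁.prod υ₂).npow n
  cases h' : (υ₁.npow n).prod (υ₂.npow n)
  rw [h, h'] at this
  cases this
  rfl

theorem exists_aWeightedInf_tensor_equiv (υ₁ : Weight M₁) (υ₂ : Weight M₂) :
    ∃ Φ : CompletedTensor (AWeightedInf I₁ υ₁) (AWeightedInf I₂ υ₂) ≃L[ℂ]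
        AWeightedInf (I₁.prod I₂) (υ₁.prod υ₂),
      ∀ (a : AFun I₁ M₁) (b : AFun I₂ M₂),
        Φ (ctmul (a.toWeightedInf υ₁) (b.toWeightedInf υ₂)) =
          (AFun.prod a b).toWeightedInf (υ₁.prod υ₂) := by
  have h := exists_gaugeCompletion_tensor_equiv (I₁ := I₁) (I₂ := I₂) υ₁.npow υ₂.npow
    (fun _ _ hij x => pow_le_pow_right₀ (υ₁.one_le x) hij)
    fun _ _ hij x => pow_le_pow_right₀ (υ₂.one_le x) hij
  have hS : (fun n => weightedDeltas (I₁.prod I₂) ((υ₁.npow n).prod (υ₂.npow n))) =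
      fun n => weightedDeltas (I₁.prod I₂) ((υ₁.prod υ₂).npow n) := by
    simp only [Weight.prod_npow]
  rw [hS] at h
  exact h

end Product

/-! ### The inductive limit topology -/

section HolInf

variable {E : Type*} [NormedAddCommGroup E] [NormedSpace ℂ E]
  {H : Type*} [TopologicalSpace H] {I : ModelWithCorners ℂ E H}
  {M : Type*} [TopologicalSpace M] [ChartedSpace H M] {υ : Weight M}

theorem mem_weightedSubmodule_npow_iff {f : Hol I M} {n : ℕ} :
    f ∈ weightedSubmodule I (υ.npow n) ↔ ∃ B, 0 ≤ B ∧ ∀ x, ‖f x‖ ≤ B * υ x ^ n := by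
  have hi : ∀ (B : ℝ) x, (υ x ^ n)⁻¹ * ‖f x‖ ≤ B ↔ ‖f x‖ ≤ B * υ x ^ n := fun B x => by
    rw [inv_mul_le_iff₀ (pow_pos (υ.pos x) n), mul_comm]
  constructor
  · rintro ⟨B, hB⟩
    refine ⟨max B 0, le_max_right _ _, fun x => (hi _ x).1 (le_max_of_le_left (hB ⟨x, rfl⟩))⟩
  · rintro ⟨B, -, hB⟩
    refine ⟨B, ?_⟩
    rintro _ ⟨x, rfl⟩
    exact (hi B x).2 (hB x)

namespace HolInf

@[simp] theorem zero_apply (x : M) : (0 : HolInf I υ) x = 0 := rfl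

@[simp] theorem add_apply (f g : HolInf I υ) (x : M) : (f + g) x = f x + g x := rfl

@[simp] theorem smul_apply (c : ℂ) (f : HolInf I υ) (x : M) : (c • f) x = c * f x := rfl

@[simp] theorem sub_apply (f g : HolInf I υ) (x : M) : (f - g) x = f x - g x := by
  have h := add_apply (f - g) g x
  rw [sub_add_cancel] at h
  rw [h, add_sub_cancel_right]

theorem sum_apply {κ : Type*} (s : Finset κ) (f : κ → HolInf I υ) (x : M) :
    (∑ k ∈ s, f k) x = ∑ k ∈ s, f k x :=
  map_sum (⟨⟨fun f => f x, rfl⟩, fun _ _ => rfl⟩ : HolInf I υ →+ ℂ) f s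

theorem exists_bound (f : HolInf I υ) : ∃ (n : ℕ) (B : ℝ), 0 ≤ B ∧ ∀ x, ‖f x‖ ≤ B * υ x ^ n := by
  obtain ⟨n, hn⟩ := f.2
  exact ⟨n, mem_weightedSubmodule_npow_iff.1 hn⟩

/-- A function with `|f| ≤ B υⁿ` as an element of `𝒪_{υ^∞}(M)`. -/
def ofBound (f : Hol I M) (n : ℕ) (B : ℝ) (hB : 0 ≤ B) (h : ∀ x, ‖f x‖ ≤ B * υ x ^ n) :
    HolInf I υ :=
  ⟨f, n, mem_weightedSubmodule_npow_iff.2 ⟨B, hB, h⟩⟩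

end HolInf

theorem Weight.mul_pow_le_mul_pow (υ : Weight M) {m n : ℕ} (hmn : m ≤ n) {B : ℝ} (hB : 0 ≤ B)
    (x : M) : B * υ x ^ m ≤ B * υ x ^ n :=
  mul_le_mul_of_nonneg_left (pow_le_pow_right₀ (υ.one_le x) hmn) hB

namespace HolInf

instance : IsTopologicalAddGroup (HolInf I υ) := topologicalAddGroup_sInf fun _ ht => ht.1

instance : ContinuousSMul ℂ (HolInf I υ) := continuousSMul_sInf fun _ ht => ht.2.1

instance : LocallyConvexSpace ℝ (HolInf I υ) := LocallyConvexSpace.sInf fun _ ht => ht.2.2.1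

/-- The unit ball of `𝒪_{υⁿ}(M)` is absorbed by the neighbourhoods of `0`. -/
theorem exists_forall_mem_of_mem_nhds {U : Set (HolInf I υ)} (hU : U ∈ 𝓝 0) (n : ℕ) :
    ∃ δ > 0, ∀ f : HolInf I υ, (∀ x, ‖f x‖ ≤ δ * υ x ^ n) → f ∈ U := by
  let _ := (weightedNorm I (υ.npow n)).toNormedAddCommGroup
  have hc : @Continuous _ _ (weightedTopology I (υ.npow n)) _ (HolInf.incl I υ n) :=
    continuous_sInf_rng.2 fun t ht => ht.2.2.2 n
  have h : HolInf.incl I υ n ⁻¹' U ∈ @nhds _ (weightedTopology I (υ.npow n)) 0 :=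
    @Continuous.tendsto _ _ (weightedTopology I (υ.npow n)) _ _ hc 0 _ hU
  obtain ⟨ε, hε, hsub⟩ := Metric.mem_nhds_iff.1 h
  refine ⟨ε / 2, half_pos hε, fun f hf => ?_⟩
  have hf' : ∀ x, (υ x ^ n)⁻¹ * ‖f x‖ ≤ ε / 2 := fun x => by
    rw [inv_mul_le_iff₀ (pow_pos (υ.pos x) n), mul_comm]
    exact hf x
  let g : weightedSubmodule I (υ.npow n) := ⟨f.1, ε / 2, by rintro _ ⟨x, rfl⟩; exact hf' x⟩
  have hg : ‖g‖ ≤ ε / 2 := Real.iSup_le hf' (half_pos hε).le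
  exact hsub (show g ∈ ball 0 ε from mem_ball_zero_iff.2 (hg.trans_lt (half_lt_self hε)))

theorem exists_seminorm_bound {r : Seminorm ℂ (HolInf I υ)} (hr : Continuous r) (n : ℕ) :
    ∃ C, 0 ≤ C ∧ ∀ (f : HolInf I υ) (B : ℝ), 0 ≤ B → (∀ x, ‖f x‖ ≤ B * υ x ^ n) → r f ≤ C * B := by
  obtain ⟨δ, hδ, h⟩ := exists_forall_mem_of_mem_nhds (U := {f | r f < 1})
    ((isOpen_lt hr continuous_const).mem_nhds (by simp)) n
  refine ⟨δ⁻¹, inv_nonneg.2 hδ.le, fun f B hB hf => ?_⟩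
  have key : ∀ t, B < t → r f ≤ δ⁻¹ * t := fun t ht => by
    have ht0 : 0 < t := hB.trans_lt ht
    have hn : ‖((δ / t : ℝ) : ℂ)‖ = δ / t := by
      rw [Complex.norm_real, Real.norm_of_nonneg (by positivity)]
    have h1 := h (((δ / t : ℝ) : ℂ) • f) fun x => by
      have hυ := pow_pos (υ.pos x) n
      rw [smul_apply, norm_mul, hn]
      calc δ / t * ‖f x‖ ≤ δ / t * (t * υ x ^ n) := by
            gcongr
            exact (hf x).trans (by gcongr)
        _ = δ * υ x ^ n := by field_simp
    have h2 : r (((δ / t : ℝ) : ℂ) • f) < 1 := h1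
    rw [map_smul_eq_mul, hn, div_mul_eq_mul_div, div_lt_one ht0] at h2
    rw [le_inv_mul_iff₀ hδ]
    exact h2.le
  refine le_of_forall_gt_imp_ge_of_dense fun a ha => ?_
  have := key (δ * a) (by rwa [inv_mul_lt_iff₀ hδ] at ha)
  rwa [inv_mul_cancel_left₀ hδ.ne'] at this

/-- A seminorm on the inductive limit is continuous if it is bounded on the unit balls of all the
spaces `𝒪_{υⁿ}(M)`. -/
theorem continuous_seminorm {r : Seminorm ℂ (HolInf I υ)}
    (h : ∀ n : ℕ, ∃ C, ∀ (f : HolInf I υ) (B : ℝ), 0 ≤ B → (∀ x, ‖f x‖ ≤ B * υ x ^ n) →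
      r f ≤ C * B) : Continuous r := by
  let t : TopologicalSpace (HolInf I υ) :=
    inferInstanceAs (TopologicalSpace (SeminormSpace r))
  have hrt : @Continuous _ _ t _ r := continuous_norm (E := SeminormSpace r)
  refine continuous_sInf_dom (t := t) ⟨inferInstanceAs (IsTopologicalAddGroup (SeminormSpace r)),
    inferInstanceAs (ContinuousSMul ℂ (SeminormSpace r)),
    inferInstanceAs (LocallyConvexSpace ℝ (SeminormSpace r)), fun n => ?_⟩ hrt
  obtain ⟨C, hC⟩ := h n
  let _ := (weightedNorm I (υ.npow n)).toNormedAddCommGroup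
  let T : weightedSubmodule I (υ.npow n) →+ SeminormSpace r :=
    ⟨⟨HolInf.incl I υ n, rfl⟩, fun _ _ => rfl⟩
  refine AddMonoidHomClass.continuous_of_bound T C fun f => ?_
  refine hC (HolInf.incl I υ n f) ‖f‖ (norm_nonneg f) fun x => ?_
  have h1 : (υ x ^ n)⁻¹ * ‖f.1 x‖ ≤ ‖f‖ := le_ciSup f.2 x
  rwa [inv_mul_le_iff₀ (pow_pos (υ.pos x) n), mul_comm] at h1

/-- An absolutely convex set absorbing the unit balls of all the spaces `𝒪_{υⁿ}(M)` is a
neighbourhood of `0`. -/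
theorem exists_seminorm_of_absConvex {V : Set (HolInf I υ)} (hV : AbsConvex ℂ V)
    (hδ : ∀ n : ℕ, ∃ δ > 0, ∀ f : HolInf I υ, (∀ x, ‖f x‖ ≤ δ * υ x ^ n) → f ∈ V) :
    ∃ r : Seminorm ℂ (HolInf I υ), Continuous r ∧ ∀ f, r f < 1 → f ∈ V := by
  have hcv : Convex ℝ V := convex_RCLike_iff_convex_real.1 hV.2
  have hsc : ∀ (n : ℕ) (δ : ℝ), 0 < δ → (∀ f : HolInf I υ, (∀ x, ‖f x‖ ≤ δ * υ x ^ n) → f ∈ V) →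
      ∀ (f : HolInf I υ) (B c : ℝ), (∀ x, ‖f x‖ ≤ B * υ x ^ n) → |c| * B ≤ δ → c • f ∈ V := by
    intro n δ hδ h f B c hf hc
    refine h _ fun x => ?_
    change ‖(c : ℂ) * f x‖ ≤ _
    rw [norm_mul, Complex.norm_real, Real.norm_eq_abs]
    calc |c| * ‖f x‖ ≤ |c| * (B * υ x ^ n) := by gcongr; exact hf x
      _ = |c| * B * υ x ^ n := by ring
      _ ≤ δ * υ x ^ n := by gcongr; exact (pow_pos (υ.pos x) n).le
  have habs : Absorbent ℝ V := by
    rw [absorbent_iff_inv_smul]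
    intro f
    obtain ⟨n, B, hB, hf⟩ := exists_bound f
    obtain ⟨δ, hδ0, h⟩ := hδ n
    filter_upwards [tendsto_norm_cobounded_atTop.eventually_ge_atTop (B / δ),
      tendsto_norm_cobounded_atTop.eventually_gt_atTop (0 : ℝ)] with c hc hc0
    refine hsc n δ hδ0 h f B _ hf ?_
    rw [Real.norm_eq_abs] at hc hc0
    rw [abs_inv, inv_mul_le_iff₀ hc0]
    rwa [div_le_iff₀ hδ0] at hc
  refine ⟨gaugeSeminorm hV.1 hcv habs, continuous_seminorm fun n => ?_,
    fun f hf => setOfPred_gauge_lt_one_subset_self hcv habs.zero_mem habs hf⟩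
  obtain ⟨δ, hδ0, h⟩ := hδ n
  refine ⟨δ⁻¹, fun f B hB hf => ?_⟩
  refine le_of_forall_gt_imp_ge_of_dense fun a ha => ?_
  have ha0 : 0 < a := (mul_nonneg (inv_nonneg.2 hδ0.le) hB).trans_lt ha
  refine gauge_le_of_mem ha0.le ?_
  rw [mem_smul_set_iff_inv_smul_mem₀ ha0.ne']
  refine hsc n δ hδ0 h f B _ hf ?_
  rw [abs_of_pos (inv_pos.2 ha0), inv_mul_le_iff₀ ha0]
  rw [inv_mul_lt_iff₀ hδ0] at ha
  linarith

theorem tendsto_of_bound {α : Type*} {l : Filter α} {g : α → HolInf I υ} {f : HolInf I υ} (m : ℕ)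
    (h : ∀ ε > 0, ∀ᶠ i in l, ∀ x, ‖g i x - f x‖ ≤ ε * υ x ^ m) : Tendsto g l (𝓝 f) := by
  rw [← tendsto_sub_nhds_zero_iff]
  intro U hU
  obtain ⟨δ, hδ, hs⟩ := exists_forall_mem_of_mem_nhds hU m
  refine mem_map.2 ?_
  filter_upwards [h δ hδ] with i hi
  exact hs _ fun x => by simpa using hi x

theorem continuous_apply (x : M) : Continuous fun f : HolInf I υ => f x := by
  let ev : HolInf I υ →ₗ[ℂ] ℂ := ⟨⟨fun f => f x, fun _ _ => rfl⟩, fun _ _ => rfl⟩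
  refine continuous_of_norm_le_seminorm (q := (normSeminorm ℂ ℂ).comp ev)
    (continuous_seminorm fun n => ⟨υ x ^ n, fun f B _ hf => ?_⟩) (φ := ev) fun _ => le_rfl
  rw [mul_comm]
  exact hf x

instance : T2Space (HolInf I υ) :=
  .of_injective_continuous (f := fun (f : HolInf I υ) (x : M) => f x) DFunLike.coe_injective
    (continuous_pi continuous_apply)

end HolInf

end HolInf

/-! ### Nuclear expansions of holomorphic functions -/

section Expansion

variable {E : Type*} [NormedAddCommGroup E] [NormedSpace ℂ E]
  {H : Type*} [TopologicalSpace H] {I : ModelWithCorners ℂ E H}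
  {M : Type*} [TopologicalSpace M] [ChartedSpace H M] {υ : Weight M}

variable (I) in
/-- A nuclear representation `g = ∑ aₖ(g) Fₖ` of the inclusion of `𝒪_{υⁿ}(M)` into `𝒪_{υᵐ}(M)`: the
`Fₖ` lie in the unit ball of `𝒪_{υᵐ}(M)`, and the `aₖ` are analytic functionals for which
`∑ ‖aₖ‖_{υⁿ}` converges. -/
structure Expansion (υ : Weight M) (n m : ℕ) (κ : Type) where
  /-- The coefficient functionals `aₖ`. -/
  coeff : κ → AFun I M
  /-- The functions `Fₖ`. -/
  fn : κ → Hol I M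
  norm_fn_le : ∀ k x, ‖fn k x‖ ≤ υ x ^ m
  summable : Summable fun k => weightedSeminorm I (υ.npow n) (coeff k)
  hasSum : ∀ (g : Hol I M) (B : ℝ), 0 ≤ B → (∀ x, ‖g x‖ ≤ B * υ x ^ n) →
    ∀ x, HasSum (fun k => coeff k g * fn k x) (g x)

variable (I) in
/-- Each inclusion `𝒪_{υⁿ}(M) → 𝒪_{υᵐ}(M)`, with `m` large enough, has a nuclear representation. -/
def HasExpansions (υ : Weight M) : Prop :=
  ∀ n : ℕ, ∃ (m : ℕ) (κ : Type), Nonempty (Expansion I υ n m κ)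

namespace Expansion

variable {n m : ℕ} {κ : Type} (e : Expansion I υ n m κ)

theorem norm_coeff_le (k : κ) {g : Hol I M} {B : ℝ} (hB : 0 ≤ B)
    (hg : ∀ x, ‖g x‖ ≤ B * υ x ^ n) :
    ‖e.coeff k g‖ ≤ B * weightedSeminorm I (υ.npow n) (e.coeff k) :=
  norm_apply_le_mul_weightedSeminorm (υ := υ.npow n) (e.coeff k) hB hg

theorem summable_norm_coeff {g : Hol I M} {B : ℝ} (hB : 0 ≤ B) (hg : ∀ x, ‖g x‖ ≤ B * υ x ^ n) :
    Summable fun k => ‖e.coeff k g‖ :=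
  .of_nonneg_of_le (fun _ => norm_nonneg _) (fun k => e.norm_coeff_le k hB hg)
    (e.summable.mul_left B)

theorem norm_le_tsum {g : Hol I M} {B : ℝ} (hB : 0 ≤ B) (hg : ∀ x, ‖g x‖ ≤ B * υ x ^ n) (x : M) :
    ‖g x‖ ≤ (∑' k, ‖e.coeff k g‖) * υ x ^ m := by
  rw [← (e.hasSum g B hB hg x).tsum_eq]
  refine tsum_of_norm_bounded ((e.summable_norm_coeff hB hg).hasSum.mul_right _) fun k => ?_
  rw [norm_mul]
  exact mul_le_mul_of_nonneg_left (e.norm_fn_le k x) (norm_nonneg _)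

/-- The partial sums of the expansion of `g` converge to `g` in the norm of `𝒪_{υᵐ}(M)`. -/
theorem eventually_norm_sub_sum_le {g : Hol I M} {B : ℝ} (hB : 0 ≤ B)
    (hg : ∀ x, ‖g x‖ ≤ B * υ x ^ n) {ε : ℝ} (hε : 0 < ε) : ∀ᶠ s : Finset κ in atTop, ∀ x,
      ‖g x - ∑ k ∈ s, e.coeff k g * e.fn k x‖ ≤ ε * υ x ^ m := by
  filter_upwards [(tendsto_tsum_compl_atTop_zero fun k => ‖e.coeff k g‖).eventually_lt_const hε]
    with s hs x
  have h := e.hasSum g B hB hg x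
  have hsub : Summable fun k : {k // k ∉ s} => ‖e.coeff k g‖ :=
    (e.summable_norm_coeff hB hg).subtype _
  rw [← h.tsum_eq, ← h.summable.sum_add_tsum_subtype_compl s, add_sub_cancel_left]
  have hυ : 0 ≤ υ x ^ m := (pow_pos (υ.pos x) m).le
  refine (tsum_of_norm_bounded (hsub.hasSum.mul_right (υ x ^ m)) fun k => ?_).trans
    (mul_le_mul_of_nonneg_right hs.le hυ)
  rw [norm_mul]
  exact mul_le_mul_of_nonneg_left (e.norm_fn_le k x) (norm_nonneg _)

/-- The functions `Fₖ` as elements of `𝒪_{υ^∞}(M)`. -/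
def fnInf (k : κ) : HolInf I υ :=
  HolInf.ofBound (e.fn k) m 1 zero_le_one fun x => (e.norm_fn_le k x).trans_eq (one_mul _).symm

theorem norm_fnInf_le (k : κ) (x : M) : ‖e.fnInf k x‖ ≤ 1 * υ x ^ m :=
  (e.norm_fn_le k x).trans_eq (one_mul _).symm

theorem eventually_norm_sum_fnInf_sub_le {g : HolInf I υ} {B : ℝ} (hB : 0 ≤ B)
    (hg : ∀ x, ‖g x‖ ≤ B * υ x ^ n) {ε : ℝ} (hε : 0 < ε) : ∀ᶠ s : Finset κ in atTop, ∀ x,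
      ‖(∑ k ∈ s, e.coeff k g.1 • e.fnInf k) x - g x‖ ≤ ε * υ x ^ m := by
  filter_upwards [e.eventually_norm_sub_sum_le hB hg hε] with s hs x
  rw [norm_sub_rev, HolInf.sum_apply]
  exact hs x

/-- A functional which is bounded on the unit ball of `𝒪_{υᵐ}(M)` may be applied to the expansion
term by term. -/
theorem hasSum_apply {g : HolInf I υ} {B : ℝ} (hB : 0 ≤ B) (hg : ∀ x, ‖g x‖ ≤ B * υ x ^ n)
    (θ : HolInf I υ →ₗ[ℂ] ℂ) {C : ℝ} (hC : 0 ≤ C)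
    (hθ : ∀ (f : HolInf I υ) (t : ℝ), 0 ≤ t → (∀ x, ‖f x‖ ≤ t * υ x ^ m) → ‖θ f‖ ≤ C * t) :
    HasSum (fun k => e.coeff k g.1 * θ (e.fnInf k)) (θ g) := by
  refine Metric.tendsto_nhds.2 fun ε hε => ?_
  filter_upwards [e.eventually_norm_sum_fnInf_sub_le hB hg (ε := ε / (C + 1)) (by positivity)]
    with s hs
  have h1 : ∑ k ∈ s, e.coeff k g.1 * θ (e.fnInf k) - θ g =
      θ (∑ k ∈ s, e.coeff k g.1 • e.fnInf k - g) := by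
    rw [map_sub, map_sum]
    simp only [map_smul, smul_eq_mul]
  rw [dist_eq_norm, h1]
  refine (hθ _ (ε / (C + 1)) (by positivity) fun x => ?_).trans_lt ?_
  · rw [HolInf.sub_apply]
    exact hs x
  · rw [← mul_div_assoc, div_lt_iff₀ (by positivity)]
    nlinarith

/-- Bounded weights `w` define a functional `g ↦ ∑ aₖ(g) wₖ` on `𝒪_{υⁿ}(M)`, which is then extended
arbitrarily to `𝒪_{υ^∞}(M)`. -/
theorem exists_functional (w : κ → ℂ) {C : ℝ} (hw : ∀ k, ‖w k‖ ≤ C) :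
    ∃ Λ : HolInf I υ →ₗ[ℂ] ℂ, ∀ (g : HolInf I υ) (B : ℝ), 0 ≤ B → (∀ x, ‖g x‖ ≤ B * υ x ^ n) →
      HasSum (fun k => e.coeff k g.1 * w k) (Λ g) ∧
        ‖Λ g‖ ≤ C * (∑' k, weightedSeminorm I (υ.npow n) (e.coeff k)) * B := by
  have hmain : ∀ (g : Hol I M) (B : ℝ), 0 ≤ B → (∀ x, ‖g x‖ ≤ B * υ x ^ n) →
      (Summable fun k => e.coeff k g * w k) ∧ ‖∑' k, e.coeff k g * w k‖ ≤
        C * (∑' k, weightedSeminorm I (υ.npow n) (e.coeff k)) * B := fun g B hB hg => by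
    have hle : ∀ k, ‖e.coeff k g * w k‖ ≤
        B * weightedSeminorm I (υ.npow n) (e.coeff k) * C := fun k => by
      rw [norm_mul]
      exact mul_le_mul (e.norm_coeff_le k hB hg) (hw k) (norm_nonneg _)
        (mul_nonneg hB (apply_nonneg _ _))
    have hs := (e.summable.hasSum.mul_left B).mul_right C
    exact ⟨.of_norm_bounded hs.summable hle, (tsum_of_norm_bounded hs hle).trans_eq (by ring)⟩
  have hsum : ∀ g : weightedSubmodule I (υ.npow n), Summable fun k => e.coeff k g.1 * w k :=
    fun g => by
      obtain ⟨B, hB, hg⟩ := mem_weightedSubmodule_npow_iff.1 g.2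
      exact (hmain g.1 B hB hg).1
  let Λ₀ : weightedSubmodule I (υ.npow n) →ₗ[ℂ] ℂ :=
    { toFun := fun g => ∑' k, e.coeff k g.1 * w k
      map_add' := fun f g => by
        rw [← (hsum f).tsum_add (hsum g)]
        refine tsum_congr fun k => ?_
        rw [← add_mul]
        exact congrArg (· * w k) (map_add (e.coeff k) f.1 g.1)
      map_smul' := fun c f => by
        rw [RingHom.id_apply, smul_eq_mul, ← tsum_mul_left]
        refine tsum_congr fun k => ?_
        rw [← mul_assoc]
        exact congrArg (· * w k) (map_smul (e.coeff k) c f.1) }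
  obtain ⟨Λ, hΛ⟩ := Λ₀.exists_extend
  refine ⟨Λ ∘ₗ (weightedInfSubmodule I υ).subtype, fun g B hB hg => ?_⟩
  have hgm : g.1 ∈ weightedSubmodule I (υ.npow n) :=
    mem_weightedSubmodule_npow_iff.2 ⟨B, hB, hg⟩
  have h1 : Λ g.1 = ∑' k, e.coeff k g.1 * w k := LinearMap.congr_fun hΛ ⟨g.1, hgm⟩
  have h2 := hmain g.1 B hB hg
  change HasSum _ (Λ g.1) ∧ ‖Λ g.1‖ ≤ _
  rw [h1]
  exact ⟨h2.1.hasSum, h2.2⟩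

end Expansion

end Expansion

section Product

variable {E₁ E₂ : Type*} [NormedAddCommGroup E₁] [NormedSpace ℂ E₁] [NormedAddCommGroup E₂]
  [NormedSpace ℂ E₂] {H₁ H₂ : Type*} [TopologicalSpace H₁] [TopologicalSpace H₂]
  {I₁ : ModelWithCorners ℂ E₁ H₁} {I₂ : ModelWithCorners ℂ E₂ H₂}
  {M₁ M₂ : Type*} [TopologicalSpace M₁] [ChartedSpace H₁ M₁] [TopologicalSpace M₂]
  [ChartedSpace H₂ M₂]

/-- The function `(x, y) ↦ f(x) g(y)`. -/
def Hol.tensor (f : Hol I₁ M₁) (g : Hol I₂ M₂) : Hol (I₁.prod I₂) (M₁ × M₂) :=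
  ⟨⟨fun z => f z.1 * g z.2, (f.1.continuous.comp continuous_fst).mul
      (g.1.continuous.comp continuous_snd)⟩, fun z =>
    (f.mdifferentiable.comp mdifferentiable_fst z).mul
      (g.mdifferentiable.comp mdifferentiable_snd z)⟩

@[simp] theorem Hol.tensor_apply (f : Hol I₁ M₁) (g : Hol I₂ M₂) (z : M₁ × M₂) :
    f.tensor g z = f z.1 * g z.2 := rfl

theorem Hol.norm_tensor_le {υ₁ : Weight M₁} {υ₂ : Weight M₂} {f : Hol I₁ M₁} {g : Hol I₂ M₂}
    {n₁ n₂ n : ℕ} (h₁ : n₁ ≤ n) (h₂ : n₂ ≤ n) {B₁ B₂ : ℝ} (hB₁ : 0 ≤ B₁) (hB₂ : 0 ≤ B₂)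
    (hf : ∀ x, ‖f x‖ ≤ B₁ * υ₁ x ^ n₁) (hg : ∀ x, ‖g x‖ ≤ B₂ * υ₂ x ^ n₂) (z : M₁ × M₂) :
    ‖f.tensor g z‖ ≤ B₁ * B₂ * υ₁.prod υ₂ z ^ n := by
  have h1 := (hf z.1).trans (υ₁.mul_pow_le_mul_pow h₁ hB₁ z.1)
  have h2 := (hg z.2).trans (υ₂.mul_pow_le_mul_pow h₂ hB₂ z.2)
  rw [Hol.tensor_apply, norm_mul]
  refine (mul_le_mul h1 h2 (norm_nonneg _) ((norm_nonneg _).trans h1)).trans (le_of_eq ?_)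
  change _ = B₁ * B₂ * (υ₁ z.1 * υ₂ z.2) ^ n
  rw [mul_pow]
  ring

variable [I₁.Boundaryless] [IsManifold I₁ 1 M₁] [FiniteDimensional ℂ E₁] [FiniteDimensional ℂ E₂]

/-- The expansion `H = ∑ (aₖ ⊗ bₗ)(H) Fₖ ⊗ Gₗ` on a product. -/
def Expansion.prod {υ₁ : Weight M₁} {υ₂ : Weight M₂} {n m₁ m₂ : ℕ} {κ l : Type}
    (e₁ : Expansion I₁ υ₁ n m₁ κ) (e₂ : Expansion I₂ υ₂ n m₂ l) :
    Expansion (I₁.prod I₂) (υ₁.prod υ₂) n (max m₁ m₂) (κ × l) where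
  coeff k := AFun.prod (e₁.coeff k.1) (e₂.coeff k.2)
  fn k := (e₁.fn k.1).tensor (e₂.fn k.2)
  norm_fn_le k z := by
    have := Hol.norm_tensor_le (υ₁ := υ₁) (υ₂ := υ₂) (le_max_left m₁ m₂) (le_max_right m₁ m₂)
      zero_le_one zero_le_one (fun x => (e₁.norm_fn_le k.1 x).trans_eq (one_mul _).symm)
      (fun x => (e₂.norm_fn_le k.2 x).trans_eq (one_mul _).symm) z
    simpa using this
  summable := by
    refine .of_nonneg_of_le (fun _ => apply_nonneg _ _) (fun k => ?_)
      (e₁.summable.mul_of_nonneg e₂.summable (fun _ => apply_nonneg _ _)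
        fun _ => apply_nonneg _ _)
    rw [Weight.prod_npow]
    exact weightedSeminorm_prod_le _ _ _ _
  hasSum F B hB hF z := by
    obtain ⟨x, y⟩ := z
    have hυ₁ : ∀ x, 0 < υ₁ x ^ n := fun x => pow_pos (υ₁.pos x) n
    have hF' : ∀ x y, ‖F (x, y)‖ ≤ B * υ₁ x ^ n * υ₂ y ^ n := fun x y =>
      (hF (x, y)).trans_eq (by
        change B * (υ₁ x * υ₂ y) ^ n = _
        rw [mul_pow, mul_assoc])
    set w₁ := fun k => weightedSeminorm I₁ (υ₁.npow n) (e₁.coeff k)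
    set w₂ := fun k => weightedSeminorm I₂ (υ₂.npow n) (e₂.coeff k)
    -- `x ↦ b (F (x, ·))` is bounded by `B ‖b‖ υ₁ⁿ`
    have hb : ∀ j x, ‖F.partialEval (e₂.coeff j) x‖ ≤ B * w₂ j * υ₁ x ^ n := fun j x => by
      have := e₂.norm_coeff_le j (mul_nonneg hB (hυ₁ x).le) (g := F.slice x) (hF' x)
      refine this.trans (le_of_eq ?_)
      ring
    have hBw : ∀ j, 0 ≤ B * w₂ j := fun j => mul_nonneg hB (apply_nonneg _ _)
    have hsum : Summable fun k : κ × l => AFun.prod (e₁.coeff k.1) (e₂.coeff k.2) F *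
        (e₁.fn k.1).tensor (e₂.fn k.2) (x, y) := by
      refine .of_norm_bounded (((e₁.summable.mul_of_nonneg e₂.summable (fun _ => apply_nonneg _ _)
        fun _ => apply_nonneg _ _).mul_left B).mul_right (υ₁ x ^ m₁ * υ₂ y ^ m₂)) fun k => ?_
      have h1 : ‖AFun.prod (e₁.coeff k.1) (e₂.coeff k.2) F‖ ≤ B * w₂ k.2 * w₁ k.1 :=
        e₁.norm_coeff_le k.1 (hBw k.2) (hb k.2)
      rw [norm_mul, Hol.tensor_apply, norm_mul]
      refine (mul_le_mul h1 (mul_le_mul (e₁.norm_fn_le k.1 x) (e₂.norm_fn_le k.2 y) (norm_nonneg _)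
        (pow_pos (υ₁.pos x) _).le) (by positivity)
        (mul_nonneg (hBw k.2) (apply_nonneg _ _))).trans (le_of_eq ?_)
      ring
    have h2 : HasSum (fun j => F.partialEval (e₂.coeff j) x * e₂.fn j y) (F (x, y)) :=
      e₂.hasSum (F.slice x) _ (mul_nonneg hB (hυ₁ x).le) (hF' x) y
    have h3 := (Equiv.prodComm l κ).hasSum_iff.2 hsum.hasSum
    have h4 : HasSum (fun j => F.partialEval (e₂.coeff j) x * e₂.fn j y) _ :=
      h3.prod_fiberwise fun j => by
        have := (e₁.hasSum (F.partialEval (e₂.coeff j)) _ (hBw j) (hb j) x).mul_right (e₂.fn j y)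
        simp only [mul_assoc] at this
        exact this
    rw [h2.unique h4]
    exact hsum.hasSum

end Product

/-! ### Nuclearity provides expansions -/

section LocalBanach

open UniformSpace (Completion)

theorem continuous_toLocalBanach {X : Type*} [AddCommGroup X] [Module ℂ X] [TopologicalSpace X]
    [IsTopologicalAddGroup X] {p : Seminorm ℂ X} (hp : Continuous p) :
    Continuous (toLocalBanach p) := by
  let T : X →+ SeminormSpace p := ⟨⟨SeminormSpace.of p, rfl⟩, fun _ _ => rfl⟩
  have hT : Continuous T := by
    refine continuous_of_continuousAt_zero T ?_
    rw [ContinuousAt, map_zero, tendsto_zero_iff_norm_tendsto_zero]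
    have : Tendsto p (𝓝 0) (𝓝 0) := by simpa using hp.tendsto 0
    exact this
  exact (Completion.continuous_coe _).comp hT

theorem norm_toLocalBanach {X : Type*} [AddCommGroup X] [Module ℂ X] (p : Seminorm ℂ X) (x : X) :
    ‖toLocalBanach p x‖ = p x :=
  Completion.norm_coe (SeminormSpace.of p x)

/-- A functional dominated by a multiple of a seminorm `p` extends to the Banach space associated
with `p`. -/
theorem exists_functional_localBanach {X : Type*} [AddCommGroup X] [Module ℂ X] {p : Seminorm ℂ X}
    {φ : X →ₗ[ℂ] ℂ} {C : ℝ} (hφ : ∀ x, ‖φ x‖ ≤ C * p x) :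
    ∃ ψ : LocalBanach p →L[ℂ] ℂ, ∀ x, ψ (toLocalBanach p x) = φ x := by
  let φ' : SeminormSpace p →ₗ[ℂ] ℂ := φ
  obtain ⟨ψ, hψ, -⟩ := exists_functional_extension (normSeminorm ℂ (SeminormSpace p))
    continuous_norm (φ := φ') (C := C) hφ
  exact ⟨ψ, fun x => hψ (SeminormSpace.of p x)⟩

theorem completionSeminorm_mono {X : Type*} [UniformSpace X] [AddCommGroup X] [IsUniformAddGroup X]
    [Module ℂ X] [UniformContinuousConstSMul ℂ X] {p q : Seminorm ℂ X} (hp : Continuous p)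
    (hq : Continuous q) (h : p ≤ q) : completionSeminorm p hp ≤ completionSeminorm q hq := by
  intro z
  induction z using Completion.induction_on with
  | hp => exact isClosed_le (continuous_completionSeminorm _ _) (continuous_completionSeminorm _ _)
  | ih a => simpa using h a

/-- In a Banach space, each element is the sum of a series with terms in a given dense subgroup, the
sum of whose norms is almost optimal. -/
theorem exists_hasSum_of_dense {Y : Type*} [NormedAddCommGroup Y] [CompleteSpace Y]
    {s : AddSubgroup Y} (hs : Dense (s : Set Y)) (y : Y) {ε : ℝ} (hε : 0 < ε) :
    ∃ v : ℕ → Y, (∀ i, v i ∈ s) ∧ HasSum v y ∧ (Summable fun i => ‖v i‖) ∧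
      ∑' i, ‖v i‖ ≤ ‖y‖ + ε := by
  obtain ⟨v, hv, hvs, h0, h1⟩ := controlled_sum_of_mem_closure (s := s) (hs y)
    (b := fun i => ε / 2 * (1 / 2) ^ i) fun i => by positivity
  have hb : HasSum (fun i => ε / 2 * (1 / 2 : ℝ) ^ i) ε := by
    have := hasSum_geometric_two.mul_left (ε / 2)
    rwa [div_mul_cancel₀ _ two_ne_zero] at this
  have hle : ∀ i, ‖v i‖ ≤ (if i = 0 then ‖y‖ else 0) + ε / 2 * (1 / 2) ^ i := by
    intro i
    rcases Nat.eq_zero_or_pos i with rfl | hi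
    · have := norm_sub_le y (-v 0 + y)
      rw [neg_add_eq_sub, sub_sub_cancel] at this
      rw [neg_add_eq_sub] at h0
      rw [if_pos rfl]
      linarith
    · rw [if_neg hi.ne', zero_add]
      exact (h1 i hi).le
  have hd := (hasSum_ite_eq 0 ‖y‖).add hb
  have hsn : Summable fun i => ‖v i‖ := .of_nonneg_of_le (fun _ => norm_nonneg _) hle hd.summable
  refine ⟨v, hvs, ?_, hsn, (hsn.tsum_le_tsum hle hd.summable).trans_eq hd.tsum_eq⟩
  have h2 := hsn.of_norm.hasSum
  have h3 := (tendsto_add_atTop_iff_nat 1).2 h2.tendsto_sum_nat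
  rwa [tendsto_nhds_unique h3 hv] at h2

end LocalBanach

section Nuclear

open UniformSpace (Completion)

variable {E : Type*} [NormedAddCommGroup E] [NormedSpace ℂ E]
  {H : Type*} [TopologicalSpace H] {I : ModelWithCorners ℂ E H}
  {M : Type*} [TopologicalSpace M] [ChartedSpace H M] {υ : Weight M}
  [I.Boundaryless] [IsManifold I 1 M] [FiniteDimensional ℂ E] [T2Space M]

/-- The canonical map from `𝒜_{υ^∞}(M)` to the completion for `‖·‖_{υⁿ}`, written as a nuclear map
`∑ fₖ yₖ` and restricted to the point evaluations, expresses `g(x)` as `∑ fₖ(δ_x) ĝ(yₖ)`, where `ĝ`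
is the functional defined by `g`. -/
theorem hasExpansions_of_isNuclear (h : IsNuclear (AWeightedInf I υ)) : HasExpansions I υ := by
  intro n
  set S : ℕ → Set (AFun I M) := fun n => weightedDeltas I (υ.npow n)
  have hp := withSeminorms_weightedFamily (I := I) υ.npow
  have hP := withSeminorms_completionSeminorm hp
  set P : ℕ → Seminorm ℂ (AWeightedInf I υ) :=
    fun i => completionSeminorm (weightedFamily I υ.npow i) (hp.continuous_seminorm i)
  have hPm : Monotone P := fun i j hij => completionSeminorm_mono _ _
    (weightedSeminorm_mono fun x => pow_le_pow_right₀ (υ.one_le x) hij)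
  obtain ⟨q, f, y, hq, hfq, hy, hsum⟩ := h (P n) (hP.continuous_seminorm n)
  obtain ⟨m, C, hC, hqP⟩ := exists_le_of_withSeminorms hP hPm hq
  let J₀ : AFun I M →ₗ[ℂ] AWeightedInf I υ :=
    ⟨⟨toGaugeCompletion S, fun a b => Completion.coe_add (GaugeSpace.of S a) (GaugeSpace.of S b)⟩,
      fun c a => Completion.coe_smul c (GaugeSpace.of S a)⟩
  have hPJ : ∀ i a, P i (J₀ a) = weightedSeminorm I (υ.npow i) a := fun i a =>
    completionSeminorm_coe (weightedFamily I υ.npow i) (hp.continuous_seminorm i) (GaugeSpace.of S a)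
  let J : AFun I M →+ LocalBanach (P n) :=
    AddMonoidHom.mk' (fun a => toLocalBanach (P n) (J₀ a)) fun a b =>
      (congrArg (toLocalBanach (P n)) (map_add J₀ a b)).trans
        (Completion.coe_add (SeminormSpace.of (P n) (J₀ a)) (SeminormSpace.of (P n) (J₀ b)))
  have hJn : ∀ a, ‖J a‖ = weightedSeminorm I (υ.npow n) a := fun a =>
    (norm_toLocalBanach _ _).trans (hPJ n a)
  have hJd : Dense (J.range : Set (LocalBanach (P n))) := by
    have h1 : DenseRange J₀ := Completion.denseRange_coe (α := GaugeSpace S)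
    have h2 : DenseRange (toLocalBanach (P n)) :=
      Completion.denseRange_coe (α := SeminormSpace (P n))
    exact h2.comp h1 (continuous_toLocalBanach (hP.continuous_seminorm n))
  -- the functionals `f k` are evaluations at holomorphic functions
  choose F hFle hF using fun k => exists_hol_of_le_weightedSeminorm (I := I) (υ := υ.npow m)
    (φ := (f k).toLinearMap ∘ₗ J₀) hC.le fun a =>
      ((hfq k (J₀ a)).trans (hqP _)).trans_eq (by rw [hPJ])
  -- the vectors `y k` are sums of absolutely convergent series in `𝒜(M)`
  choose v hv hvy hvs hvle using fun k =>
    exists_hasSum_of_dense hJd (y k) (ε := (1 / 2) ^ k) (by positivity)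
  choose a ha using hv
  have hC0 : (C : ℂ) ≠ 0 := by exact_mod_cast hC.ne'
  have hCn : ‖(C : ℂ)‖ = C := by rw [Complex.norm_real, Real.norm_of_nonneg hC.le]
  have hws : Summable fun k : ℕ × ℕ => ‖v k.1 k.2‖ := by
    refine (summable_prod_of_nonneg fun _ => norm_nonneg _).2 ⟨hvs, ?_⟩
    exact .of_nonneg_of_le (fun _ => tsum_nonneg fun _ => norm_nonneg _) hvle
      (hy.add summable_geometric_two)
  have hwa : ∀ k i, weightedSeminorm I (υ.npow n) (a k i) = ‖v k i‖ := fun k i => by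
    rw [← hJn, ha]
  refine ⟨m, ℕ × ℕ, ⟨{
    coeff := fun k => (C : ℂ) • a k.1 k.2
    fn := fun k => (C : ℂ)⁻¹ • F k.1
    norm_fn_le := fun k x => by
      rw [Hol.smul_apply, norm_mul, norm_inv, hCn, inv_mul_le_iff₀ hC]
      exact hFle k.1 x
    summable := by
      simp only [map_smul_eq_mul, hCn, hwa]
      exact hws.mul_left C
    hasSum := fun g B hB hg x => ?_ }⟩⟩
  let ev : GaugeSpace S →ₗ[ℂ] ℂ :=
    (⟨⟨fun a => a g, fun _ _ => rfl⟩, fun _ _ => rfl⟩ : AFun I M →ₗ[ℂ] ℂ)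
  obtain ⟨ψ₀, hψ₀, hψ₀le⟩ := exists_functional_extension (weightedFamily I υ.npow n)
    (hp.continuous_seminorm n) (φ := ev) (C := B)
    fun a => norm_apply_le_mul_weightedSeminorm (υ := υ.npow n) a hB hg
  obtain ⟨ψ, hψ⟩ := exists_functional_localBanach (p := P n) (φ := ψ₀.toLinearMap) hψ₀le
  have hψJ : ∀ b : AFun I M, ψ (J b) = b g := fun b => (hψ _).trans (hψ₀ (GaugeSpace.of S b))
  have h1 : HasSum (fun k => F k x * ψ (y k)) (g x) := by
    have h2 := (hsum (J₀ (delta I x))).mapL ψ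
    have h3 : ψ (toLocalBanach (P n) (J₀ (delta I x))) = g x := hψJ (delta I x)
    have h4 : ∀ k, ψ (f k (J₀ (delta I x)) • y k) = F k x * ψ (y k) := fun k => by
      rw [map_smul, smul_eq_mul, show f k (J₀ (delta I x)) = F k x from hF k (delta I x)]
    simp only [h3, h4] at h2
    exact h2
  have h4 : ∀ k, HasSum (fun i => F k x * a k i g) (F k x * ψ (y k)) := fun k => by
    have := (hvy k).mapL ψ
    simp only [← ha, hψJ] at this
    exact this.mul_left _
  have h5 : Summable fun k : ℕ × ℕ => F k.1 x * a k.1 k.2 g := by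
    refine .of_norm_bounded (hws.mul_left (C * υ x ^ m * B)) fun k => ?_
    rw [norm_mul]
    have h6 := norm_apply_le_mul_weightedSeminorm (υ := υ.npow n) (a k.1 k.2) hB hg
    rw [hwa] at h6
    exact (mul_le_mul (hFle k.1 x) h6 (norm_nonneg _)
      (mul_nonneg hC.le (pow_pos (υ.pos x) m).le)).trans_eq (mul_assoc _ _ _).symm
  rw [h1.unique (h5.hasSum.prod_fiberwise h4)]
  have h7 : ∀ k : ℕ × ℕ, ((C : ℂ) • a k.1 k.2) g * ((C : ℂ)⁻¹ • F k.1) x =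
      F k.1 x * a k.1 k.2 g := fun k => by
    change (C : ℂ) * a k.1 k.2 g * ((C : ℂ)⁻¹ * F k.1 x) = _
    field_simp
  simp only [h7]
  exact h5.hasSum

end Nuclear

/-! ### Completeness of the inductive limit -/

section Complete

variable {E : Type*} [NormedAddCommGroup E] [NormedSpace ℂ E]
  {H : Type*} [TopologicalSpace H] {I : ModelWithCorners ℂ E H}
  {M : Type*} [TopologicalSpace M] [ChartedSpace H M] {υ : Weight M}

namespace HolInf

/-- Given continuous seminorms `pₙ`, there is a neighbourhood of `0` which is contained in
`Bₙ + {pₙ ≤ 1}` for all `n`, where `Bₙ` is the unit ball of `𝒪_{υⁿ}(M)`. -/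
theorem exists_seminorm_forall_exists_le (p : ℕ → Seminorm ℂ (HolInf I υ))
    (hp : ∀ n, Continuous (p n)) : ∃ r : Seminorm ℂ (HolInf I υ), Continuous r ∧
      ∀ f, r f < 1 → ∀ n, ∃ g : HolInf I υ, (∀ x, ‖g x‖ ≤ υ x ^ n) ∧ p n (f - g) ≤ 1 := by
  refine exists_seminorm_of_absConvex
    (V := {f | ∀ n, ∃ g : HolInf I υ, (∀ x, ‖g x‖ ≤ υ x ^ n) ∧ p n (f - g) ≤ 1})
    ⟨?_, convex_RCLike_iff_convex_real.2 ?_⟩ fun N => ?_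
  · refine balanced_iff_smul_mem.2 fun {c} hc f hf n => ?_
    obtain ⟨g, hg, hpg⟩ := hf n
    refine ⟨c • g, fun x => ?_, ?_⟩
    · rw [smul_apply, norm_mul]
      exact (mul_le_of_le_one_left (norm_nonneg _) hc).trans (hg x)
    · rw [← smul_sub, map_smul_eq_mul]
      exact (mul_le_of_le_one_left (apply_nonneg _ _) hc).trans hpg
  · intro f hf f' hf' s t hs ht hst n
    obtain ⟨g, hg, hpg⟩ := hf n
    obtain ⟨g', hg', hpg'⟩ := hf' n
    have hcv := (absConvex_of_seminorm_le (p n) 1).2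
    rw [convex_RCLike_iff_convex_real] at hcv
    refine ⟨s • g + t • g', fun x => ?_, ?_⟩
    · change ‖(s : ℂ) * g x + (t : ℂ) * g' x‖ ≤ _
      refine (norm_add_le _ _).trans ?_
      rw [norm_mul, norm_mul, Complex.norm_real, Complex.norm_real, Real.norm_of_nonneg hs,
        Real.norm_of_nonneg ht]
      calc s * ‖g x‖ + t * ‖g' x‖ ≤ s * υ x ^ n + t * υ x ^ n := by
            gcongr
            exacts [hg x, hg' x]
        _ = υ x ^ n := by rw [← add_mul, hst, one_mul]
    · have := hcv (x := f - g) hpg (y := f' - g') hpg' hs ht hst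
      rwa [show s • f + t • f' - (s • g + t • g') = s • (f - g) + t • (f' - g') by
        rw [smul_sub, smul_sub]; abel]
  · -- only the finitely many seminorms `pₙ` with `n < N` impose a condition on small multiples of
    -- the unit ball of `𝒪_{υᴺ}(M)`
    choose C hC0 hC using fun n => exists_seminorm_bound (hp n) N
    set D : ℝ := 1 + ∑ n ∈ Finset.range N, C n
    have hD : 1 ≤ D := le_add_of_nonneg_right (Finset.sum_nonneg fun n _ => hC0 n)
    have hD0 : 0 < D := zero_lt_one.trans_le hD
    refine ⟨D⁻¹, inv_pos.2 hD0, fun f hf n => ?_⟩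
    rcases lt_or_ge n N with hn | hn
    · refine ⟨0, fun x => by simpa using (pow_pos (υ.pos x) n).le, ?_⟩
      rw [sub_zero]
      refine (hC n f D⁻¹ (inv_nonneg.2 hD0.le) hf).trans ?_
      rw [← div_eq_mul_inv, div_le_one hD0]
      have := Finset.single_le_sum (fun n _ => hC0 n) (Finset.mem_range.2 hn)
      linarith
    · refine ⟨f, fun x => (hf x).trans ?_, by simp⟩
      refine (υ.mul_pow_le_mul_pow hn (inv_nonneg.2 hD0.le) x).trans ?_
      exact mul_le_of_le_one_left (pow_pos (υ.pos x) n).le (inv_le_one_of_one_le₀ hD)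

variable [I.Boundaryless] [IsManifold I 1 M] [FiniteDimensional ℂ E] [T2Space M]

/-- The balls of `𝒪_{υⁿ}(M)` are relatively compact in `𝒪_{υ^∞}(M)`. -/
theorem exists_le_nhds_of_ultrafilter (hυ : HasExpansions I υ) (l : Ultrafilter (HolInf I υ)) {n : ℕ}
    {B : ℝ} (hB : 0 ≤ B) (hl : {f : HolInf I υ | ∀ x, ‖f x‖ ≤ B * υ x ^ n} ∈ l) :
    ∃ f, (l : Filter (HolInf I υ)) ≤ 𝓝 f := by
  have hlim : ∀ a : AFun I M, ∃ c : ℂ, ‖c‖ ≤ B * weightedSeminorm I (υ.npow n) a ∧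
      Tendsto (fun f : HolInf I υ => a f.1) l (𝓝 c) := fun a => by
    obtain ⟨c, hc, hlc⟩ := (isCompact_closedBall (0 : ℂ)
      (B * weightedSeminorm I (υ.npow n) a)).ultrafilter_le_nhds (l.map fun f => a f.1) (by
        rw [le_principal_iff]
        refine Ultrafilter.mem_map.2 (mem_of_superset hl fun f hf => ?_)
        rw [mem_preimage, mem_closedBall_zero_iff]
        exact norm_apply_le_mul_weightedSeminorm (υ := υ.npow n) a hB hf)
    exact ⟨c, by simpa using hc, hlc⟩
  choose c hc hlc using hlim
  let φ : AFun I M →ₗ[ℂ] ℂ :=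
    { toFun := c
      map_add' := fun a b => tendsto_nhds_unique (hlc (a + b)) ((hlc a).add (hlc b))
      map_smul' := fun t a => tendsto_nhds_unique (hlc (t • a)) ((hlc a).const_smul t) }
  -- the pointwise limit `φ` on `𝒜(M)` is the evaluation at a function `g` in the same ball, and the
  -- expansion turns pointwise convergence to `g` into convergence in `𝒪_{υᵐ}(M)`
  obtain ⟨g, hg, hφg⟩ := exists_hol_of_le_weightedSeminorm (φ := φ) (υ := υ.npow n) hB hc
  obtain ⟨m, κ, ⟨e⟩⟩ := hυ n
  refine ⟨ofBound g n B hB hg, tendsto_of_bound (g := id) m fun ε hε => ?_⟩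
  have h2B : 0 ≤ 2 * B := by positivity
  have hbd : ∀ᶠ f : HolInf I υ in l, ∀ x, ‖(f.1 - g) x‖ ≤ 2 * B * υ x ^ n := by
    filter_upwards [hl] with f hf x
    have h1 : (f.1 - g) x = f.1 x - g x := map_sub (delta I x) f.1 g
    rw [h1]
    refine (norm_sub_le _ _).trans ?_
    have h2 : ‖f.1 x‖ ≤ B * υ x ^ n := hf x
    have h3 : ‖g x‖ ≤ B * υ x ^ n := hg x
    linarith
  have htend : Tendsto (fun f : HolInf I υ => ∑' k, ‖e.coeff k (f.1 - g)‖) l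
      (𝓝 (∑' _ : κ, (0 : ℝ))) := by
    refine tendsto_tsum_of_dominated_convergence (e.summable.mul_left (2 * B)) (fun k => ?_) ?_
    · have h1 : Tendsto (fun f : HolInf I υ => e.coeff k f.1 - e.coeff k g) l (𝓝 0) := by
        have := (hlc (e.coeff k)).sub_const (e.coeff k g)
        rwa [show c (e.coeff k) = e.coeff k g from hφg _, sub_self] at this
      simpa using h1.norm
    · filter_upwards [hbd] with f hf k
      rw [norm_norm]
      exact e.norm_coeff_le k h2B hf
  rw [tsum_zero] at htend
  filter_upwards [hbd, htend.eventually_lt_const hε] with f hf hfε x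
  have h1 := e.norm_le_tsum h2B hf x
  rw [show (f.1 - g) x = f x - g x from map_sub (delta I x) f.1 g] at h1
  exact h1.trans (mul_le_mul_of_nonneg_right hfε.le (pow_pos (υ.pos x) m).le)

end HolInf

end Complete

section Cauchy

variable {E : Type*} [NormedAddCommGroup E] [NormedSpace ℂ E]
  {H : Type*} [TopologicalSpace H] {I : ModelWithCorners ℂ E H}
  {M : Type*} [TopologicalSpace M] [ChartedSpace H M] {υ : Weight M}

namespace HolInf

/-- The uniform structure of the topological group `𝒪_{υ^∞}(M)`. -/
@[reducible]
def uniformSpace : UniformSpace (HolInf I υ) := IsTopologicalAddGroup.rightUniformSpace _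

attribute [local instance] uniformSpace

theorem isUniformAddGroup : IsUniformAddGroup (HolInf I υ) := isUniformAddGroup_of_addCommGroup

/-- A Cauchy filter on `𝒪_{υ^∞}(M)` accumulates at a ball of one of the spaces `𝒪_{υⁿ}(M)`: all its
members come arbitrarily close to this ball. -/
theorem exists_forall_exists_le_of_cauchy {l : Filter (HolInf I υ)} (hl : Cauchy l) :
    ∃ n : ℕ, ∀ A ∈ l, ∀ p : Seminorm ℂ (HolInf I υ), Continuous p →
      ∃ f ∈ A, ∃ g : HolInf I υ, (∀ x, ‖g x‖ ≤ n * υ x ^ n) ∧ p (f - g) ≤ 1 := by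
  have := hl.1
  have := isUniformAddGroup (I := I) (υ := υ)
  by_contra! hcon
  choose A hA p hp hcon using hcon
  obtain ⟨r, hr, hrp⟩ := exists_seminorm_forall_exists_le p hp
  obtain ⟨A', hA', hsub⟩ := (cauchy_iff.1 hl).2 {z | r (z.2 - z.1) < 1} (by
    rw [uniformity_eq_comap_nhds_zero]
    exact preimage_mem_comap ((isOpen_lt hr continuous_const).mem_nhds (by simp)))
  obtain ⟨f, hf⟩ := Filter.nonempty_of_mem hA'
  obtain ⟨N, B, hB, hfB⟩ := exists_bound f
  set n := max N (⌈B⌉₊ + 1)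
  obtain ⟨f', hf', hf'A⟩ := Filter.nonempty_of_mem (inter_mem hA' (hA n))
  have h1 : r (f' - f) < 1 := hsub (mk_mem_prod hf hf')
  obtain ⟨g, hg, hpg⟩ := hrp _ h1 n
  refine (hcon n f' hf'A (f + g) fun x => ?_).not_ge (by rwa [← sub_sub])
  have hn : B + 1 ≤ n := by
    have : ((⌈B⌉₊ + 1 : ℕ) : ℝ) ≤ n := Nat.cast_le.2 (le_max_right _ _)
    push_cast at this
    linarith [Nat.le_ceil B]
  have h2 := (hfB x).trans (υ.mul_pow_le_mul_pow (le_max_left N (⌈B⌉₊ + 1)) hB x)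
  rw [add_apply]
  calc ‖f x + g x‖ ≤ B * υ x ^ n + υ x ^ n := (norm_add_le _ _).trans (add_le_add h2 (hg x))
    _ = (B + 1) * υ x ^ n := by ring
    _ ≤ n * υ x ^ n := mul_le_mul_of_nonneg_right hn (pow_pos (υ.pos x) n).le

theorem completeSpace [I.Boundaryless] [IsManifold I 1 M] [FiniteDimensional ℂ E] [T2Space M]
    (hυ : HasExpansions I υ) : CompleteSpace (HolInf I υ) := by
  refine ⟨fun {l} hl => ?_⟩
  have := hl.1
  obtain ⟨n, hn⟩ := exists_forall_exists_le_of_cauchy hl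
  set K : Set (HolInf I υ) := {f | ∀ x, ‖f x‖ ≤ n * υ x ^ n}
  -- the filter generated by the sets `A - U` has a trace on the ball `K`; an accumulation point of
  -- this trace is one of `l`
  let G : Filter (HolInf I υ) := (l ×ˢ 𝓝 0).map fun z => z.1 - z.2
  have hG : (G ⊓ 𝓟 K).NeBot := by
    refine inf_principal_neBot_iff.2 fun s hs => ?_
    obtain ⟨A, hA, U, hU, hAU⟩ := mem_prod_iff.1 (mem_map.1 hs)
    have := polynormableSpace_of_locallyConvexSpace (HolInf I υ)
    obtain ⟨p, hp, hpU⟩ := exists_continuous_seminorm_of_mem_nhds hU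
    obtain ⟨f, hf, g, hg, hpg⟩ := hn A hA p hp
    have h1 : (f, f - g) ∈ A ×ˢ U := ⟨hf, hpU _ hpg⟩
    have h2 : f - (f - g) ∈ s := hAU h1
    rw [sub_sub_cancel] at h2
    exact ⟨g, h2, hg⟩
  have hle : (Ultrafilter.of (G ⊓ 𝓟 K) : Filter (HolInf I υ)) ≤ G ⊓ 𝓟 K := Ultrafilter.of_le _
  obtain ⟨f₀, hf₀⟩ := exists_le_nhds_of_ultrafilter hυ (Ultrafilter.of (G ⊓ 𝓟 K))
    n.cast_nonneg (hle (mem_inf_of_right (mem_principal_self K)))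
  refine ⟨f₀, le_nhds_of_cauchy_adhp hl ?_⟩
  refine clusterPt_iff_nonempty.2 fun W hW A hA => ?_
  have hadd : Tendsto (fun z : HolInf I υ × HolInf I υ => z.1 + z.2) (𝓝 f₀ ×ˢ 𝓝 0) (𝓝 f₀) := by
    have := (continuous_add (M := HolInf I υ)).tendsto (f₀, 0)
    rwa [nhds_prod_eq, add_zero] at this
  obtain ⟨W', hW', U, hU, hWU⟩ := mem_prod_iff.1 (hadd hW)
  have h1 : (fun z : HolInf I υ × HolInf I υ => z.1 - z.2) '' (A ×ˢ U) ∈ G :=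
    image_mem_map (prod_mem_prod hA hU)
  obtain ⟨g, hg, ⟨⟨f, u⟩, ⟨hf, hu⟩, hfu⟩⟩ := (Ultrafilter.of (G ⊓ 𝓟 K)).nonempty_of_mem
    (inter_mem (hf₀ hW') (hle (mem_inf_of_left h1)))
  have h2 : (g, u) ∈ W' ×ˢ U := ⟨hg, hu⟩
  have h3 : g + u ∈ W := hWU h2
  rw [← hfu] at h3
  simp only [sub_add_cancel] at h3
  exact ⟨f, h3, hf⟩

end HolInf

end Cauchy

/-! ### Elementary tensors in the inductive limit -/

theorem Seminorm.bilinear_le_mul {X Y Z : Type*} [AddCommGroup X] [Module ℂ X] [AddCommGroup Y]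
    [Module ℂ Y] [AddCommGroup Z] [Module ℂ Z] (β : X →ₗ[ℂ] Y →ₗ[ℂ] Z) {p : Seminorm ℂ X}
    {q : Seminorm ℂ Y} {r : Seminorm ℂ Z} (h : ∀ x y, p x < 1 → q y < 1 → r (β x y) ≤ 1) (x : X)
    (y : Y) : r (β x y) ≤ p x * q y := by
  have h1 : ∀ x, p x < 1 → ∀ y, r (β x y) ≤ q y := fun x hx y => by
    have := Seminorm.le_mul_of_bound q (r.comp (β x)) zero_lt_one (fun y hy => h x y hx hy) y
    simpa using this
  have h2 := Seminorm.le_mul_of_bound p (r.comp (β.flip y)) zero_lt_one (fun x hx => h1 x hx y) x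
  rw [div_one, mul_comm] at h2
  exact h2

/-- Pulled back along a continuous bilinear map, a continuous seminorm is dominated by a product of
continuous seminorms. -/
theorem exists_seminorm_mul_bound {X Y Z : Type*} [AddCommGroup X] [Module ℂ X]
    [TopologicalSpace X] [PolynormableSpace ℂ X] [AddCommGroup Y] [Module ℂ Y] [TopologicalSpace Y]
    [PolynormableSpace ℂ Y] [AddCommGroup Z] [Module ℂ Z]
    [TopologicalSpace Z] (β : X →ₗ[ℂ] Y →ₗ[ℂ] Z) (hβ : Continuous fun z : X × Y => β z.1 z.2)
    {r : Seminorm ℂ Z} (hr : Continuous r) : ∃ (p : Seminorm ℂ X) (q : Seminorm ℂ Y),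
      Continuous p ∧ Continuous q ∧ ∀ x y, r (β x y) ≤ p x * q y := by
  have h : {z : X × Y | r (β z.1 z.2) < 1} ∈ 𝓝 ((0, 0) : X × Y) :=
    (isOpen_lt (hr.comp hβ) continuous_const).mem_nhds (by simp)
  rw [nhds_prod_eq] at h
  obtain ⟨U, hU, W, hW, hUW⟩ := mem_prod_iff.1 h
  obtain ⟨p, hp, hpU⟩ := exists_continuous_seminorm_of_mem_nhds hU
  obtain ⟨q, hq, hqW⟩ := exists_continuous_seminorm_of_mem_nhds hW
  refine ⟨p, q, hp, hq, Seminorm.bilinear_le_mul β fun x y hx hy => ?_⟩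
  have : (x, y) ∈ U ×ˢ W := ⟨hpU x hx.le, hqW y hy.le⟩
  exact le_of_lt (hUW this)

theorem absConvex_setOf_forall_le {X ι : Type*} [AddCommGroup X] [Module ℂ X]
    (p : ι → Seminorm ℂ X) (c : ι → ℝ) : AbsConvex ℂ {x | ∀ i, p i x ≤ c i} := by
  rw [ofPred_forall]
  exact .iInter fun i => absConvex_of_seminorm_le (p i) (c i)

section Product

variable {E₁ E₂ : Type*} [NormedAddCommGroup E₁] [NormedSpace ℂ E₁] [NormedAddCommGroup E₂]
  [NormedSpace ℂ E₂] {H₁ H₂ : Type*} [TopologicalSpace H₁] [TopologicalSpace H₂]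
  {I₁ : ModelWithCorners ℂ E₁ H₁} {I₂ : ModelWithCorners ℂ E₂ H₂}
  {M₁ M₂ : Type*} [TopologicalSpace M₁] [ChartedSpace H₁ M₁] [TopologicalSpace M₂]
  [ChartedSpace H₂ M₂] {υ₁ : Weight M₁} {υ₂ : Weight M₂}

namespace HolInf

/-- The bilinear map `(f, g) ↦ f ⊗ g`. -/
def tensorₗ : HolInf I₁ υ₁ →ₗ[ℂ] HolInf I₂ υ₂ →ₗ[ℂ] HolInf (I₁.prod I₂) (υ₁.prod υ₂) :=
  LinearMap.mk₂ ℂ (fun f g => ⟨f.1.tensor g.1, by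
      obtain ⟨n₁, B₁, hB₁, hf⟩ := f.exists_bound
      obtain ⟨n₂, B₂, hB₂, hg⟩ := g.exists_bound
      exact ⟨max n₁ n₂, mem_weightedSubmodule_npow_iff.2 ⟨B₁ * B₂, mul_nonneg hB₁ hB₂,
        Hol.norm_tensor_le (le_max_left n₁ n₂) (le_max_right n₁ n₂) hB₁ hB₂ hf hg⟩⟩⟩)
    (fun _ _ _ => DFunLike.ext _ _ fun _ => add_mul _ _ _)
    (fun _ _ _ => DFunLike.ext _ _ fun _ => mul_assoc _ _ _)
    (fun _ _ _ => DFunLike.ext _ _ fun _ => mul_add _ _ _)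
    (fun _ _ _ => DFunLike.ext _ _ fun _ => mul_left_comm _ _ _)

@[simp] theorem tensorₗ_apply (f : HolInf I₁ υ₁) (g : HolInf I₂ υ₂) (z : M₁ × M₂) :
    tensorₗ f g z = f z.1 * g z.2 := rfl

theorem norm_tensorₗ_le {f : HolInf I₁ υ₁} {g : HolInf I₂ υ₂} {n₁ n₂ n : ℕ} (h₁ : n₁ ≤ n)
    (h₂ : n₂ ≤ n) {B₁ B₂ : ℝ} (hB₁ : 0 ≤ B₁) (hB₂ : 0 ≤ B₂) (hf : ∀ x, ‖f x‖ ≤ B₁ * υ₁ x ^ n₁)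
    (hg : ∀ x, ‖g x‖ ≤ B₂ * υ₂ x ^ n₂) (z : M₁ × M₂) :
    ‖tensorₗ f g z‖ ≤ B₁ * B₂ * υ₁.prod υ₂ z ^ n :=
  Hol.norm_tensor_le h₁ h₂ hB₁ hB₂ hf hg z

theorem continuous_tensorₗ : Continuous fun z : HolInf I₁ υ₁ × HolInf I₂ υ₂ =>
    tensorₗ z.1 z.2 := by
  have := polynormableSpace_of_locallyConvexSpace (HolInf (I₁.prod I₂) (υ₁.prod υ₂))
  have : Nonempty {p : Seminorm ℂ (HolInf (I₁.prod I₂) (υ₁.prod υ₂)) // Continuous p} :=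
    ⟨⟨0, continuous_const (y := (0 : ℝ))⟩⟩
  refine continuous_bilinear_of_le (PolynormableSpace.withSeminorms ℂ _) tensorₗ ?_
  rintro ⟨r, hr⟩
  choose C hC0 hC using exists_seminorm_bound hr
  -- an increasing sequence `D n ≥ 1` majorizing `C`; then `D (max m n) ≤ D m * D n`
  set D : ℕ → ℝ := fun n => 1 + ∑ i ∈ Finset.range (n + 1), C i
  have hD1 : ∀ n, 1 ≤ D n := fun n =>
    le_add_of_nonneg_right (Finset.sum_nonneg fun i _ => hC0 i)
  have hD0 : ∀ n, 0 < D n := fun n => zero_lt_one.trans_le (hD1 n)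
  have hCD : ∀ n, C n ≤ D n := fun n => by
    have := Finset.single_le_sum (fun i _ => hC0 i) (Finset.self_mem_range_succ n)
    simp only [D]
    linarith
  have hDmul : ∀ m n, D (max m n) ≤ D m * D n := fun m n => by
    rcases le_total m n with h | h
    · rw [max_eq_right h]
      exact le_mul_of_one_le_left (hD0 n).le (hD1 m)
    · rw [max_eq_left h]
      exact le_mul_of_one_le_right (hD0 m).le (hD1 n)
  have hbd : ∀ (f : HolInf I₁ υ₁) (g : HolInf I₂ υ₂) (m n : ℕ) (A B : ℝ), 0 ≤ A → 0 ≤ B →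
      (∀ x, ‖f x‖ ≤ A * υ₁ x ^ m) → (∀ x, ‖g x‖ ≤ B * υ₂ x ^ n) →
      r (tensorₗ f g) ≤ D m * D n * (A * B) := fun f g m n A B hA hB hf hg => by
    refine (hC (max m n) _ (A * B) (mul_nonneg hA hB)
      (norm_tensorₗ_le (le_max_left m n) (le_max_right m n) hA hB hf hg)).trans ?_
    exact mul_le_mul_of_nonneg_right ((hCD _).trans (hDmul m n)) (mul_nonneg hA hB)
  -- `{p < 1}` lies in the set of all `f` with `r (f ⊗ g) ≤ D n * B` for all `g` with `|g| ≤ B υ₂ⁿ`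
  let ι := {i : HolInf I₂ υ₂ × ℕ × ℝ // 0 ≤ i.2.2 ∧ ∀ x, ‖i.1 x‖ ≤ i.2.2 * υ₂ x ^ i.2.1}
  obtain ⟨p, hp, hpV⟩ := exists_seminorm_of_absConvex (absConvex_setOf_forall_le
    (fun i : ι => r.comp (tensorₗ.flip i.1.1 : HolInf I₁ υ₁ →ₗ[ℂ] _))
    fun i => D i.1.2.1 * i.1.2.2) fun m => ⟨(D m)⁻¹, inv_pos.2 (hD0 m), by
      rintro f hf ⟨⟨g, n, B⟩, hB, hg⟩
      refine (hbd f g m n _ B (inv_nonneg.2 (hD0 m).le) hB hf hg).trans (le_of_eq ?_)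
      have := (hD0 m).ne'
      field_simp⟩
  obtain ⟨q, hq, hqV⟩ := exists_seminorm_of_absConvex (absConvex_setOf_forall_le
    (fun f : {f : HolInf I₁ υ₁ // p f < 1} => r.comp (tensorₗ f.1 : HolInf I₂ υ₂ →ₗ[ℂ] _))
    fun _ => 1) fun n => ⟨(D n)⁻¹, inv_pos.2 (hD0 n), by
      rintro g hg ⟨f, hf⟩
      refine (hpV f hf ⟨⟨g, n, (D n)⁻¹⟩, inv_nonneg.2 (hD0 n).le, hg⟩).trans (le_of_eq ?_)
      exact mul_inv_cancel₀ (hD0 n).ne'⟩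
  exact ⟨p, q, hp, hq, Seminorm.bilinear_le_mul tensorₗ fun f g hf hg => hqV g hg ⟨f, hf⟩⟩

variable [I₁.Boundaryless] [IsManifold I₁ 1 M₁] [FiniteDimensional ℂ E₁] [FiniteDimensional ℂ E₂]

theorem dense_span_tensorₗ (h₁ : HasExpansions I₁ υ₁) (h₂ : HasExpansions I₂ υ₂) :
    Dense (Submodule.span ℂ (range fun z : HolInf I₁ υ₁ × HolInf I₂ υ₂ => tensorₗ z.1 z.2) :
      Set (HolInf (I₁.prod I₂) (υ₁.prod υ₂))) := by
  intro F
  obtain ⟨n, B, hB, hF⟩ := F.exists_bound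
  obtain ⟨m₁, κ, ⟨e₁⟩⟩ := h₁ n
  obtain ⟨m₂, l, ⟨e₂⟩⟩ := h₂ n
  refine mem_closure_of_tendsto (f := fun s => ∑ k ∈ s, (e₁.prod e₂).coeff k F.1 •
      (e₁.prod e₂).fnInf k) (b := atTop)
    (tendsto_of_bound (max m₁ m₂) fun ε hε =>
      (e₁.prod e₂).eventually_norm_sum_fnInf_sub_le hB hF hε) (.of_forall fun s => ?_)
  exact Submodule.sum_mem _ fun k _ => Submodule.smul_mem _ _
    (Submodule.subset_span ⟨(e₁.fnInf k.1, e₂.fnInf k.2), rfl⟩)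

end HolInf

theorem AFun.prod_tensor [I₁.Boundaryless] [IsManifold I₁ 1 M₁] [FiniteDimensional ℂ E₁]
    [FiniteDimensional ℂ E₂] (a : AFun I₁ M₁) (b : AFun I₂ M₂) (f : Hol I₁ M₁) (g : Hol I₂ M₂) :
    AFun.prod a b (f.tensor g) = a f * b g := by
  have h : (f.tensor g).partialEval b = b g • f := DFunLike.ext _ _ fun x => by
    have : (f.tensor g).slice x = f x • g := rfl
    change b ((f.tensor g).slice x) = b g * f x
    rw [this, map_smul, smul_eq_mul, mul_comm]
  change a ((f.tensor g).partialEval b) = _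
  rw [h, map_smul, smul_eq_mul, mul_comm]

end Product

/-! ### Tensor products of inductive limits -/

section Product

variable {E₁ E₂ : Type*} [NormedAddCommGroup E₁] [NormedSpace ℂ E₁] [NormedAddCommGroup E₂]
  [NormedSpace ℂ E₂] {H₁ H₂ : Type*} [TopologicalSpace H₁] [TopologicalSpace H₂]
  {I₁ : ModelWithCorners ℂ E₁ H₁} {I₂ : ModelWithCorners ℂ E₂ H₂}
  {M₁ M₂ : Type*} [TopologicalSpace M₁] [ChartedSpace H₁ M₁] [TopologicalSpace M₂]
  [ChartedSpace H₂ M₂] {υ₁ : Weight M₁} {υ₂ : Weight M₂}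
  [I₁.Boundaryless] [IsManifold I₁ 1 M₁] [FiniteDimensional ℂ E₁] [FiniteDimensional ℂ E₂]

namespace HolInf

/-- If `φ` is bounded on products of balls, then applying `φ` termwise to the product expansion of
`f ⊗ g` gives `φ f g`. -/
theorem eq_of_hasSum_bilinear (φ : HolInf I₁ υ₁ →ₗ[ℂ] HolInf I₂ υ₂ →ₗ[ℂ] ℂ) {C : ℕ → ℝ}
    (hC : ∀ n, 0 ≤ C n) (hφ : ∀ (n : ℕ) (f : HolInf I₁ υ₁) (g : HolInf I₂ υ₂) (A B : ℝ), 0 ≤ A →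
      0 ≤ B → (∀ x, ‖f x‖ ≤ A * υ₁ x ^ n) → (∀ x, ‖g x‖ ≤ B * υ₂ x ^ n) →
      ‖φ f g‖ ≤ C n * (A * B)) {n m₁ m₂ : ℕ} {κ l : Type} (e₁ : Expansion I₁ υ₁ n m₁ κ)
    (e₂ : Expansion I₂ υ₂ n m₂ l) {f : HolInf I₁ υ₁} {g : HolInf I₂ υ₂} {A B : ℝ} (hA : 0 ≤ A)
    (hB : 0 ≤ B) (hf : ∀ x, ‖f x‖ ≤ A * υ₁ x ^ n) (hg : ∀ x, ‖g x‖ ≤ B * υ₂ x ^ n) {s : ℂ}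
    (hs : HasSum (fun k : κ × l => (e₁.prod e₂).coeff k (tensorₗ f g).1 *
      φ (e₁.fnInf k.1) (e₂.fnInf k.2)) s) : s = φ f g := by
  have h₁ : HasSum (fun k => e₁.coeff k f.1 * φ (e₁.fnInf k) g) (φ f g) :=
    e₁.hasSum_apply hA hf (φ.flip g) (C := C (max m₁ n) * B) (mul_nonneg (hC _) hB)
      fun f' t ht hf' => by
        have := hφ (max m₁ n) f' g t B ht hB
          (fun x => (hf' x).trans (υ₁.mul_pow_le_mul_pow (le_max_left m₁ n) ht x))
          (fun x => (hg x).trans (υ₂.mul_pow_le_mul_pow (le_max_right m₁ n) hB x))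
        exact this.trans_eq (by ring)
  have h₂ : ∀ k, HasSum (fun j => e₂.coeff j g.1 * φ (e₁.fnInf k) (e₂.fnInf j))
      (φ (e₁.fnInf k) g) := fun k =>
    e₂.hasSum_apply hB hg (φ (e₁.fnInf k)) (C := C (max m₁ m₂)) (hC _)
      fun g' t ht hg' => by
        have := hφ (max m₁ m₂) (e₁.fnInf k) g' 1 t zero_le_one ht
          (fun x => (e₁.norm_fnInf_le k x).trans
            (υ₁.mul_pow_le_mul_pow (le_max_left m₁ m₂) zero_le_one x))
          (fun x => (hg' x).trans (υ₂.mul_pow_le_mul_pow (le_max_right m₁ m₂) ht x))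
        rwa [one_mul] at this
  refine (hs.prod_fiberwise fun k => ?_).unique h₁
  have h₃ : ∀ j, (e₁.prod e₂).coeff (k, j) (tensorₗ f g).1 = e₁.coeff k f.1 * e₂.coeff j g.1 :=
    fun j => AFun.prod_tensor _ _ _ _
  simp only [h₃, mul_assoc]
  exact (h₂ k).mul_left _

/-- A bilinear form which is bounded on products of balls factors through `(f, g) ↦ f ⊗ g`, with
bounds on the balls of `𝒪_{υⁿ}(M₁ × M₂)` which only depend on those of the form. -/
theorem exists_factor_bilinear (h₁ : HasExpansions I₁ υ₁) (h₂ : HasExpansions I₂ υ₂) {C : ℕ → ℝ}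
    (hC : ∀ n, 0 ≤ C n) : ∃ D : ℕ → ℝ, ∀ φ : HolInf I₁ υ₁ →ₗ[ℂ] HolInf I₂ υ₂ →ₗ[ℂ] ℂ,
      (∀ (n : ℕ) (f : HolInf I₁ υ₁) (g : HolInf I₂ υ₂) (A B : ℝ), 0 ≤ A →
        0 ≤ B → (∀ x, ‖f x‖ ≤ A * υ₁ x ^ n) → (∀ x, ‖g x‖ ≤ B * υ₂ x ^ n) →
        ‖φ f g‖ ≤ C n * (A * B)) →
      ∃ ψ : HolInf (I₁.prod I₂) (υ₁.prod υ₂) →ₗ[ℂ] ℂ, (∀ f g, ψ (tensorₗ f g) = φ f g) ∧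
        ∀ (n : ℕ) (F : HolInf (I₁.prod I₂) (υ₁.prod υ₂)) (B : ℝ), 0 ≤ B →
          (∀ z, ‖F z‖ ≤ B * υ₁.prod υ₂ z ^ n) → ‖ψ F‖ ≤ D n * B := by
  choose m₁ κ e₁ using h₁
  choose m₂ l e₂ using h₂
  replace e₁ := fun n => (e₁ n).some
  replace e₂ := fun n => (e₂ n).some
  set υ := υ₁.prod υ₂
  let e : ∀ n, Expansion (I₁.prod I₂) υ n (max (m₁ n) (m₂ n)) (κ n × l n) :=
    fun n => (e₁ n).prod (e₂ n)
  set D : ℕ → ℝ := fun n => C (max (m₁ n) (m₂ n)) *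
    ∑' k, weightedSeminorm (I₁.prod I₂) (υ.npow n) ((e n).coeff k)
  have hD : ∀ n, 0 ≤ D n := fun n => mul_nonneg (hC _) (tsum_nonneg fun _ => apply_nonneg _ _)
  refine ⟨D, fun φ hφ => ?_⟩
  -- `Λ n` is the functional on `𝒪_{υⁿ}(M₁ × M₂)` given by the expansion
  have hw : ∀ n (k : κ n × l n), ‖φ ((e₁ n).fnInf k.1) ((e₂ n).fnInf k.2)‖ ≤
      C (max (m₁ n) (m₂ n)) := fun n k => by
    have := hφ (max (m₁ n) (m₂ n)) ((e₁ n).fnInf k.1) ((e₂ n).fnInf k.2) 1 1 zero_le_one zero_le_one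
      (fun x => ((e₁ n).norm_fnInf_le k.1 x).trans
        (υ₁.mul_pow_le_mul_pow (le_max_left _ _) zero_le_one x))
      (fun x => ((e₂ n).norm_fnInf_le k.2 x).trans
        (υ₂.mul_pow_le_mul_pow (le_max_right _ _) zero_le_one x))
    simpa using this
  choose Λ hΛ using fun n => (e n).exists_functional _ (hw n)
  have hΛt : ∀ (n : ℕ) (f : HolInf I₁ υ₁) (g : HolInf I₂ υ₂) (A B : ℝ), 0 ≤ A → 0 ≤ B →
      (∀ x, ‖f x‖ ≤ A * υ₁ x ^ n) → (∀ x, ‖g x‖ ≤ B * υ₂ x ^ n) → Λ n (tensorₗ f g) = φ f g :=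
    fun n f g A B hA hB hf hg => eq_of_hasSum_bilinear φ hC hφ (e₁ n) (e₂ n) hA hB hf hg
      (hΛ n _ (A * B) (mul_nonneg hA hB) (norm_tensorₗ_le le_rfl le_rfl hA hB hf hg)).1
  -- `Λ N` extends `Λ n` for large `N`, since both agree on the terms of the expansion
  have hcons : ∀ (n : ℕ) (F : HolInf (I₁.prod I₂) υ) (B : ℝ), 0 ≤ B →
      (∀ z, ‖F z‖ ≤ B * υ z ^ n) → ∀ N, max (m₁ n) (m₂ n) ≤ N → Λ N F = Λ n F := by
    intro n F B hB hF N hN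
    have h1 := (e n).hasSum_apply hB hF (Λ N) (hD N) fun G t ht hG =>
      (hΛ N G t ht fun z => (hG z).trans (υ.mul_pow_le_mul_pow hN ht z)).2
    refine h1.unique ?_
    have h2 := (hΛ n F B hB hF).1
    have h3 : ∀ k : κ n × l n, Λ N ((e n).fnInf k) =
        φ ((e₁ n).fnInf k.1) ((e₂ n).fnInf k.2) := fun k =>
      hΛt N ((e₁ n).fnInf k.1) ((e₂ n).fnInf k.2) 1 1 zero_le_one zero_le_one
        (fun x => ((e₁ n).norm_fnInf_le k.1 x).trans
          (υ₁.mul_pow_le_mul_pow ((le_max_left _ _).trans hN) zero_le_one x))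
        (fun x => ((e₂ n).norm_fnInf_le k.2 x).trans
          (υ₂.mul_pow_le_mul_pow ((le_max_right _ _).trans hN) zero_le_one x))
    simp only [h3]
    exact h2
  have hev : ∀ F : HolInf (I₁.prod I₂) υ, ∃ c, ∀ᶠ N in atTop, Λ N F = c := fun F => by
    obtain ⟨n, B, hB, hF⟩ := F.exists_bound
    exact ⟨Λ n F, (eventually_ge_atTop (max (m₁ n) (m₂ n))).mono fun N hN => hcons n F B hB hF N hN⟩
  choose c hc using hev
  have huniq : ∀ F a, (∀ᶠ N in atTop, Λ N F = a) → c F = a := fun F a ha => by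
    obtain ⟨N, h1, h2⟩ := ((hc F).and ha).exists
    exact h1.symm.trans h2
  let ψ : HolInf (I₁.prod I₂) υ →ₗ[ℂ] ℂ :=
    { toFun := c
      map_add' := fun F G => huniq _ _ (by
        filter_upwards [hc F, hc G] with N h1 h2
        rw [map_add, h1, h2])
      map_smul' := fun t F => huniq _ _ (by
        filter_upwards [hc F] with N h1
        rw [map_smul, h1, RingHom.id_apply]) }
  refine ⟨ψ, fun f g => huniq _ _ ?_, fun n F B hB hF => ?_⟩
  · obtain ⟨n₁, A, hA, hf⟩ := f.exists_bound
    obtain ⟨n₂, B, hB, hg⟩ := g.exists_bound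
    filter_upwards [eventually_ge_atTop (max n₁ n₂)] with N hN
    exact hΛt N f g A B hA hB
      (fun x => (hf x).trans (υ₁.mul_pow_le_mul_pow ((le_max_left _ _).trans hN) hA x))
      fun x => (hg x).trans (υ₂.mul_pow_le_mul_pow ((le_max_right _ _).trans hN) hB x)
  · have h1 : ψ F = Λ n F := huniq _ _
      ((eventually_ge_atTop (max (m₁ n) (m₂ n))).mono fun N hN => hcons n F B hB hF N hN)
    rw [h1]
    exact (hΛ n F B hB hF).2

attribute [local instance] uniformSpace

/-- The isomorphism `𝒪_{υ₁^∞}(M₁) ⊗̂ 𝒪_{υ₂^∞}(M₂) ≅ 𝒪_{υ^∞}(M₁ × M₂)`. -/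
theorem exists_tensor_equiv [I₂.Boundaryless] [IsManifold I₂ 1 M₂] [T2Space M₁] [T2Space M₂]
    (h₁ : HasExpansions I₁ υ₁) (h₂ : HasExpansions I₂ υ₂) :
    ∃ Ψ : CompletedTensor (HolInf I₁ υ₁) (HolInf I₂ υ₂) ≃L[ℂ] HolInf (I₁.prod I₂) (υ₁.prod υ₂),
      ∀ f g, Ψ (ctmul f g) = tensorₗ f g := by
  have hprod : HasExpansions (I₁.prod I₂) (υ₁.prod υ₂) := fun n => by
    obtain ⟨m₁, κ, ⟨e₁⟩⟩ := h₁ n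
    obtain ⟨m₂, l, ⟨e₂⟩⟩ := h₂ n
    exact ⟨_, _, ⟨e₁.prod e₂⟩⟩
  have := isUniformAddGroup (I := I₁.prod I₂) (υ := υ₁.prod υ₂)
  have := completeSpace hprod
  refine exists_completedTensor_equiv tensorₗ continuous_tensorₗ (dense_span_tensorₗ h₁ h₂)
    fun r hr => ?_
  have := polynormableSpace_of_locallyConvexSpace (HolInf I₁ υ₁)
  have := polynormableSpace_of_locallyConvexSpace (HolInf I₂ υ₂)
  obtain ⟨p, q, hp, hq, hpq⟩ := exists_seminorm_mul_bound
    (ProjTensor.mk (HolInf I₁ υ₁) (HolInf I₂ υ₂)) continuous_tmul hr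
  choose P hP0 hP using exists_seminorm_bound hp
  choose Q hQ0 hQ using exists_seminorm_bound hq
  obtain ⟨D, hD⟩ := exists_factor_bilinear h₁ h₂ (C := fun n => P n * Q n)
    fun n => mul_nonneg (hP0 n) (hQ0 n)
  let ι := {ψ : HolInf (I₁.prod I₂) (υ₁.prod υ₂) →ₗ[ℂ] ℂ //
    ∀ (n : ℕ) (F : HolInf (I₁.prod I₂) (υ₁.prod υ₂)) (B : ℝ), 0 ≤ B →
      (∀ z, ‖F z‖ ≤ B * υ₁.prod υ₂ z ^ n) → ‖ψ F‖ ≤ D n * B}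
  obtain ⟨s, hs, hsV⟩ := exists_seminorm_of_absConvex (absConvex_setOf_forall_le
    (fun ψ : ι => (normSeminorm ℂ ℂ).comp ψ.1) fun _ => 1) fun n => ⟨(|D n| + 1)⁻¹, by positivity, by
      rintro F hF ⟨ψ, hψ⟩
      refine (hψ n F _ (by positivity) hF).trans ?_
      rw [← div_eq_mul_inv, div_le_one (by positivity)]
      linarith [le_abs_self (D n)]⟩
  refine ⟨{F | s F < 1}, (isOpen_lt hs continuous_const).mem_nhds (by simp), fun φ hφ => ?_⟩
  obtain ⟨ψ, hψ, hψD⟩ := hD ((ProjTensor.mk _ _).compr₂ φ) fun n f g A B hA hB hf hg => by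
    calc ‖φ (ProjTensor.tmul f g)‖ ≤ p f * q g := (hφ _).trans (hpq f g)
      _ ≤ P n * A * (Q n * B) := mul_le_mul (hP n f A hA hf) (hQ n g B hB hg) (apply_nonneg _ _)
        (mul_nonneg (hP0 n) hA)
      _ = P n * Q n * (A * B) := by ring
  exact ⟨ψ, hψ, fun F hF => hsV F hF ⟨ψ, hψD⟩⟩

end HolInf

end Product

end AnalyticFunctional

end

open AnalyticFunctional in
theorem proposition5p6
    {E₁ E₂ : Type*} [NormedAddCommGroup E₁] [NormedSpace ℂ E₁] [FiniteDimensional ℂ E₁]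
    [NormedAddCommGroup E₂] [NormedSpace ℂ E₂] [FiniteDimensional ℂ E₂]
    {H₁ H₂ : Type*} [TopologicalSpace H₁] [TopologicalSpace H₂]
    (I₁ : ModelWithCorners ℂ E₁ H₁) [I₁.Boundaryless]
    (I₂ : ModelWithCorners ℂ E₂ H₂) [I₂.Boundaryless]
    (M₁ M₂ : Type*)
    [TopologicalSpace M₁] [T2Space M₁] [SecondCountableTopology M₁]
    [ChartedSpace H₁ M₁] [IsManifold I₁ 1 M₁]
    [TopologicalSpace M₂] [T2Space M₂] [SecondCountableTopology M₂]
    [ChartedSpace H₂ M₂] [IsManifold I₂ 1 M₂]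
    (υ₁ : Weight M₁) (υ₂ : Weight M₂) :
    (∃ Φ : CompletedTensor (AWeighted I₁ υ₁) (AWeighted I₂ υ₂) ≃L[ℂ]
        AWeighted (I₁.prod I₂) (υ₁.prod υ₂),
      ∀ (a : AFun I₁ M₁) (b : AFun I₂ M₂),
        Φ (ctmul (a.toWeighted υ₁) (b.toWeighted υ₂)) =
          (AFun.prod a b).toWeighted (υ₁.prod υ₂)) ∧
    (∃ Φ : CompletedTensor (AWeightedInf I₁ υ₁) (AWeightedInf I₂ υ₂) ≃L[ℂ]
        AWeightedInf (I₁.prod I₂) (υ₁.prod υ₂),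
      ∀ (a : AFun I₁ M₁) (b : AFun I₂ M₂),
        Φ (ctmul (a.toWeightedInf υ₁) (b.toWeightedInf υ₂)) =
          (AFun.prod a b).toWeightedInf (υ₁.prod υ₂)) ∧
    (IsNuclear (AWeightedInf I₁ υ₁) → IsNuclear (AWeightedInf I₂ υ₂) →
      ∃ Ψ : CompletedTensor (HolInf I₁ υ₁) (HolInf I₂ υ₂) ≃L[ℂ] HolInf (I₁.prod I₂) (υ₁.prod υ₂),
        ∀ (f : HolInf I₁ υ₁) (g : HolInf I₂ υ₂) (x : M₁) (y : M₂),
          Ψ (ctmul f g) (x, y) = f x * g y) := by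
  refine ⟨exists_aWeighted_tensor_equiv υ₁ υ₂, exists_aWeightedInf_tensor_equiv υ₁ υ₂,
    fun h₁ h₂ => ?_⟩
  obtain ⟨Ψ, hΨ⟩ := HolInf.exists_tensor_equiv (hasExpansions_of_isNuclear h₁)
    (hasExpansions_of_isNuclear h₂)
  exact ⟨Ψ, fun f g x y => by rw [hΨ, HolInf.tensorₗ_apply]⟩
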